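/- Let $A$ be a bounded operator on a nonzero complex Hilbert space $H$ and let $\Omega\subseteq\mathbb{C}$ be a bounded convex open set whose boundary $\partial\Omega$ is an embedded smooth submanifold of $\mathbb{C}$, such that $\Omega$ contains the spectrum of $A$. Write $\Omega^{-}$ for the closure of $\Omega$, $n_\Omega(\sigma)$ for the outward unit normal at $\sigma\in\partial\Omega$, $|\mathrm{d}\sigma|$ for arc length on $\partial\Omega$, and $*$ for complex conjugates and adjoints. Let $\mathcal{C}(\partial\Omega)$ be the space of continuous functions $\partial\Omega\to\mathbb{C}$ with the supremum norm. Let $\mathcal{A}(\Omega^{-})$ be the space of continuous functions on $\Omega^{-}$ that are analytic on $\Omega$, regarded as a subspace of $\mathcal{C}(\partial\Omega)$ via boundary values, and let $\mathcal{H}(\Omega^{-})$ be the uniform closure of $\mathcal{A}(\Omega^{-})+\mathcal{A}(\Omega^{-})^{*}$ in $\mathcal{C}(\partial\Omega)$. For $f\in\mathcal{A}(\Omega^{-})$ put $$\gamma(f)=\frac{1}{2\pi i}\int_{\partial\Omega}f(\sigma)(\sigma-A)^{-1}\,\mathrm{d}\sigma ,$$ where $\partial\Omega$ is positively oriented, that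 is, $\mathrm{d}\sigma=i\,n_\Omega(\sigma)\,|\mathrm{d}\sigma|$. There is exactly one bounded operator $K_\Omega^{\mathrm{i}}\colon\mathcal{C}(\partial\Omega)\to\mathcal{H}(\Omega^{-})$ (the interior double-layer transform) such that, for every Hölder continuous $\varphi$, the function $$z\mapsto\int_{\partial\Omega}\varphi(\sigma)\,\frac1\pi\operatorname{Re}\Big(\frac{n_\Omega(\sigma)}{\sigma-z}\Big)\,|\mathrm{d}\sigma|,\qquad z\in\Omega,$$ extends continuously to $\Omega^{-}$ with boundary values $K_\Omega^{\mathrm{i}}(\varphi)$. There is exactly one bounded operator $\hat\gamma\colon\mathcal{H}(\Omega^{-})\to\mathcal{L}(H)$ (the harmonic functional calculus of $A$ on $\Omega$) such that $\hat\gamma(f+g^{*})=\gamma(f)+\gamma(g)^{*}$ for all $f,g\in\mathcal{A}(\Omega^{-})$. Moreover, the following assertions are equivalent: (i) $\Omega^{-}$ contains the numerical range $W(A)=\{\langle Ax,x\rangle : x\in H,\ \|x\|=1\}$; (ii) $\hat\gamma\circ K_\Omega^{\mathrm{i}}\colon\mathcal{C}(\partial\Omega)\to\mathcal{L}(H)$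 is positive, that is, it maps nonnegative functions to positive operators; (iii) the operator norm of $\hat\gamma\circ K_\Omega^{\mathrm{i}}$ equals $2$. -/

import Mathlib

open scoped ContDiff ComplexOrder MeasureTheory

/-- A smoothly bounded open subset `Ω` of the complex plane: `Ω` is open and bounded, and its
topological boundary `∂Ω` is an embedded smooth submanifold of the plane (a smooth curve), i.e. near
each of its points `∂Ω` is the zero set of a smooth real-valued function with nonvanishing
differential. -/
structure SmoothlyBoundedSet where
  carrier : Set ℂ
  isOpen : IsOpen carrier
  isBounded : Bornology.IsBounded carrier
  smooth_frontier : ∀ p ∈ frontier carrier, ∃ (U : Set ℂ) (ρ : ℂ → ℝ),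
    IsOpen U ∧ p ∈ U ∧ ContDiffOn ℝ ∞ ρ U ∧ (∀ z ∈ U, fderiv ℝ ρ z ≠ 0) ∧
      frontier carrier ∩ U = {z ∈ U | ρ z = 0}

/-- The boundary `∂Ω`. -/
abbrev SmoothlyBoundedSet.bdry (Ω : SmoothlyBoundedSet) : Set ℂ := frontier Ω.carrier

/-- `∂Ω` is compact, so that `C(∂Ω, ℂ)` carries the supremum norm. -/
instance SmoothlyBoundedSet.compactSpace_bdry (Ω : SmoothlyBoundedSet) : CompactSpace Ω.bdry :=
  isCompact_iff_compactSpace.mp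
    (Ω.isBounded.isCompact_closure.of_isClosed_subset isClosed_frontier frontier_subset_closure)

/-- `ν` is the outward unit normal vector of the set `S` at the boundary point `σ`: the directions
`v` in the open half-plane `⟨v, ν⟩ < 0` point into `S`, and those in the open half-plane
`0 < ⟨v, ν⟩` point into the exterior of `S`. In particular `ν` is orthogonal to the tangent line
of the boundary. There is at most one such `ν`. -/
def IsOutwardUnitNormal (S : Set ℂ) (σ ν : ℂ) : Prop :=
  ‖ν‖ = 1 ∧
    (∀ v : ℂ, inner ℝ v ν < 0 → ∀ᶠ t : ℝ in nhdsWithin 0 (Set.Ioi 0), σ + t • v ∈ S) ∧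
    (∀ v : ℂ, 0 < inner ℝ v ν → ∀ᶠ t : ℝ in nhdsWithin 0 (Set.Ioi 0), σ + t • v ∉ closure S)

/-- The outward unit normal vector `n_Ω(σ)` at `σ ∈ ∂Ω`. -/
noncomputable def SmoothlyBoundedSet.normal (Ω : SmoothlyBoundedSet) (σ : ℂ) : ℂ :=
  Classical.epsilon (IsOutwardUnitNormal Ω.carrier σ)

/-- The double-layer potential `P_Ω(σ, z) = (1/π) Re (n_Ω(σ) / (σ - z))`. -/
noncomputable def SmoothlyBoundedSet.doubleLayerPotential (Ω : SmoothlyBoundedSet) (σ z : ℂ) : ℝ :=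
  (1 / Real.pi) * (Ω.normal σ / (σ - z)).re

/-- The algebra `𝒜(Ω⁻)` of continuous functions on the closure `Ω⁻` that are analytic on `Ω`,
identified with the space of its boundary values in `C(∂Ω, ℂ)`. (The identification is isometric by
the maximum modulus principle.) -/
def SmoothlyBoundedSet.analyticSpace (Ω : SmoothlyBoundedSet) : Submodule ℂ C(Ω.bdry, ℂ) where
  carrier := {f | ∃ F : ℂ → ℂ, DiffContOnCl ℂ F Ω.carrier ∧ ∀ σ : Ω.bdry, F σ = f σ}
  add_mem' := by
    rintro f g ⟨F, hF, hFf⟩ ⟨G, hG, hGg⟩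
    exact ⟨F + G, hF.add hG, fun σ => by simp [hFf, hGg]⟩
  zero_mem' := ⟨fun _ => 0, diffContOnCl_const, fun _ => rfl⟩
  smul_mem' := by
    rintro c f ⟨F, hF, hFf⟩
    exact ⟨c • F, hF.const_smul c, fun σ => by simp [hFf]⟩

/-- The space `ℋ(Ω⁻)`: the uniform closure of `𝒜(Ω⁻) + 𝒜(Ω⁻)*` in `C(∂Ω, ℂ)`, where `*` is
pointwise complex conjugation. -/
noncomputable def SmoothlyBoundedSet.harmonicSpace (Ω : SmoothlyBoundedSet) :
    Submodule ℂ C(Ω.bdry, ℂ) :=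
  (Ω.analyticSpace ⊔ Ω.analyticSpace.map
    (starLinearEquiv ℂ (A := C(Ω.bdry, ℂ))).toLinearMap).topologicalClosure

theorem SmoothlyBoundedSet.add_star_mem_harmonicSpace (Ω : SmoothlyBoundedSet)
    (f g : Ω.analyticSpace) :
    (f : C(Ω.bdry, ℂ)) + star (g : C(Ω.bdry, ℂ)) ∈ Ω.harmonicSpace :=
  Submodule.le_topologicalClosure _
    (Submodule.add_mem_sup f.2 (Submodule.mem_map_of_mem (f := (starLinearEquiv ℂ
      (A := C(Ω.bdry, ℂ))).toLinearMap) g.2))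

/-- The sum `f + g*` of `f ∈ 𝒜(Ω⁻)` and the conjugate of `g ∈ 𝒜(Ω⁻)`, as an element of
`ℋ(Ω⁻)`. -/
noncomputable def SmoothlyBoundedSet.addStar (Ω : SmoothlyBoundedSet) (f g : Ω.analyticSpace) :
    Ω.harmonicSpace :=
  ⟨(f : C(Ω.bdry, ℂ)) + star (g : C(Ω.bdry, ℂ)), Ω.add_star_mem_harmonicSpace f g⟩

/-- `φ` is Hölder continuous with some positive exponent. -/
def IsHolder {X : Type*} [MetricSpace X] (φ : X → ℂ) : Prop :=
  ∃ c α : NNReal, 0 < α ∧ HolderWith c α φ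

/-- `K` is the interior double-layer transform `K_Ω^i : C(∂Ω) → ℋ(Ω⁻)`: the bounded operator which
sends a Hölder continuous function `φ` to (the boundary values of) the continuous extension to `Ω⁻`
of the function `z ↦ ∫_{∂Ω} φ(σ) P_Ω(σ, z) |dσ|` on `Ω`. Here `|dσ|` is arc length, that is the
one-dimensional Hausdorff measure. -/
def SmoothlyBoundedSet.IsInteriorDoubleLayerTransform (Ω : SmoothlyBoundedSet)
    (K : C(Ω.bdry, ℂ) →L[ℂ] Ω.harmonicSpace) : Prop :=
  ∀ φ : C(Ω.bdry, ℂ), IsHolder φ →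
    ∃ u : ℂ → ℂ, ContinuousOn u (closure Ω.carrier) ∧
      (∀ z ∈ Ω.carrier,
        u z = ∫ σ : Ω.bdry, φ σ * (Ω.doubleLayerPotential σ z : ℂ) ∂μH[1]) ∧
      ∀ σ : Ω.bdry, u σ = (K φ : C(Ω.bdry, ℂ)) σ

section Operator

variable {H : Type*} [NormedAddCommGroup H] [InnerProductSpace ℂ H] [CompleteSpace H]

/-- The numerical range `W(A) = {⟨Ax, x⟩ : ‖x‖ = 1}`. -/
def numericalRange (A : H →L[ℂ] H) : Set ℂ :=
  {w | ∃ x : H, ‖x‖ = 1 ∧ inner ℂ x (A x) = w}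

/-- The analytic functional calculus
`γ(f) = (1/(2πi)) ∫_{∂Ω} f(σ) (σ - A)⁻¹ dσ` for `f ∈ 𝒜(Ω⁻)`. As `∂Ω` is positively oriented with
respect to the outward normal, `dσ = i n_Ω(σ) |dσ|`. -/
noncomputable def SmoothlyBoundedSet.analyticCalculus (Ω : SmoothlyBoundedSet) (A : H →L[ℂ] H)
    (f : Ω.analyticSpace) : H →L[ℂ] H :=
  (1 / (2 * Real.pi * Complex.I) : ℂ) •
    ∫ σ : Ω.bdry, ((f : C(Ω.bdry, ℂ)) σ * (Complex.I * Ω.normal σ)) • resolvent A (σ : ℂ) ∂μH[1]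

/-- `Γ` is the harmonic functional calculus `γ̂ : ℋ(Ω⁻) → 𝓛(H)` of `A` on `Ω`: the bounded operator
with `γ̂(f + g*) = γ(f) + γ(g)*` for all `f, g ∈ 𝒜(Ω⁻)`. -/
def SmoothlyBoundedSet.IsHarmonicCalculus (Ω : SmoothlyBoundedSet) (A : H →L[ℂ] H)
    (Γ : Ω.harmonicSpace →L[ℂ] (H →L[ℂ] H)) : Prop :=
  ∀ f g : Ω.analyticSpace,
    Γ (Ω.addStar f g) =
      Ω.analyticCalculus A f + ContinuousLinearMap.adjoint (Ω.analyticCalculus A g)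

/-- A linear map `T : C(X) → 𝓛(H)` is positive if it maps nonnegative functions to positive
operators. -/
def IsPositiveMap {X : Type*} [TopologicalSpace X] [CompactSpace X]
    (T : C(X, ℂ) →L[ℂ] (H →L[ℂ] H)) : Prop :=
  ∀ φ : C(X, ℂ), (∀ x, 0 ≤ φ x) → (T φ).IsPositive

end Operator

/-! Everything rests on one formula: `γ̂ ∘ K` is integration against an operator-valued kernel, `φ ↦
∫ φ(σ) P(σ) |dσ|`, where `P(σ) = (1/π) Re (n(σ) (σ - A)⁻¹)` is `resolventKernel` (see
`IsHarmonicCalculus.map_doubleLayerTransform`). Its total mass is `2 • 1`, because the resolvent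
integrates to `2πi` around the spectrum.

Put `x = (σ - A) y` with `‖y‖ = 1`. Then `⟨P(σ) x, x⟩` is, up to the factor `1/π`, the signed
distance from `⟨A y, y⟩` to the supporting line of `Ω` at `σ`. A convex `Ω⁻` is the intersection of
its supporting half-planes, so `W(A) ⊆ Ω⁻` means that `P(σ) ≥ 0` for every `σ`
(`numericalRange_subset_iff`). Since `P` is continuous and arc length charges every open subset of
`∂Ω`, this is the same as positivity of the integrated map. A positive kernel of mass `2` gives norm
at most `2`, attained at `φ = 1`. Conversely, a map of norm at most `2` that sends `1` to `2` is
positive (`isPositiveMap_of_norm_le`).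

The kernel formula is reached by dilation. The potential `P_Ω(σ, ·)` is singular at `σ`, but
composed with `z ↦ z₀ + r (z - z₀)`, `r < 1`, it lies in `𝒜 + 𝒜*`. There `γ̂` is computed by a
resolvent identity and Cauchy's theorem (`analyticCalculus_cauchyKernel`), and then `r → 1`.

The operator `K` exists because, by convexity, the potential is a nonnegative kernel of mass `2`.
This gives continuity up to the boundary for every continuous density. The operator `γ̂` exists
because a bound on `f + g*` controls `Re (f + g)` and `Im (f - g)`, hence `f` and `g` up to
constants on a smaller contour that still encloses the spectrum
(`exists_norm_calculus_add_adjoint_le`).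

Contour integrals against Hausdorff measure are made computable by parametrizing `∂Ω` in polar
coordinates with the gauge. Continuity of the normal makes this curve `C¹`. -/

section

open Set Filter Topology

/-! ### Existence, supporting property and continuity of the outward normal. -/

theorem continuous_of_isClosed_graph_of_compactSpace {X Y : Type*} [TopologicalSpace X]
    [TopologicalSpace Y] [CompactSpace Y] {f : X → Y} (hf : IsClosed {p : X × Y | f p.1 = p.2}) :
    Continuous f := by
  refine continuous_iff_isClosed.2 fun C hC => ?_
  have : f ⁻¹' C = Prod.fst '' ({p : X × Y | f p.1 = p.2} ∩ Prod.snd ⁻¹' C) := by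
    ext x
    simp
  rw [this]
  exact isClosedMap_fst_of_compactSpace _ (hf.inter (hC.preimage continuous_snd))

/-- Convexity puts `σ + t (z₀ - σ)` in `S`. The segment from there to `σ + t v` lies where the
linear part of `ρ` is positive, so for small `t` it misses the zero set of `ρ` and hence the
frontier. By connectedness its other end is in `S` too. -/
theorem eventually_add_smul_mem_of_fderiv_pos {S U : Set ℂ} {ρ : ℂ → ℝ} {σ z₀ : ℂ}
    (hS : IsOpen S) (hc : Convex ℝ S) (hσ : σ ∈ frontier S) (hU : U ∈ 𝓝 σ) {L : ℂ →L[ℝ] ℝ}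
    (hρ : HasFDerivAt ρ L σ) (hρ0 : ρ σ = 0) (hfr : ∀ z ∈ U, z ∈ frontier S → ρ z = 0)
    (hz₀ : z₀ ∈ S) (hL : 0 < L (z₀ - σ)) {v : ℂ} (hv : 0 < L v) :
    ∀ᶠ t : ℝ in 𝓝[>] 0, σ + t • v ∈ S := by
  set v₀ := z₀ - σ with hv₀
  set c := min (L v₀) (L v) with hcdef
  have hcpos : 0 < c := lt_min hL hv
  set M := max ‖v₀‖ ‖v‖ + 1 with hM
  have hMpos : 0 < M := by positivity
  -- Directions `h` along the segment satisfy `L h ≥ c` and `‖h‖ ≤ M`, so this tolerance keeps the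
  -- linearization error below `t c / 2`, half of the main term.
  have hlit := (hρ.isLittleO.bound (c := c / (2 * M)) (by positivity)).and hU
  obtain ⟨δ, hδ, hball⟩ := Metric.mem_nhds_iff.1 hlit
  have ht : ∀ᶠ t : ℝ in 𝓝[>] 0, t < min 1 (δ / M) :=
    nhdsWithin_le_nhds (gt_mem_nhds (by positivity))
  filter_upwards [ht, self_mem_nhdsWithin] with t ht1 ht0
  have ht0 : 0 < t := ht0
  have hseg : ∀ z ∈ segment ℝ (σ + t • v₀) (σ + t • v), z ∉ frontier S := by
    rintro z ⟨a, b, ha, hb, hab, rfl⟩ hz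
    have e : a • (σ + t • v₀) + b • (σ + t • v) = σ + t • (a • v₀ + b • v) := by
      have : (a : ℂ) + b = 1 := by exact_mod_cast hab
      simp only [Complex.real_smul]
      linear_combination σ * this
    rw [e] at hz
    set h := a • v₀ + b • v with hh
    have hnorm : ‖h‖ ≤ M := by
      calc ‖h‖ ≤ ‖a • v₀‖ + ‖b • v‖ := norm_add_le _ _
        _ = a * ‖v₀‖ + b * ‖v‖ := by
          rw [norm_smul, norm_smul, Real.norm_of_nonneg ha, Real.norm_of_nonneg hb]
        _ ≤ a * max ‖v₀‖ ‖v‖ + b * max ‖v₀‖ ‖v‖ := by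
          gcongr
          · exact le_max_left _ _
          · exact le_max_right _ _
        _ ≤ M := by rw [← add_mul, hab, one_mul, hM]; linarith
    have hLh : c ≤ L h := by
      have : L h = a * L v₀ + b * L v := by rw [hh, map_add, map_smul, map_smul]; rfl
      rw [this]
      calc c = a * c + b * c := by rw [← add_mul, hab, one_mul]
        _ ≤ _ := by
          gcongr
          · exact min_le_left _ _
          · exact min_le_right _ _
    have hin : σ + t • h ∈ Metric.ball σ δ := by
      rw [mem_ball_iff_norm, add_sub_cancel_left, norm_smul, Real.norm_of_nonneg ht0.le]
      calc t * ‖h‖ ≤ t * M := by gcongr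
        _ < δ := by
          rw [← lt_div_iff₀ hMpos]; exact ht1.trans_le (min_le_right _ _)
    obtain ⟨hb1, hb2⟩ := hball hin
    rw [hfr _ hb2 hz, hρ0, add_sub_cancel_left, sub_zero, zero_sub, norm_neg, norm_smul,
      Real.norm_of_nonneg ht0.le, map_smul, smul_eq_mul] at hb1
    have h1 : t * c ≤ t * L h := by gcongr
    have h2 : t * L h ≤ ‖t * L h‖ := Real.le_norm_self _
    have h3 : c / (2 * M) * (t * ‖h‖) ≤ c / (2 * M) * (t * M) := by gcongr
    have h4 : c / (2 * M) * (t * M) = t * c / 2 := by field_simp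
    have h5 : 0 < t * c := by positivity
    linarith
  have hz1 : σ + t • v₀ ∈ S := by
    have := hc.add_smul_sub_mem_interior' (frontier_subset_closure hσ)
      (hS.interior_eq.symm ▸ hz₀) (t := t) ⟨ht0, (ht1.trans_le (min_le_left _ _)).le⟩
    rwa [hS.interior_eq] at this
  refine (convex_segment (𝕜 := ℝ) (σ + t • v₀) (σ + t • v)).isPreconnected.subset_left_of_subset_union
    hS isClosed_closure.isOpen_compl (disjoint_compl_right.mono_left subset_closure)
    (v := (closure S)ᶜ) (fun z hz => ?_) ⟨_, left_mem_segment _ _ _, hz1⟩ (right_mem_segment _ _ _)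
  by_contra! hcon
  rw [mem_union, not_or, mem_compl_iff, not_not] at hcon
  exact hseg z hz (hS.frontier_eq ▸ ⟨hcon.2, hcon.1⟩)

/-- As `S` is open and the differential is nonzero, some point of `S` is off the tangent line. It
fixes the sign of `ρ`, and the normal is minus the normalized gradient. For outward `v` the point `σ
- t v` is in `S`; were `σ + t v` in the closure, the midpoint `σ` would be interior. -/
theorem exists_isOutwardUnitNormal {S U : Set ℂ} {ρ : ℂ → ℝ} {σ : ℂ}
    (hS : IsOpen S) (hc : Convex ℝ S) (hne : S.Nonempty) (hσ : σ ∈ frontier S) (hU : U ∈ 𝓝 σ)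
    (hρ : DifferentiableAt ℝ ρ σ) (hd : fderiv ℝ ρ σ ≠ 0) (hρ0 : ρ σ = 0)
    (hfr : ∀ z ∈ U, z ∈ frontier S → ρ z = 0) : ∃ ν, IsOutwardUnitNormal S σ ν := by
  set L := fderiv ℝ ρ σ with hL
  obtain ⟨z₀, hz₀, hLz⟩ : ∃ z₀ ∈ S, L (z₀ - σ) ≠ 0 := by
    obtain ⟨z₁, hz₁⟩ := hne
    by_contra! hcon
    obtain ⟨v, hv⟩ : ∃ v, L v ≠ 0 := by
      by_contra! h; exact hd (ContinuousLinearMap.ext h)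
    have hcont : Tendsto (fun t : ℝ => z₁ + t • v) (𝓝[≠] 0) (𝓝 z₁) := by
      have : Continuous fun t : ℝ => z₁ + t • v := by fun_prop
      simpa using (this.tendsto 0).mono_left nhdsWithin_le_nhds
    obtain ⟨t, ht, ht0⟩ := ((hcont.eventually (hS.mem_nhds hz₁)).and self_mem_nhdsWithin).exists
    have h1 := hcon _ ht
    have h2 := hcon _ hz₁
    rw [add_sub_right_comm, map_add, h2, zero_add, map_smul, smul_eq_mul] at h1
    exact (mul_ne_zero ht0 hv) h1
  have key : ∃ L' : ℂ →L[ℝ] ℝ, L' ≠ 0 ∧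
      ∀ v, 0 < L' v → ∀ᶠ t : ℝ in 𝓝[>] 0, σ + t • v ∈ S := by
    rcases lt_or_gt_of_ne hLz with h | h
    · refine ⟨-L, neg_ne_zero.2 hd, fun v hv => ?_⟩
      exact eventually_add_smul_mem_of_fderiv_pos (ρ := -ρ) hS hc hσ hU hρ.hasFDerivAt.neg
        (by simp [hρ0]) (fun z hz hz' => by simp [hfr z hz hz']) hz₀ (by simpa using h) hv
    · exact ⟨L, hd, fun v hv => eventually_add_smul_mem_of_fderiv_pos hS hc hσ hU hρ.hasFDerivAt
        hρ0 hfr hz₀ h hv⟩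
  obtain ⟨L', hL'0, hL'⟩ := key
  set w := (InnerProductSpace.toDual ℝ ℂ).symm L' with hw
  have hwL : ∀ v, inner ℝ w v = L' v := fun v => InnerProductSpace.toDual_symm_apply
  have hw0 : 0 < ‖w‖ := by
    rw [norm_pos_iff]; intro h
    exact hL'0 (ContinuousLinearMap.ext fun v => by rw [← hwL, h]; simp)
  have hν : ∀ v, inner ℝ v (-(‖w‖⁻¹ • w)) = -(‖w‖⁻¹ * L' v) := by
    intro v
    rw [inner_neg_right, inner_smul_right, real_inner_comm, hwL]
  have hin : ∀ v : ℂ, inner ℝ v (-(‖w‖⁻¹ • w)) < 0 → ∀ᶠ t : ℝ in 𝓝[>] 0, σ + t • v ∈ S := by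
    intro v hv
    rw [hν] at hv
    refine hL' v ?_
    by_contra! h
    have : ‖w‖⁻¹ * L' v ≤ 0 := mul_nonpos_of_nonneg_of_nonpos (by positivity) h
    linarith
  refine ⟨-(‖w‖⁻¹ • w), ?_, hin, fun v hv => ?_⟩
  · rw [norm_neg, norm_smul, norm_inv, norm_norm, inv_mul_cancel₀ hw0.ne']
  · have h1 := hin (-v) (by rw [inner_neg_left]; linarith)
    filter_upwards [h1] with t ht hcl
    have := hc.add_smul_sub_mem_interior' hcl (hS.interior_eq.symm ▸ ht) (t := 1 / 2)
      ⟨by norm_num, by norm_num⟩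
    rw [show σ + t • v + (1 / 2 : ℝ) • (σ + t • -v - (σ + t • v)) = σ by
      simp only [Complex.real_smul]; push_cast; ring, hS.interior_eq] at this
    rw [hS.frontier_eq] at hσ
    exact hσ.2 this

namespace SmoothlyBoundedSet

variable (Ω : SmoothlyBoundedSet)

theorem isOutwardUnitNormal_normal (hΩ : Convex ℝ Ω.carrier) {σ : ℂ}
    (hσ : σ ∈ Ω.bdry) : IsOutwardUnitNormal Ω.carrier σ (Ω.normal σ) := by
  refine Classical.epsilon_spec (p := IsOutwardUnitNormal Ω.carrier σ) ?_
  obtain ⟨U, ρ, hU, hσU, hρ, hd, hfr⟩ := Ω.smooth_frontier σ hσ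
  have hmem : ∀ z ∈ U, z ∈ frontier Ω.carrier → ρ z = 0 := fun z hz hz' =>
    ((Set.ext_iff.1 hfr z).1 ⟨hz', hz⟩).2
  refine exists_isOutwardUnitNormal Ω.isOpen hΩ ?_ hσ (hU.mem_nhds hσU)
    ((hρ.contDiffAt (hU.mem_nhds hσU)).differentiableAt (by simp)) (hd σ hσU) (hmem σ hσU hσ) hmem
  exact closure_nonempty_iff.1 ⟨σ, frontier_subset_closure hσ⟩

theorem norm_normal (hΩ : Convex ℝ Ω.carrier) {σ : ℂ} (hσ : σ ∈ Ω.bdry) :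
    ‖Ω.normal σ‖ = 1 :=
  (Ω.isOutwardUnitNormal_normal hΩ hσ).1

theorem inner_sub_normal_nonpos (hΩ : Convex ℝ Ω.carrier) {σ z : ℂ} (hσ : σ ∈ Ω.bdry)
    (hz : z ∈ closure Ω.carrier) : inner ℝ (z - σ) (Ω.normal σ) ≤ 0 := by
  by_contra! h
  have h1 := (Ω.isOutwardUnitNormal_normal hΩ hσ).2.2 _ h
  have ht : ∀ᶠ t : ℝ in 𝓝[>] 0, t < 1 := nhdsWithin_le_nhds (gt_mem_nhds one_pos)
  obtain ⟨t, ⟨h1, h2⟩, h3⟩ := ((h1.and ht).and self_mem_nhdsWithin).exists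
  exact h1 (hΩ.closure.add_smul_sub_mem (frontier_subset_closure hσ) hz ⟨le_of_lt h3, h2.le⟩)

/-- The supporting inequality still holds at `z + t n`, which is in `Ω` for small `t > 0`, and this
makes it strict at `z`. -/
theorem inner_sub_normal_neg (hΩ : Convex ℝ Ω.carrier) {σ z : ℂ} (hσ : σ ∈ Ω.bdry)
    (hz : z ∈ Ω.carrier) : inner ℝ (z - σ) (Ω.normal σ) < 0 := by
  have hcont : Tendsto (fun t : ℝ => z + t • Ω.normal σ) (𝓝[>] 0) (𝓝 z) := by
    have : Continuous fun t : ℝ => z + t • Ω.normal σ := by fun_prop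
    simpa using (this.tendsto 0).mono_left nhdsWithin_le_nhds
  obtain ⟨t, ht, ht0⟩ := ((hcont.eventually (Ω.isOpen.mem_nhds hz)).and self_mem_nhdsWithin).exists
  have ht0 : 0 < t := ht0
  have := Ω.inner_sub_normal_nonpos hΩ hσ (subset_closure ht)
  rw [add_sub_right_comm, inner_add_left, real_inner_smul_left, real_inner_self_eq_norm_sq,
    Ω.norm_normal hΩ hσ] at this
  linarith

/-- If `m ≠ n`, the direction `m - n` has negative inner product with `n`, so it enters `Ω`. It has
positive inner product with `m`, so it violates the inequality for `m`. -/
theorem eq_normal_of_inner_nonpos (hΩ : Convex ℝ Ω.carrier) {σ m : ℂ} (hσ : σ ∈ Ω.bdry)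
    (hm : ‖m‖ = 1) (h : ∀ z ∈ Ω.carrier, inner ℝ (z - σ) m ≤ 0) : m = Ω.normal σ := by
  by_contra hne
  have hlt := (inner_lt_one_iff_real_of_norm_eq_one hm (Ω.norm_normal hΩ hσ)).2 hne
  have h1 := (Ω.isOutwardUnitNormal_normal hΩ hσ).2.1 (m - Ω.normal σ) (by
    rw [inner_sub_left, real_inner_self_eq_norm_sq, Ω.norm_normal hΩ hσ]; linarith)
  obtain ⟨t, ht, ht0⟩ := (h1.and self_mem_nhdsWithin).exists
  have ht0 : 0 < t := ht0
  have h2 := h _ ht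
  rw [add_sub_cancel_left, real_inner_smul_left, inner_sub_left, real_inner_self_eq_norm_sq, hm,
    real_inner_comm] at h2
  have : 0 < t * (1 ^ 2 - inner ℝ m (Ω.normal σ)) := mul_pos ht0 (by linarith)
  linarith

/-- The supporting inequalities over all `z ∈ Ω` determine the normal and are closed conditions on
the pair `(σ, m)`. So the graph is closed, and the unit circle is compact. -/
theorem continuous_normal (hΩ : Convex ℝ Ω.carrier) :
    Continuous fun σ : Ω.bdry => Ω.normal σ := by
  have hmem : ∀ σ : Ω.bdry, Ω.normal σ ∈ Metric.sphere (0 : ℂ) 1 := fun σ => by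
    simpa using Ω.norm_normal hΩ σ.2
  suffices Continuous fun σ : Ω.bdry => (⟨Ω.normal σ, hmem σ⟩ : Metric.sphere (0 : ℂ) 1) from
    continuous_subtype_val.comp this
  refine continuous_of_isClosed_graph_of_compactSpace ?_
  have : {p : Ω.bdry × Metric.sphere (0 : ℂ) 1 | (⟨Ω.normal p.1, hmem p.1⟩ : Metric.sphere (0 : ℂ) 1) = p.2} =
      ⋂ z ∈ Ω.carrier, {p | inner ℝ (z - p.1) (p.2 : ℂ) ≤ 0} := by
    ext ⟨σ, m⟩
    simp only [mem_ofPred_eq, mem_iInter]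
    constructor
    · rintro h z hz
      rw [← h]
      exact (Ω.inner_sub_normal_neg hΩ σ.2 hz).le
    · intro h
      exact Subtype.ext (Ω.eq_normal_of_inner_nonpos hΩ σ.2 (by simp) h).symm
  rw [this]
  exact isClosed_biInter fun z _ => isClosed_le (by fun_prop) continuous_const

end SmoothlyBoundedSet

/-! ### Polar parametrization of the boundary by the gauge. -/

namespace SmoothlyBoundedSet

variable (Ω : SmoothlyBoundedSet)

/-- The Minkowski functional of `Ω` with respect to the centre `z₀`. -/
noncomputable def gaugeAt (z₀ w : ℂ) : ℝ := gauge ((z₀ + ·) ⁻¹' Ω.carrier) w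

variable {Ω} {z₀ : ℂ}

theorem convex_preimage_add (hΩ : Convex ℝ Ω.carrier) : Convex ℝ ((z₀ + ·) ⁻¹' Ω.carrier) :=
  hΩ.translate_preimage_right z₀

theorem preimage_add_mem_nhds (hz₀ : z₀ ∈ Ω.carrier) : (z₀ + ·) ⁻¹' Ω.carrier ∈ 𝓝 (0 : ℂ) :=
  (Ω.isOpen.preimage (continuous_const_add z₀)).mem_nhds (by simpa using hz₀)

theorem continuous_gaugeAt (hΩ : Convex ℝ Ω.carrier) (hz₀ : z₀ ∈ Ω.carrier) :
    Continuous (Ω.gaugeAt z₀) :=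
  continuous_gauge (convex_preimage_add hΩ) (preimage_add_mem_nhds hz₀)

theorem gaugeAt_pos (hz₀ : z₀ ∈ Ω.carrier) {w : ℂ} (hw : w ≠ 0) : 0 < Ω.gaugeAt z₀ w := by
  refine (gauge_pos (absorbent_nhds_zero (preimage_add_mem_nhds hz₀)) ?_).2 hw
  rw [NormedSpace.isVonNBounded_iff]
  have := (isometry_add_left z₀).antilipschitz.isBounded_preimage Ω.isBounded
  exact this

theorem gaugeAt_smul {t : ℝ} (ht : 0 ≤ t) (w : ℂ) :
    Ω.gaugeAt z₀ (t • w) = t * Ω.gaugeAt z₀ w :=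
  gauge_smul_of_nonneg ht w

theorem gaugeAt_lt_one_iff (hΩ : Convex ℝ Ω.carrier) (hz₀ : z₀ ∈ Ω.carrier) {z : ℂ} :
    Ω.gaugeAt z₀ (z - z₀) < 1 ↔ z ∈ Ω.carrier := by
  rw [gaugeAt, gauge_lt_one_iff_mem_interior (convex_preimage_add hΩ) (preimage_add_mem_nhds hz₀),
    (Ω.isOpen.preimage (continuous_const_add z₀)).interior_eq]
  simp

theorem gaugeAt_eq_one_iff (hΩ : Convex ℝ Ω.carrier) (hz₀ : z₀ ∈ Ω.carrier) {z : ℂ} :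
    Ω.gaugeAt z₀ (z - z₀) = 1 ↔ z ∈ Ω.bdry := by
  rw [gaugeAt, gauge_eq_one_iff_mem_frontier (convex_preimage_add hΩ) (preimage_add_mem_nhds hz₀),
    ← Homeomorph.coe_addLeft, ← Homeomorph.preimage_frontier]
  simp

theorem add_inv_gaugeAt_smul_mem_bdry (hΩ : Convex ℝ Ω.carrier) (hz₀ : z₀ ∈ Ω.carrier) {w : ℂ}
    (hw : w ≠ 0) : z₀ + (Ω.gaugeAt z₀ w)⁻¹ • w ∈ Ω.bdry := by
  have hpos := gaugeAt_pos (Ω := Ω) hz₀ hw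
  rw [← gaugeAt_eq_one_iff hΩ hz₀, add_sub_cancel_left, gaugeAt_smul (by positivity),
    inv_mul_cancel₀ hpos.ne']

/-- The boundary point is the radial projection of `z` from an interior point `z₀`. There `z - σ` is
a negative multiple of `z₀ - σ`. -/
theorem exists_inner_normal_pos (hΩ : Convex ℝ Ω.carrier) (hne : Ω.carrier.Nonempty) {z : ℂ}
    (hz : z ∉ closure Ω.carrier) : ∃ σ ∈ Ω.bdry, 0 < inner ℝ (z - σ) (Ω.normal σ) := by
  obtain ⟨z₀, hz₀⟩ := hne
  have hw : z - z₀ ≠ 0 := fun h => hz (subset_closure (sub_eq_zero.1 h ▸ hz₀))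
  have hg : 1 < Ω.gaugeAt z₀ (z - z₀) := by
    by_contra! h
    rcases h.lt_or_eq with h | h
    · exact hz (subset_closure ((gaugeAt_lt_one_iff hΩ hz₀).1 h))
    · exact hz (frontier_subset_closure ((gaugeAt_eq_one_iff hΩ hz₀).1 h))
  have hσ := add_inv_gaugeAt_smul_mem_bdry hΩ hz₀ hw
  set g := Ω.gaugeAt z₀ (z - z₀)
  refine ⟨_, hσ, ?_⟩
  have h1 := Ω.inner_sub_normal_neg hΩ hσ hz₀
  rw [show z - (z₀ + g⁻¹ • (z - z₀)) = -((g - 1) • (z₀ - (z₀ + g⁻¹ • (z - z₀)))) by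
    have : (g : ℂ) ≠ 0 := by exact_mod_cast (by linarith : g ≠ 0)
    simp only [Complex.real_smul]; push_cast; field_simp; ring, inner_neg_left,
    real_inner_smul_left]
  nlinarith

variable (Ω z₀)

/-- The boundary of `Ω` in polar coordinates around `z₀`. -/
noncomputable def polarCurve (θ : ℝ) : ℂ :=
  z₀ + (Ω.gaugeAt z₀ (Complex.exp (θ * Complex.I)))⁻¹ • Complex.exp (θ * Complex.I)

variable {Ω z₀}

theorem polarCurve_mem_bdry (hΩ : Convex ℝ Ω.carrier) (hz₀ : z₀ ∈ Ω.carrier) (θ : ℝ) :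
    Ω.polarCurve z₀ θ ∈ Ω.bdry :=
  add_inv_gaugeAt_smul_mem_bdry hΩ hz₀ (Complex.exp_ne_zero _)

theorem continuous_polarCurve (hΩ : Convex ℝ Ω.carrier) (hz₀ : z₀ ∈ Ω.carrier) :
    Continuous (Ω.polarCurve z₀) := by
  have h1 : Continuous fun θ : ℝ => Complex.exp (θ * Complex.I) := by fun_prop
  exact continuous_const.add ((((continuous_gaugeAt hΩ hz₀).comp h1).inv₀
    fun θ => (gaugeAt_pos hz₀ (Complex.exp_ne_zero _)).ne').smul h1)

theorem polarCurve_pi (Ω : SmoothlyBoundedSet) (z₀ : ℂ) :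
    Ω.polarCurve z₀ Real.pi = Ω.polarCurve z₀ (-Real.pi) := by
  have : Complex.exp ((-Real.pi : ℝ) * Complex.I) = Complex.exp (Real.pi * Complex.I) := by
    push_cast
    rw [neg_mul, Complex.exp_neg, Complex.exp_pi_mul_I]; norm_num
  rw [polarCurve, polarCurve, this]

theorem arg_polarCurve_sub (hz₀ : z₀ ∈ Ω.carrier) {θ : ℝ} (hθ : θ ∈ Ioc (-Real.pi) Real.pi) :
    Complex.arg (Ω.polarCurve z₀ θ - z₀) = θ := by
  rw [polarCurve, add_sub_cancel_left, Complex.real_smul, Complex.arg_real_mul, Complex.arg_exp_mul_I,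
    (toIocMod_eq_self Real.two_pi_pos).2 (by
      rwa [show -Real.pi + 2 * Real.pi = Real.pi by ring])]
  have := gaugeAt_pos (Ω := Ω) hz₀ (Complex.exp_ne_zero (θ * Complex.I))
  positivity

theorem polarCurve_arg (hΩ : Convex ℝ Ω.carrier) (hz₀ : z₀ ∈ Ω.carrier) {σ : ℂ}
    (hσ : σ ∈ Ω.bdry) : Ω.polarCurve z₀ (Complex.arg (σ - z₀)) = σ := by
  have h1 := (gaugeAt_eq_one_iff hΩ hz₀).2 hσ
  have h0 : σ - z₀ ≠ 0 := by
    intro h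
    have : σ ∈ Ω.carrier := sub_eq_zero.1 h ▸ hz₀
    rw [bdry, Ω.isOpen.frontier_eq] at hσ
    exact hσ.2 this
  have hn : 0 < ‖σ - z₀‖ := norm_pos_iff.2 h0
  have h2 : Complex.exp (Complex.arg (σ - z₀) * Complex.I) = ‖σ - z₀‖⁻¹ • (σ - z₀) := by
    have := Complex.norm_mul_exp_arg_mul_I (σ - z₀)
    nth_rw 3 [← this]
    have h3 : (‖σ - z₀‖ : ℂ) ≠ 0 := by exact_mod_cast hn.ne'
    rw [Complex.real_smul]; push_cast
    rw [inv_mul_cancel_left₀ h3]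
  rw [polarCurve, h2, gaugeAt_smul (by positivity), h1, smul_smul]
  simp [hn.ne']

/-- The outward normal at `σ ∈ ∂Ω`, scaled so that its inner product with `σ - z₀` is `1`; this is
the gradient of the gauge. -/
noncomputable def gaugeGradient (Ω : SmoothlyBoundedSet) (z₀ σ : ℂ) : ℂ :=
  (inner ℝ (σ - z₀) (Ω.normal σ))⁻¹ • Ω.normal σ

theorem inner_sub_normal_pos (hΩ : Convex ℝ Ω.carrier) (hz₀ : z₀ ∈ Ω.carrier) {σ : ℂ}
    (hσ : σ ∈ Ω.bdry) : 0 < inner ℝ (σ - z₀) (Ω.normal σ) := by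
  have := Ω.inner_sub_normal_neg hΩ hσ hz₀
  rw [← neg_sub, inner_neg_left]; linarith

/-- This is the supporting half-plane at `σ`, tested at the boundary point in direction `w`: the
gauge dominates its tangent functional. Equality in the direction of `σ` is
`inner_exp_gaugeGradient`. -/
theorem inner_gaugeGradient_le (hΩ : Convex ℝ Ω.carrier) (hz₀ : z₀ ∈ Ω.carrier) {σ : ℂ}
    (hσ : σ ∈ Ω.bdry) (w : ℂ) : inner ℝ w (Ω.gaugeGradient z₀ σ) ≤ Ω.gaugeAt z₀ w := by
  rcases eq_or_ne w 0 with rfl | hw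
  · rw [inner_zero_left]
    exact gauge_nonneg _
  have hg := gaugeAt_pos (Ω := Ω) hz₀ hw
  have h1 := Ω.inner_sub_normal_nonpos hΩ hσ
    (frontier_subset_closure (add_inv_gaugeAt_smul_mem_bdry hΩ hz₀ hw))
  rw [add_sub_right_comm, inner_add_left, real_inner_smul_left, ← neg_sub, inner_neg_left] at h1
  have hp := inner_sub_normal_pos hΩ hz₀ hσ
  rw [gaugeGradient, real_inner_smul_right, inv_mul_le_iff₀ hp]
  have : (Ω.gaugeAt z₀ w)⁻¹ * inner ℝ w (Ω.normal σ) ≤ inner ℝ (σ - z₀) (Ω.normal σ) := by linarith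
  rwa [inv_mul_le_iff₀ hg, mul_comm] at this

theorem inner_exp_gaugeGradient (hΩ : Convex ℝ Ω.carrier) (hz₀ : z₀ ∈ Ω.carrier) (θ : ℝ) :
    inner ℝ (Complex.exp (θ * Complex.I)) (Ω.gaugeGradient z₀ (Ω.polarCurve z₀ θ)) =
      Ω.gaugeAt z₀ (Complex.exp (θ * Complex.I)) := by
  have hg := gaugeAt_pos (Ω := Ω) hz₀ (Complex.exp_ne_zero (θ * Complex.I))
  have hp := inner_sub_normal_pos hΩ hz₀ (polarCurve_mem_bdry hΩ hz₀ θ)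
  have hc : Ω.polarCurve z₀ θ - z₀ =
    (Ω.gaugeAt z₀ (Complex.exp (θ * Complex.I)))⁻¹ • Complex.exp (θ * Complex.I) := by
    rw [polarCurve, add_sub_cancel_left]
  rw [gaugeGradient, real_inner_smul_right]
  rw [hc, real_inner_smul_left] at hp ⊢
  have : inner ℝ (Complex.exp (θ * Complex.I)) (Ω.normal (Ω.polarCurve z₀ θ)) ≠ 0 := by
    intro h; rw [h] at hp; simp at hp
  field_simp

theorem continuous_normal_polarCurve (hΩ : Convex ℝ Ω.carrier) (hz₀ : z₀ ∈ Ω.carrier) :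
    Continuous fun θ => Ω.normal (Ω.polarCurve z₀ θ) :=
  (Ω.continuous_normal hΩ).comp
    ((continuous_polarCurve hΩ hz₀).subtype_mk (polarCurve_mem_bdry hΩ hz₀))

theorem continuous_gaugeGradient_polarCurve (hΩ : Convex ℝ Ω.carrier) (hz₀ : z₀ ∈ Ω.carrier) :
    Continuous fun θ => Ω.gaugeGradient z₀ (Ω.polarCurve z₀ θ) := by
  have h1 := continuous_normal_polarCurve hΩ hz₀
  have h2 := continuous_polarCurve hΩ hz₀
  exact (((h2.sub continuous_const).inner h1).inv₀ fun θ =>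
    (inner_sub_normal_pos hΩ hz₀ (polarCurve_mem_bdry hΩ hz₀ θ)).ne').smul h1

theorem hasDerivAt_exp_mul_I (θ : ℝ) :
    HasDerivAt (fun θ : ℝ => Complex.exp (θ * Complex.I)) (Complex.I * Complex.exp (θ * Complex.I)) θ := by
  have h := (((hasDerivAt_id (θ : ℂ)).mul_const Complex.I).cexp).comp_ofReal
  simpa [mul_comm] using h

/-- Using the subgradient inequality at both `θ` and `t` gives `0 ≤ gauge (e t) - ⟨e t, N θ⟩ ≤ ⟨e t
- e θ, N t - N θ⟩`. The right side is `O(t - θ) · o(1)` because the normal is continuous, so the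
gauge has the derivative of its tangent functional. -/
theorem hasDerivAt_gaugeAt_exp (hΩ : Convex ℝ Ω.carrier) (hz₀ : z₀ ∈ Ω.carrier) (θ : ℝ) :
    HasDerivAt (fun θ : ℝ => Ω.gaugeAt z₀ (Complex.exp (θ * Complex.I)))
      (inner ℝ (Complex.I * Complex.exp (θ * Complex.I)) (Ω.gaugeGradient z₀ (Ω.polarCurve z₀ θ)))
      θ := by
  set N : ℝ → ℂ := fun θ => Ω.gaugeGradient z₀ (Ω.polarCurve z₀ θ) with hN
  set e : ℝ → ℂ := fun θ => Complex.exp (θ * Complex.I) with he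
  have h1 : HasDerivAt (fun t => inner ℝ (e t) (N θ)) (inner ℝ (Complex.I * e θ) (N θ)) θ := by
    have := (hasDerivAt_exp_mul_I θ).inner ℝ (hasDerivAt_const θ (N θ))
    rw [inner_zero_right, zero_add] at this
    exact this
  have h2 : (fun t => Ω.gaugeAt z₀ (e t) - inner ℝ (e t) (N θ)) =o[𝓝 θ] fun t => t - θ := by
    have h3 : (fun t => Ω.gaugeAt z₀ (e t) - inner ℝ (e t) (N θ)) =O[𝓝 θ]
        fun t => ‖e t - e θ‖ * ‖N t - N θ‖ := by
      refine Asymptotics.IsBigO.of_bound 1 (Eventually.of_forall fun t => ?_)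
      have a1 := inner_gaugeGradient_le hΩ hz₀ (polarCurve_mem_bdry hΩ hz₀ θ) (e t)
      have a2 := inner_gaugeGradient_le hΩ hz₀ (polarCurve_mem_bdry hΩ hz₀ t) (e θ)
      have a3 := inner_exp_gaugeGradient hΩ hz₀ t
      have a4 := inner_exp_gaugeGradient hΩ hz₀ θ
      change inner ℝ (e t) (N θ) ≤ _ at a1
      change inner ℝ (e θ) (N t) ≤ Ω.gaugeAt z₀ (e θ) at a2
      change inner ℝ (e t) (N t) = Ω.gaugeAt z₀ (e t) at a3
      change inner ℝ (e θ) (N θ) = Ω.gaugeAt z₀ (e θ) at a4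
      rw [Real.norm_of_nonneg (by linarith), one_mul, norm_mul, norm_norm, norm_norm]
      have a5 := real_inner_le_norm (e t - e θ) (N t - N θ)
      simp only [inner_sub_left, inner_sub_right] at a5
      linarith
    have h4 : (fun t => ‖e t - e θ‖ * ‖N t - N θ‖) =o[𝓝 θ] fun t => (t - θ) * (1 : ℝ) := by
      refine Asymptotics.IsBigO.mul_isLittleO ?_ ?_
      · exact (hasDerivAt_exp_mul_I θ).isBigO_sub.norm_left
      · rw [Asymptotics.isLittleO_one_iff]
        have : Tendsto (fun t => ‖N t - N θ‖) (𝓝 θ) (𝓝 ‖N θ - N θ‖) :=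
          (((continuous_gaugeGradient_polarCurve hΩ hz₀).sub continuous_const).norm).tendsto θ
        simpa using this
    simpa using h3.trans_isLittleO h4
  have h5 : HasDerivAt (fun t => Ω.gaugeAt z₀ (e t) - inner ℝ (e t) (N θ)) 0 θ := by
    rw [hasDerivAt_iff_isLittleO]
    refine h2.congr_left fun t => ?_
    have a4 := inner_exp_gaugeGradient hΩ hz₀ θ
    change inner ℝ (e θ) (N θ) = Ω.gaugeAt z₀ (e θ) at a4
    rw [a4, sub_self, sub_zero, smul_zero, sub_zero]
  refine ((h5.add h1).congr_deriv (zero_add _)).congr_of_eventuallyEq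
    (Eventually.of_forall fun t => ?_)
  exact (sub_add_cancel _ _).symm

/-- The velocity of the polar parametrization of `∂Ω`. -/
noncomputable def polarVelocity (Ω : SmoothlyBoundedSet) (z₀ : ℂ) (θ : ℝ) : ℂ :=
  ((Ω.gaugeAt z₀ (Complex.exp (θ * Complex.I)))⁻¹ / inner ℝ (Complex.exp (θ * Complex.I))
    (Ω.normal (Ω.polarCurve z₀ θ)) : ℝ) * (Complex.I * Ω.normal (Ω.polarCurve z₀ θ))

theorem inner_exp_normal_pos (hΩ : Convex ℝ Ω.carrier) (hz₀ : z₀ ∈ Ω.carrier) (θ : ℝ) :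
    0 < inner ℝ (Complex.exp (θ * Complex.I)) (Ω.normal (Ω.polarCurve z₀ θ)) := by
  have hg := gaugeAt_pos (Ω := Ω) hz₀ (Complex.exp_ne_zero (θ * Complex.I))
  have hp := inner_sub_normal_pos hΩ hz₀ (polarCurve_mem_bdry hΩ hz₀ θ)
  rw [polarCurve, add_sub_cancel_left, real_inner_smul_left] at hp
  exact pos_of_mul_pos_right hp (by positivity)

theorem continuous_polarVelocity (hΩ : Convex ℝ Ω.carrier) (hz₀ : z₀ ∈ Ω.carrier) :
    Continuous (Ω.polarVelocity z₀) := by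
  have h1 : Continuous fun θ : ℝ => Complex.exp (θ * Complex.I) := by fun_prop
  have h2 := continuous_normal_polarCurve hΩ hz₀
  have h3 := ((continuous_gaugeAt hΩ hz₀).comp h1).inv₀
    fun θ => (gaugeAt_pos hz₀ (Complex.exp_ne_zero _)).ne'
  exact (Complex.continuous_ofReal.comp (h3.div (h1.inner h2)
    fun θ => (inner_exp_normal_pos hΩ hz₀ θ).ne')).mul (continuous_const.mul h2)

theorem norm_polarVelocity (hΩ : Convex ℝ Ω.carrier) (hz₀ : z₀ ∈ Ω.carrier) (θ : ℝ) :
    ‖Ω.polarVelocity z₀ θ‖ = (Ω.gaugeAt z₀ (Complex.exp (θ * Complex.I)))⁻¹ /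
      inner ℝ (Complex.exp (θ * Complex.I)) (Ω.normal (Ω.polarCurve z₀ θ)) := by
  have hg := gaugeAt_pos (Ω := Ω) hz₀ (Complex.exp_ne_zero (θ * Complex.I))
  have hp := inner_exp_normal_pos hΩ hz₀ θ
  rw [polarVelocity, norm_mul, norm_mul, Ω.norm_normal hΩ (polarCurve_mem_bdry hΩ hz₀ θ),
    Complex.norm_I, Complex.norm_real, Real.norm_of_nonneg (by positivity)]
  ring

theorem norm_polarVelocity_pos (hΩ : Convex ℝ Ω.carrier) (hz₀ : z₀ ∈ Ω.carrier) (θ : ℝ) :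
    0 < ‖Ω.polarVelocity z₀ θ‖ := by
  have hg := gaugeAt_pos (Ω := Ω) hz₀ (Complex.exp_ne_zero (θ * Complex.I))
  have hp := inner_exp_normal_pos hΩ hz₀ θ
  rw [norm_polarVelocity hΩ hz₀]
  positivity

theorem polarVelocity_eq (hΩ : Convex ℝ Ω.carrier) (hz₀ : z₀ ∈ Ω.carrier) (θ : ℝ) :
    Ω.polarVelocity z₀ θ =
      ‖Ω.polarVelocity z₀ θ‖ • (Complex.I * Ω.normal (Ω.polarCurve z₀ θ)) := by
  rw [norm_polarVelocity hΩ hz₀, Complex.real_smul, polarVelocity]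

theorem hasDerivAt_polarCurve (hΩ : Convex ℝ Ω.carrier) (hz₀ : z₀ ∈ Ω.carrier) (θ : ℝ) :
    HasDerivAt (Ω.polarCurve z₀) (Ω.polarVelocity z₀ θ) θ := by
  have hg := gaugeAt_pos (Ω := Ω) hz₀ (Complex.exp_ne_zero (θ * Complex.I))
  have hp := inner_exp_normal_pos hΩ hz₀ θ
  have h1 := ((hasDerivAt_gaugeAt_exp hΩ hz₀ θ).fun_inv hg.ne').smul (hasDerivAt_exp_mul_I θ)
  refine (h1.const_add z₀).congr_deriv ?_
  have hN : Ω.gaugeGradient z₀ (Ω.polarCurve z₀ θ) =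
      (Ω.gaugeAt z₀ (Complex.exp (θ * Complex.I)) /
        inner ℝ (Complex.exp (θ * Complex.I)) (Ω.normal (Ω.polarCurve z₀ θ))) •
        Ω.normal (Ω.polarCurve z₀ θ) := by
    have hc : Ω.polarCurve z₀ θ - z₀ =
      (Ω.gaugeAt z₀ (Complex.exp (θ * Complex.I)))⁻¹ • Complex.exp (θ * Complex.I) := by
      rw [polarCurve, add_sub_cancel_left]
    rw [gaugeGradient, hc, real_inner_smul_left, mul_inv, inv_inv, div_eq_mul_inv]
  rw [hN, real_inner_smul_right, polarVelocity]
  set n := Ω.normal (Ω.polarCurve z₀ θ)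
  set e := Complex.exp (θ * Complex.I) with he
  set g := Ω.gaugeAt z₀ e
  set p := inner ℝ e n with hpdef
  set q := inner ℝ (Complex.I * e) n with hqdef
  have hee : e * (starRingEnd ℂ) e = 1 := by
    rw [Complex.mul_conj, Complex.normSq_eq_norm_sq, he, Complex.norm_exp_ofReal_mul_I]; simp
  -- Coordinates of the normal in the orthonormal frame `(e, i e)`. In them the velocity formula
  -- becomes an algebraic identity in `p`, `q` and `g`.
  have hn : n = e * (p + q * Complex.I) := by
    have : (p + q * Complex.I : ℂ) = (starRingEnd ℂ) e * n := by
      rw [hpdef, hqdef, Complex.inner, Complex.inner]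
      apply Complex.ext <;> simp <;> ring
    rw [this, ← mul_assoc, hee, one_mul]
  have hg' : (g : ℂ) ≠ 0 := by exact_mod_cast hg.ne'
  have hp' : (p : ℂ) ≠ 0 := by exact_mod_cast hp.ne'
  rw [hn]
  simp only [Complex.real_smul]
  push_cast
  field_simp
  linear_combination (-q * e : ℂ) * Complex.I_sq

end SmoothlyBoundedSet

end

/-! ### Arc length as Hausdorff measure, and integration over the boundary. -/

section

open Set Filter Topology MeasureTheory

section CurveLength

variable {E : Type*} [NormedAddCommGroup E] [NormedSpace ℝ E] {γ γ' : ℝ → E}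

theorem norm_sub_sub_smul_le (hγ : ∀ t, HasDerivAt γ (γ' t) t) {s : Set ℝ} (hs : Convex ℝ s)
    {v : E} {ε : ℝ} (h : ∀ t ∈ s, ‖γ' t - v‖ ≤ ε) {x y : ℝ} (hx : x ∈ s) (hy : y ∈ s) :
    ‖γ y - γ x - (y - x) • v‖ ≤ ε * |y - x| := by
  have := hs.norm_image_sub_le_of_norm_hasDerivWithin_le (f := fun t => γ t - t • v)
    (f' := fun t => γ' t - (1 : ℝ) • v) (C := ε)
    (fun t _ => ((hγ t).sub ((hasDerivAt_id t).smul_const v)).hasDerivWithinAt)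
    (fun t ht => by simpa using h t ht) hx hy
  simpa [sub_smul, sub_sub_sub_comm] using this

variable [MeasurableSpace E] [BorelSpace E]

theorem hausdorffMeasure_image_Ioc_le (hγ : ∀ t, HasDerivAt γ (γ' t) t) {x y C : ℝ} (hxy : x ≤ y)
    (h : ∀ t ∈ Icc x y, ‖γ' t‖ ≤ C) : μH[1] (γ '' Ioc x y) ≤ ENNReal.ofReal (C * (y - x)) := by
  have hC : 0 ≤ C := (norm_nonneg _).trans (h x ⟨le_rfl, hxy⟩)
  have hlip : LipschitzOnWith C.toNNReal γ (Ioc x y) := by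
    refine LipschitzOnWith.of_dist_le_mul fun s hs t ht => ?_
    rw [dist_eq_norm, Real.dist_eq, Real.coe_toNNReal _ hC]
    simpa using norm_sub_sub_smul_le hγ (convex_Icc x y) (v := 0) (fun t ht => by simpa using h t ht)
      (Ioc_subset_Icc_self ht) (Ioc_subset_Icc_self hs)
  have := hlip.hausdorffMeasure_image_le (d := 1) zero_le_one
  rwa [hausdorffMeasure_real, Real.volume_Ioc, ENNReal.rpow_one, ← ENNReal.ofReal,
    ← ENNReal.ofReal_mul hC] at this

/-- Where the derivative stays within `ε` of `v`, the curve stretches distances by at least `‖v‖ -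
ε`, so its inverse is Lipschitz. -/
theorem le_hausdorffMeasure_image_Ioc (hγ : ∀ t, HasDerivAt γ (γ' t) t) {x y ε : ℝ} {v : E}
    (h : ∀ t ∈ Icc x y, ‖γ' t - v‖ ≤ ε) (hε : ε < ‖v‖) :
    ENNReal.ofReal ((‖v‖ - ε) * (y - x)) ≤ μH[1] (γ '' Ioc x y) := by
  have hpos : 0 < ‖v‖ - ε := by linarith
  have hanti : AntilipschitzWith (‖v‖ - ε).toNNReal⁻¹ (fun t : Ioc x y => γ t) := by
    refine AntilipschitzWith.of_le_mul_dist fun s t => ?_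
    have h1 := norm_sub_sub_smul_le hγ (convex_Icc x y) h
      (Ioc_subset_Icc_self t.2) (Ioc_subset_Icc_self s.2)
    have h2 := norm_sub_norm_le (((s : ℝ) - t) • v) (((s : ℝ) - t) • v - (γ s - γ t))
    rw [sub_sub_cancel, norm_sub_rev (((s : ℝ) - t) • v), norm_smul, Real.norm_eq_abs] at h2
    rw [Subtype.dist_eq, Real.dist_eq, dist_eq_norm, NNReal.coe_inv, Real.coe_toNNReal _ hpos.le,
      le_inv_mul_iff₀ hpos]
    linarith
  have h1 := hanti.le_hausdorffMeasure_image (d := 1) zero_le_one univ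
  rw [← isometry_subtype_coe.hausdorffMeasure_image (Or.inl zero_le_one), image_univ,
    Subtype.range_coe, hausdorffMeasure_real, Real.volume_Ioc, ENNReal.rpow_one, image_univ,
    show range (fun t : Ioc x y => γ t) = γ '' Ioc x y from (image_eq_range _ _).symm] at h1
  have hne : (‖v‖ - ε).toNNReal ≠ 0 := by simpa using hpos
  rw [ENNReal.coe_inv hne] at h1
  calc ENNReal.ofReal ((‖v‖ - ε) * (y - x))
      = (‖v‖ - ε).toNNReal * ENNReal.ofReal (y - x) := by
        rw [ENNReal.ofReal_mul hpos.le]; rfl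
    _ ≤ (‖v‖ - ε).toNNReal * (((‖v‖ - ε).toNNReal : ENNReal)⁻¹ * μH[1] (γ '' Ioc x y)) := by gcongr
    _ = μH[1] (γ '' Ioc x y) := by
        rw [← mul_assoc, ENNReal.mul_inv_cancel (by exact_mod_cast hne) ENNReal.coe_ne_top, one_mul]

/-- The upper and lower bounds on short arcs show that `y ↦ ν (a, y]` has right derivative `‖γ'‖`,
and the fundamental theorem of calculus applies. Additivity of the auxiliary measure `ν` takes the
place of injectivity of `γ`. -/
theorem measure_Ioc_eq_integral_norm_deriv (hγ : ∀ t, HasDerivAt γ (γ' t) t)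
    (hγ' : Continuous γ') (hne : ∀ t, γ' t ≠ 0) {ν : Measure ℝ} {a b : ℝ} (hab : a ≤ b)
    (hν : ∀ x y, a ≤ x → x ≤ y → y ≤ b → ν (Ioc x y) = μH[1] (γ '' Ioc x y)) :
    ν (Ioc a b) = ENNReal.ofReal (∫ t in a..b, ‖γ' t‖) := by
  obtain ⟨C, hC⟩ := (isCompact_Icc (a := a) (b := b)).exists_bound_of_continuousOn hγ'.continuousOn
  have hle : ∀ x y, a ≤ x → x ≤ y → y ≤ b → ν (Ioc x y) ≤ ENNReal.ofReal (C * (y - x)) := by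
    intro x y hx hxy hy
    rw [hν x y hx hxy hy]
    exact hausdorffMeasure_image_Ioc_le hγ hxy fun t ht => hC t ⟨hx.trans ht.1, ht.2.trans hy⟩
  have hfin : ∀ x y, a ≤ x → x ≤ y → y ≤ b → ν (Ioc x y) ≠ ⊤ := fun x y hx hxy hy =>
    ((hle x y hx hxy hy).trans_lt ENNReal.ofReal_lt_top).ne
  have hC0 : 0 ≤ C := (norm_nonneg _).trans (hC a ⟨le_rfl, hab⟩)
  set F : ℝ → ℝ := fun y => ν.real (Ioc a y) with hF
  have hadd : ∀ x y, a ≤ x → x ≤ y → y ≤ b → F y - F x = ν.real (Ioc x y) := by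
    intro x y hx hxy hy
    have : Ioc a y = Ioc a x ∪ Ioc x y := (Ioc_union_Ioc_eq_Ioc hx hxy).symm
    rw [hF]
    simp only
    rw [this, measureReal_union (Ioc_disjoint_Ioc_of_le le_rfl) measurableSet_Ioc
      (hfin a x le_rfl hx (hxy.trans hy)) (hfin x y hx hxy hy)]
    ring
  have hcont : ContinuousOn F (Icc a b) := by
    have : LipschitzOnWith C.toNNReal F (Icc a b) := by
      refine LipschitzOnWith.of_dist_le_mul fun y hy x hx => ?_
      rw [Real.coe_toNNReal _ hC0]
      wlog hxy : x ≤ y generalizing x y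
      · rw [dist_comm, dist_comm y]
        exact this x hx y hy (le_of_not_ge hxy)
      rw [Real.dist_eq, Real.dist_eq, abs_of_nonneg (sub_nonneg.2 hxy), hadd x y hx.1 hxy hy.2,
        abs_of_nonneg measureReal_nonneg]
      exact ENNReal.toReal_le_of_le_ofReal (by nlinarith) (hle x y hx.1 hxy hy.2)
    exact this.continuousOn
  have hderiv : ∀ x ∈ Ioo a b, HasDerivWithinAt F ‖γ' x‖ (Ioi x) x := by
    intro x hx
    rw [hasDerivWithinAt_iff_isLittleO, Asymptotics.isLittleO_iff]
    intro c hc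
    set ε := min c (‖γ' x‖ / 2) with hε
    have hv : 0 < ‖γ' x‖ := norm_pos_iff.2 (hne x)
    have hε0 : 0 < ε := lt_min hc (by positivity)
    have hεv : ε < ‖γ' x‖ := (min_le_right _ _).trans_lt (by linarith)
    obtain ⟨δ, hδ, hball⟩ := Metric.continuousAt_iff.1 (hγ'.continuousAt (x := x)) ε hε0
    have h1 : ∀ᶠ y in 𝓝[>] x, y < min (x + δ) b :=
      nhdsWithin_le_nhds (gt_mem_nhds (lt_min (by linarith) hx.2))
    filter_upwards [h1, self_mem_nhdsWithin] with y hy hxy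
    have hxy : x < y := hxy
    have hyb : y ≤ b := (hy.trans_le (min_le_right _ _)).le
    have hclose : ∀ t ∈ Icc x y, ‖γ' t - γ' x‖ ≤ ε := by
      intro t ht
      rw [← dist_eq_norm]
      refine (hball ?_).le
      rw [Real.dist_eq, abs_of_nonneg (by linarith [ht.1])]
      linarith [ht.2, hy.trans_le (min_le_left _ _)]
    have hup := hausdorffMeasure_image_Ioc_le hγ hxy.le (C := ‖γ' x‖ + ε) fun t ht => by
      have := norm_le_norm_add_norm_sub (γ' x) (γ' t)
      rw [norm_sub_rev] at this
      linarith [hclose t ht]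
    have hlo := le_hausdorffMeasure_image_Ioc hγ hclose hεv
    rw [← hν x y hx.1.le hxy.le hyb] at hup hlo
    have hup' := ENNReal.toReal_le_of_le_ofReal (by nlinarith) hup
    have hlo' := (ENNReal.ofReal_le_iff_le_toReal (hfin x y hx.1.le hxy.le hyb)).1 hlo
    rw [hadd x y hx.1.le hxy.le hyb, Real.norm_eq_abs, Real.norm_eq_abs, smul_eq_mul,
      abs_of_pos (sub_pos.2 hxy), Measure.real, abs_le]
    have : ε * (y - x) ≤ c * (y - x) := by
      have := min_le_left c (‖γ' x‖ / 2)
      have : 0 < y - x := sub_pos.2 hxy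
      gcongr
    constructor <;> nlinarith
  have := intervalIntegral.integral_eq_sub_of_hasDeriv_right_of_le hab hcont hderiv
    (hγ'.norm.intervalIntegrable _ _)
  rw [this, hadd a b le_rfl hab le_rfl, Measure.real, ENNReal.ofReal_toReal (hfin a b le_rfl hab le_rfl)]

end CurveLength

namespace SmoothlyBoundedSet

variable {Ω : SmoothlyBoundedSet} {z₀ : ℂ}

theorem bdry_inter_preimage_arg (hΩ : Convex ℝ Ω.carrier) (hz₀ : z₀ ∈ Ω.carrier) {x y : ℝ}
    (hx : -Real.pi ≤ x) (hy : y ≤ Real.pi) :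
    (fun σ => Complex.arg (σ - z₀)) ⁻¹' Ioc x y ∩ Ω.bdry = Ω.polarCurve z₀ '' Ioc x y := by
  ext σ
  constructor
  · rintro ⟨h1, h2⟩
    exact ⟨_, h1, polarCurve_arg hΩ hz₀ h2⟩
  · rintro ⟨θ, hθ, rfl⟩
    refine ⟨?_, polarCurve_mem_bdry hΩ hz₀ θ⟩
    rw [mem_preimage, arg_polarCurve_sub hz₀ ⟨hx.trans_lt hθ.1, hθ.2.trans hy⟩]
    exact hθ

/-- On `∂Ω` the angle around `z₀` inverts `polarCurve`, so the pushforward of arc length gives `(x,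
y]` the length of the corresponding arc. Both measures live on `(-π, π]`, and half-open intervals
determine them. -/
theorem map_arg_hausdorffMeasure (hΩ : Convex ℝ Ω.carrier) (hz₀ : z₀ ∈ Ω.carrier) :
    (μH[1].restrict Ω.bdry).map (fun σ => Complex.arg (σ - z₀)) =
      (volume.restrict (Ioc (-Real.pi) Real.pi)).withDensity
        fun θ => ENNReal.ofReal ‖Ω.polarVelocity z₀ θ‖ := by
  have harg : Measurable fun σ : ℂ => Complex.arg (σ - z₀) :=
    Complex.measurable_arg.comp (measurable_id.sub_const z₀)
  have hpi := Real.pi_pos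
  have hbd : MeasurableSet Ω.bdry := isClosed_frontier.measurableSet
  set ν := (μH[1].restrict Ω.bdry).map (fun σ => Complex.arg (σ - z₀)) with hν
  have hνm : ∀ t, MeasurableSet t → ν t = μH[1] ((fun σ => Complex.arg (σ - z₀)) ⁻¹' t ∩ Ω.bdry) := by
    intro t ht
    rw [hν, Measure.map_apply harg ht, Measure.restrict_apply (harg ht)]
  have hνI : ∀ x y, -Real.pi ≤ x → x ≤ y → y ≤ Real.pi →
      ν (Ioc x y) = μH[1] (Ω.polarCurve z₀ '' Ioc x y) := by
    intro x y hx _ hy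
    rw [hνm _ measurableSet_Ioc, bdry_inter_preimage_arg hΩ hz₀ hx hy]
  have hvc := (continuous_polarVelocity hΩ hz₀).norm
  have hkey : ∀ x y, -Real.pi ≤ x → x ≤ y → y ≤ Real.pi → ν (Ioc x y) =
      ENNReal.ofReal (∫ t in x..y, ‖Ω.polarVelocity z₀ t‖) := by
    intro x y hx hxy hy
    exact measure_Ioc_eq_integral_norm_deriv (hasDerivAt_polarCurve hΩ hz₀)
      (continuous_polarVelocity hΩ hz₀) (fun t => norm_pos_iff.1 (norm_polarVelocity_pos hΩ hz₀ t))
      hxy fun x' y' h1 h2 h3 => hνI x' y' (hx.trans h1) h2 (h3.trans hy)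
  have hsupp : ∀ t, MeasurableSet t → ν t = ν (t ∩ Ioc (-Real.pi) Real.pi) := by
    intro t ht
    rw [hνm _ ht, hνm _ (ht.inter measurableSet_Ioc)]
    congr 1
    ext σ
    simp [Complex.neg_pi_lt_arg, Complex.arg_le_pi]
  have hwd : ∀ x y, -Real.pi ≤ x → x ≤ y → y ≤ Real.pi →
      ((volume.restrict (Ioc (-Real.pi) Real.pi)).withDensity
        fun θ => ENNReal.ofReal ‖Ω.polarVelocity z₀ θ‖) (Ioc x y) =
      ENNReal.ofReal (∫ t in x..y, ‖Ω.polarVelocity z₀ t‖) := by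
    intro x y hx hxy hy
    rw [withDensity_apply _ measurableSet_Ioc, Measure.restrict_restrict measurableSet_Ioc,
      inter_eq_left.2 (Ioc_subset_Ioc hx hy), intervalIntegral.integral_of_le hxy,
      ofReal_integral_eq_lintegral_ofReal]
    · exact (hvc.integrableOn_Icc).mono_set Ioc_subset_Icc_self
    · exact Eventually.of_forall fun _ => norm_nonneg _
  have hfin : IsFiniteMeasure ν := ⟨by
    rw [hsupp _ MeasurableSet.univ, univ_inter, hkey _ _ le_rfl (by linarith) le_rfl]
    exact ENNReal.ofReal_lt_top⟩
  have hsupp' : ∀ t, MeasurableSet t → ((volume.restrict (Ioc (-Real.pi) Real.pi)).withDensity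
        fun θ => ENNReal.ofReal ‖Ω.polarVelocity z₀ θ‖) t =
      ((volume.restrict (Ioc (-Real.pi) Real.pi)).withDensity
        fun θ => ENNReal.ofReal ‖Ω.polarVelocity z₀ θ‖) (t ∩ Ioc (-Real.pi) Real.pi) := by
    intro t ht
    rw [withDensity_apply _ ht, withDensity_apply _ (ht.inter measurableSet_Ioc),
      Measure.restrict_restrict ht, Measure.restrict_restrict (ht.inter measurableSet_Ioc),
      inter_assoc, inter_self]
  refine Measure.ext_of_Ioc _ _ fun x y _ => ?_
  rw [hsupp _ measurableSet_Ioc, hsupp' _ measurableSet_Ioc, Ioc_inter_Ioc]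
  rcases le_total (x ⊔ -Real.pi) (y ⊓ Real.pi) with h | h
  · rw [hkey _ _ le_sup_right h inf_le_right, hwd _ _ le_sup_right h inf_le_right]
  · rw [Ioc_eq_empty_of_le h]; simp

theorem hausdorffMeasure_restrict_bdry (hΩ : Convex ℝ Ω.carrier) (hz₀ : z₀ ∈ Ω.carrier) :
    μH[1].restrict Ω.bdry = ((volume.restrict (Ioc (-Real.pi) Real.pi)).withDensity
        fun θ => ENNReal.ofReal ‖Ω.polarVelocity z₀ θ‖).map (Ω.polarCurve z₀) := by
  have harg : Measurable fun σ : ℂ => Complex.arg (σ - z₀) :=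
    Complex.measurable_arg.comp (measurable_id.sub_const z₀)
  rw [← map_arg_hausdorffMeasure hΩ hz₀,
    Measure.map_map (continuous_polarCurve hΩ hz₀).measurable harg]
  conv_lhs => rw [← Measure.map_id (μ := μH[1].restrict Ω.bdry)]
  refine Measure.map_congr ((ae_restrict_iff' isClosed_frontier.measurableSet).2
    (Eventually.of_forall fun σ hσ => ?_))
  exact (polarCurve_arg hΩ hz₀ hσ).symm

theorem map_coe_hausdorffMeasure (Ω : SmoothlyBoundedSet) :
    (μH[1] : Measure Ω.bdry).map ((↑) : Ω.bdry → ℂ) = μH[1].restrict Ω.bdry := by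
  rw [isometry_subtype_coe.map_hausdorffMeasure (Or.inl zero_le_one), Subtype.range_coe]

theorem isFiniteMeasure_hausdorffMeasure (hΩ : Convex ℝ Ω.carrier) (hne : Ω.carrier.Nonempty) :
    IsFiniteMeasure (μH[1] : Measure Ω.bdry) := by
  obtain ⟨z₀, hz₀⟩ := hne
  refine ⟨?_⟩
  have h1 : (μH[1] : Measure Ω.bdry) univ = μH[1].restrict Ω.bdry univ := by
    rw [← map_coe_hausdorffMeasure, Measure.map_apply measurable_subtype_coe MeasurableSet.univ,
      preimage_univ]
  rw [h1, hausdorffMeasure_restrict_bdry hΩ hz₀, Measure.map_apply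
    (continuous_polarCurve hΩ hz₀).measurable MeasurableSet.univ, preimage_univ,
    withDensity_apply _ MeasurableSet.univ, Measure.restrict_univ]
  exact (((continuous_polarVelocity hΩ hz₀).norm.integrableOn_Icc).mono_set
    Ioc_subset_Icc_self).lintegral_lt_top

theorem isOpenPosMeasure_hausdorffMeasure (hΩ : Convex ℝ Ω.carrier) (hne : Ω.carrier.Nonempty) :
    (μH[1] : Measure Ω.bdry).IsOpenPosMeasure := by
  obtain ⟨z₀, hz₀⟩ := hne
  refine ⟨fun U hU hUne h0 => ?_⟩
  obtain ⟨V, hV, rfl⟩ := isOpen_induced_iff.1 hU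
  have h1 : μH[1].restrict Ω.bdry V = 0 := by
    rw [← map_coe_hausdorffMeasure, Measure.map_apply measurable_subtype_coe hV.measurableSet, h0]
  have hγ := continuous_polarCurve hΩ hz₀
  have hW := hV.preimage hγ
  rw [hausdorffMeasure_restrict_bdry hΩ hz₀, Measure.map_apply hγ.measurable hV.measurableSet,
    withDensity_apply _ hW.measurableSet, lintegral_eq_zero_iff
    (continuous_polarVelocity hΩ hz₀).norm.measurable.ennreal_ofReal] at h1
  have h2 : (volume.restrict (Ioc (-Real.pi) Real.pi)) (Ω.polarCurve z₀ ⁻¹' V) = 0 := by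
    rw [Filter.EventuallyEq, ae_iff] at h1
    have : {a | ¬ENNReal.ofReal ‖Ω.polarVelocity z₀ a‖ = (0 : ℝ → ENNReal) a} = univ := by
      ext a
      simpa using norm_pos_iff.1 (norm_polarVelocity_pos hΩ hz₀ a)
    rwa [this, Measure.restrict_apply MeasurableSet.univ, univ_inter] at h1
  obtain ⟨σ, hσ⟩ := hUne
  have h3 : Complex.arg (σ - z₀) ∈ Ω.polarCurve z₀ ⁻¹' V := by
    rw [mem_preimage, polarCurve_arg hΩ hz₀ σ.2]
    exact hσ
  -- The angle may be `π`, where a neighbourhood meets `(-π, π]` only from one side. Passing to the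
  -- closure of the open interval covers that case.
  have h4 : Complex.arg (σ - z₀) ∈ closure (Ioo (-Real.pi) Real.pi) := by
    rw [closure_Ioo (by linarith [Real.pi_pos])]
    exact ⟨(Complex.neg_pi_lt_arg _).le, Complex.arg_le_pi _⟩
  have h5 := mem_closure_iff.1 h4 _ hW h3
  refine ((hW.inter isOpen_Ioo).measure_pos volume h5).ne' ?_
  rw [Measure.restrict_apply hW.measurableSet] at h2
  exact measure_mono_null (inter_subset_inter_right _ Ioo_subset_Ioc_self) h2

theorem hausdorffMeasure_bdry_eq_map (hΩ : Convex ℝ Ω.carrier) (hz₀ : z₀ ∈ Ω.carrier) :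
    (μH[1] : Measure Ω.bdry) = ((volume.restrict (Ioc (-Real.pi) Real.pi)).withDensity
        fun θ => ENNReal.ofReal ‖Ω.polarVelocity z₀ θ‖).map
          fun θ => ⟨Ω.polarCurve z₀ θ, polarCurve_mem_bdry hΩ hz₀ θ⟩ := by
  have hemb : MeasurableEmbedding ((↑) : Ω.bdry → ℂ) :=
    MeasurableEmbedding.subtype_coe isClosed_frontier.measurableSet
  have hγ := continuous_polarCurve hΩ hz₀
  ext s hs
  rw [Measure.map_apply (hγ.subtype_mk _).measurable hs,
    ← preimage_image_eq s hemb.injective, ← Measure.map_apply hemb.measurable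
      (hemb.measurableSet_image.2 hs), map_coe_hausdorffMeasure,
    hausdorffMeasure_restrict_bdry hΩ hz₀, Measure.map_apply hγ.measurable
      (hemb.measurableSet_image.2 hs), preimage_image_eq s hemb.injective]
  congr 1
  ext θ
  simp [polarCurve_mem_bdry hΩ hz₀ θ]

section Integral

variable {E : Type*} [NormedAddCommGroup E] [NormedSpace ℝ E]

theorem integral_bdry_eq (hΩ : Convex ℝ Ω.carrier) (hz₀ : z₀ ∈ Ω.carrier) {f : Ω.bdry → E}
    (hf : Continuous f) : ∫ σ : Ω.bdry, f σ ∂μH[1] = ∫ θ in (-Real.pi)..Real.pi,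
      ‖Ω.polarVelocity z₀ θ‖ • f ⟨Ω.polarCurve z₀ θ, polarCurve_mem_bdry hΩ hz₀ θ⟩ := by
  rw [hausdorffMeasure_bdry_eq_map hΩ hz₀, integral_map
    ((continuous_polarCurve hΩ hz₀).subtype_mk _).measurable.aemeasurable hf.aestronglyMeasurable,
    integral_withDensity_eq_integral_toReal_smul
      (continuous_polarVelocity hΩ hz₀).norm.measurable.ennreal_ofReal (by simp),
    intervalIntegral.integral_of_le (by linarith [Real.pi_pos])]
  simp

/-- Here `dσ = i n |dσ|` becomes `γ'(θ) dθ`, so the left side is a genuine contour integral. -/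
theorem integral_bdry_smul_eq {E : Type*} [NormedAddCommGroup E] [NormedSpace ℂ E]
    (hΩ : Convex ℝ Ω.carrier) (hz₀ : z₀ ∈ Ω.carrier) {f : Ω.bdry → E} (hf : Continuous f) :
    ∫ σ : Ω.bdry, (Complex.I * Ω.normal σ) • f σ ∂μH[1] = ∫ θ in (-Real.pi)..Real.pi,
      Ω.polarVelocity z₀ θ • f ⟨Ω.polarCurve z₀ θ, polarCurve_mem_bdry hΩ hz₀ θ⟩ := by
  have hc : Continuous fun σ : Ω.bdry => (Complex.I * Ω.normal σ) • f σ :=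
    (continuous_const.mul (Ω.continuous_normal hΩ)).smul hf
  rw [integral_bdry_eq hΩ hz₀ hc]
  refine intervalIntegral.integral_congr fun θ _ => ?_
  simp only
  rw [← smul_assoc, ← polarVelocity_eq hΩ hz₀ θ]

/-- The integral of a derivative along the closed curve `∂Ω` vanishes. -/
theorem integral_bdry_deriv_eq_zero {E : Type*} [NormedAddCommGroup E] [NormedSpace ℂ E]
    [CompleteSpace E] (hΩ : Convex ℝ Ω.carrier) (hne : Ω.carrier.Nonempty) {F : ℂ → E}
    {f : Ω.bdry → E} (hf : Continuous f) (hF : ∀ σ : Ω.bdry, HasDerivAt F (f σ) σ) :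
    ∫ σ : Ω.bdry, (Complex.I * Ω.normal σ) • f σ ∂μH[1] = 0 := by
  obtain ⟨z₀, hz₀⟩ := hne
  rw [integral_bdry_smul_eq hΩ hz₀ hf, intervalIntegral.integral_eq_sub_of_hasDerivAt
    (f := F ∘ Ω.polarCurve z₀)
    (fun θ _ => HasDerivAt.scomp θ (hF ⟨_, polarCurve_mem_bdry hΩ hz₀ θ⟩)
      (hasDerivAt_polarCurve hΩ hz₀ θ))]
  · rw [Function.comp_apply, Function.comp_apply, polarCurve_pi, sub_self]
  · exact ((continuous_polarVelocity hΩ hz₀).smul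
      (hf.comp ((continuous_polarCurve hΩ hz₀).subtype_mk _))).intervalIntegrable _ _

end Integral

end SmoothlyBoundedSet

/-! ### Cauchy's theorem by explicit logarithms and homotopies. -/

namespace SmoothlyBoundedSet

variable {Ω : SmoothlyBoundedSet} {z₀ : ℂ}

theorem sub_ne_zero_of_mem_bdry {σ z : ℂ} (hσ : σ ∈ Ω.bdry) (hz : z ∈ Ω.carrier) : σ - z ≠ 0 := by
  intro h
  rw [bdry, Ω.isOpen.frontier_eq] at hσ
  exact hσ.2 (sub_eq_zero.1 h ▸ hz)

/-- In polar coordinates `log (σ - z₀)` is explicitly `-log gauge + iθ`. Its real part is periodic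
and its imaginary part grows by `2π`. -/
theorem integral_bdry_inv_sub (hΩ : Convex ℝ Ω.carrier) (hz₀ : z₀ ∈ Ω.carrier) :
    ∫ σ : Ω.bdry, (Complex.I * Ω.normal σ) • (σ - z₀ : ℂ)⁻¹ ∂μH[1] =
      2 * Real.pi * Complex.I := by
  have hc : Continuous fun σ : Ω.bdry => (σ - z₀ : ℂ)⁻¹ :=
    (continuous_subtype_val.sub continuous_const).inv₀ fun σ => sub_ne_zero_of_mem_bdry σ.2 hz₀
  rw [integral_bdry_smul_eq hΩ hz₀ hc]
  set h : ℝ → ℝ := fun θ => Ω.gaugeAt z₀ (Complex.exp (θ * Complex.I)) with hh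
  have hpos : ∀ θ, 0 < h θ := fun θ => gaugeAt_pos hz₀ (Complex.exp_ne_zero _)
  set L : ℝ → ℂ := fun θ => -((Real.log (h θ) : ℝ) : ℂ) + θ * Complex.I with hL
  have hexp : ∀ θ, Ω.polarCurve z₀ θ = z₀ + Complex.exp (L θ) := by
    intro θ
    rw [polarCurve, hL]
    simp only
    rw [Complex.exp_add, Complex.exp_neg, ← Complex.ofReal_exp, Real.exp_log (hpos θ),
      Complex.real_smul, Complex.ofReal_inv]
  have hLd : ∀ θ, HasDerivAt L
      (Ω.polarVelocity z₀ θ • (Ω.polarCurve z₀ θ - z₀)⁻¹) θ := by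
    intro θ
    -- Only differentiability of `L` is needed here: its derivative is read off by comparing `exp ∘
    -- L` with the known velocity of `polarCurve`.
    obtain ⟨L', hL'⟩ : ∃ L', HasDerivAt L L' θ :=
      ⟨_, ((((hasDerivAt_gaugeAt_exp hΩ hz₀ θ).log (hpos θ).ne').ofReal_comp).neg).add
        ((hasDerivAt_id (θ : ℂ)).mul_const Complex.I).comp_ofReal⟩
    have h1 : HasDerivAt (Ω.polarCurve z₀) (Complex.exp (L θ) * L') θ := by
      have := hL'.cexp.const_add z₀
      exact this.congr_of_eventuallyEq (Eventually.of_forall hexp)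
    rw [(hasDerivAt_polarCurve hΩ hz₀ θ).unique h1, hexp, add_sub_cancel_left, smul_eq_mul,
      mul_comm (Complex.exp _), mul_inv_cancel_right₀ (Complex.exp_ne_zero _)]
    exact hL'
  rw [intervalIntegral.integral_eq_sub_of_hasDerivAt (fun θ _ => hLd θ)]
  · have : h (-Real.pi) = h Real.pi := by
      simp only [hh]
      congr 1
      push_cast
      rw [neg_mul, Complex.exp_neg, Complex.exp_pi_mul_I]; norm_num
    simp only [hL, this]
    push_cast
    ring
  · exact ((continuous_polarVelocity hΩ hz₀).smul
      (hc.comp ((continuous_polarCurve hΩ hz₀).subtype_mk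
        (polarCurve_mem_bdry hΩ hz₀)))).intervalIntegrable _ _

/-- A supporting line separates `z` from `Ω⁻`. After rotation by `-n̄`, the differences `σ - z` lie
in the right half-plane, where the principal logarithm is a primitive. -/
theorem integral_bdry_inv_sub_of_notMem (hΩ : Convex ℝ Ω.carrier) (hne : Ω.carrier.Nonempty) {z : ℂ}
    (hz : z ∉ closure Ω.carrier) :
    ∫ σ : Ω.bdry, (Complex.I * Ω.normal σ) • (σ - z : ℂ)⁻¹ ∂μH[1] = 0 := by
  obtain ⟨σ₀, hσ₀, hpos⟩ := exists_inner_normal_pos hΩ hne hz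
  set n := Ω.normal σ₀
  have hn : (starRingEnd ℂ) n ≠ 0 := by
    rw [Ne, map_eq_zero, ← norm_eq_zero, Ω.norm_normal hΩ hσ₀]
    exact one_ne_zero
  have hre : ∀ σ ∈ Ω.bdry, 0 < (-(starRingEnd ℂ) n * (σ - z)).re := by
    intro σ hσ
    have h1 := Ω.inner_sub_normal_nonpos hΩ hσ₀ (frontier_subset_closure hσ)
    rw [Complex.inner] at h1 hpos
    simp at h1 hpos ⊢
    linarith
  have hne' : ∀ σ ∈ Ω.bdry, σ - z ≠ 0 := fun σ hσ h => by
    have := hre σ hσ; rw [h] at this; simp at this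
  refine integral_bdry_deriv_eq_zero hΩ hne (F := fun w => Complex.log (-(starRingEnd ℂ) n * (w - z)))
    ((continuous_subtype_val.sub continuous_const).inv₀ fun σ => hne' σ σ.2) fun σ => ?_
  have := (((hasDerivAt_id (σ : ℂ)).sub_const z).const_mul (-(starRingEnd ℂ) n)).clog
    (Or.inl (hre σ σ.2))
  refine this.congr_deriv ?_
  have h2 := hne' σ σ.2
  simp only [id]
  field_simp

section Homotopy

variable {E : Type*} [NormedAddCommGroup E] [NormedSpace ℂ E] [CompleteSpace E]

/-- The abstract homotopy principle: if the derivative of the integrand in the parameter `s` is also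
a complex derivative along the curve, its contour integral vanishes and the integral is independent
of `s`. -/
theorem integral_bdry_eq_of_deriv_eq (hΩ : Convex ℝ Ω.carrier) (hne : Ω.carrier.Nonempty) {a b : ℝ}
    (hab : a ≤ b) {Φ Φ' : ℝ → Ω.bdry → E} {Ψ : ℝ → ℂ → E}
    (hΦ : ContinuousOn (Function.uncurry Φ) (Icc a b ×ˢ univ))
    (hΦ' : ContinuousOn (Function.uncurry Φ') (Ioo a b ×ˢ univ))
    (h1 : ∀ s ∈ Ioo a b, ∀ σ, HasDerivAt (fun s => Φ s σ) (Φ' s σ) s)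
    (h2 : ∀ s ∈ Ioo a b, ∀ σ : Ω.bdry, HasDerivAt (Ψ s) (Φ' s σ) σ) :
    ∫ σ : Ω.bdry, (Complex.I * Ω.normal σ) • Φ a σ ∂μH[1] =
      ∫ σ : Ω.bdry, (Complex.I * Ω.normal σ) • Φ b σ ∂μH[1] := by
  have := isFiniteMeasure_hausdorffMeasure hΩ hne
  have hn : Continuous fun σ : Ω.bdry => Complex.I * Ω.normal σ :=
    continuous_const.mul (Ω.continuous_normal hΩ)
  set J : ℝ → E := fun s => ∫ σ : Ω.bdry, (Complex.I * Ω.normal σ) • Φ s σ ∂μH[1] with hJ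
  have hslice : ∀ s ∈ Icc a b, Continuous (Φ s) := fun s hs =>
    hΦ.comp_continuous (by fun_prop : Continuous fun σ : Ω.bdry => (s, σ)) fun σ => ⟨hs, mem_univ _⟩
  have hslice' : ∀ s ∈ Ioo a b, Continuous (Φ' s) := fun s hs =>
    hΦ'.comp_continuous (by fun_prop : Continuous fun σ : Ω.bdry => (s, σ)) fun σ => ⟨hs, mem_univ _⟩
  have hJc : ContinuousOn J (Icc a b) := by
    rw [continuousOn_iff_continuous_domRestrict]
    have h3 : Continuous (Function.uncurry fun (s : Icc a b) (σ : Ω.bdry) =>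
        (Complex.I * Ω.normal σ) • Φ s σ) :=
      (hn.comp continuous_snd).smul (hΦ.comp_continuous
        (by fun_prop : Continuous fun p : Icc a b × Ω.bdry => ((p.1 : ℝ), p.2))
        fun p => ⟨p.1.2, mem_univ _⟩)
    have := continuous_parametric_integral_of_continuous (μ := (μH[1] : Measure Ω.bdry)) h3
      (isCompact_univ)
    simp only [Measure.restrict_univ] at this
    exact this
  have hJd : ∀ s ∈ Ioo a b, HasDerivAt J 0 s := by
    intro s hs
    obtain ⟨δ, hδ, hball⟩ := Metric.nhds_basis_closedBall.mem_iff.1 (isOpen_Ioo.mem_nhds hs)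
    obtain ⟨C, hC⟩ := ((isCompact_closedBall s δ).prod (isCompact_univ (X := Ω.bdry))).exists_bound_of_continuousOn
      (hΦ'.mono (prod_mono hball subset_rfl))
    have hball' : Metric.ball s δ ⊆ Ioo a b := Metric.ball_subset_closedBall.trans hball
    have key := hasDerivAt_integral_of_dominated_loc_of_deriv_le (μ := (μH[1] : Measure Ω.bdry))
      (F := fun s σ => (Complex.I * Ω.normal σ) • Φ s σ)
      (F' := fun s σ => (Complex.I * Ω.normal σ) • Φ' s σ) (bound := fun _ => C)
      (Metric.ball_mem_nhds s hδ)
      (Filter.eventually_of_mem (Metric.ball_mem_nhds s hδ) fun t ht =>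
        (hn.smul (hslice t (Ioo_subset_Icc_self (hball' ht)))).aestronglyMeasurable)
      ((hn.smul (hslice s (Ioo_subset_Icc_self hs))).integrable_of_hasCompactSupport
        (HasCompactSupport.of_compactSpace _))
      (hn.smul (hslice' s hs)).aestronglyMeasurable
      (Eventually.of_forall fun σ t ht => by
        rw [norm_smul, norm_mul, Complex.norm_I, Ω.norm_normal hΩ σ.2, one_mul, one_mul]
        exact hC (t, σ) ⟨Metric.ball_subset_closedBall ht, mem_univ _⟩)
      (integrable_const C)
      (Eventually.of_forall fun σ t ht => (h1 t (hball' ht) σ).const_smul _)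
    have hz := integral_bdry_deriv_eq_zero hΩ hne (hslice' s hs) (h2 s hs)
    rw [hz] at key
    exact key.2
  have := intervalIntegral.integral_eq_sub_of_hasDerivAt_of_le hab hJc hJd
    (intervalIntegrable_const)
  rw [intervalIntegral.integral_zero] at this
  exact (sub_eq_zero.1 this.symm).symm

/-- Contours can be contracted towards the centre `z₀` across a region where the integrand is
holomorphic. -/
theorem integral_bdry_eq_integral_dilate (hΩ : Convex ℝ Ω.carrier) (hz₀ : z₀ ∈ Ω.carrier) {r : ℝ}
    (hr0 : 0 ≤ r) (hr1 : r ≤ 1) {G : ℂ → E}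
    (hGc : ContinuousOn G {z | z ∈ closure Ω.carrier ∧ r ≤ Ω.gaugeAt z₀ (z - z₀)})
    (hGd : DifferentiableOn ℂ G {z | z ∈ Ω.carrier ∧ r < Ω.gaugeAt z₀ (z - z₀)}) :
    ∫ σ : Ω.bdry, (Complex.I * Ω.normal σ) • G σ ∂μH[1] =
      ∫ σ : Ω.bdry, (Complex.I * Ω.normal σ) • ((r : ℂ) • G (z₀ + r * (σ - z₀))) ∂μH[1] := by
  have hg : ∀ (s : ℝ), 0 ≤ s → ∀ σ : Ω.bdry,
      Ω.gaugeAt z₀ (z₀ + s * (σ - z₀) - z₀) = s := by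
    intro s hs σ
    rw [add_sub_cancel_left, ← Complex.real_smul, gaugeAt_smul hs,
      (gaugeAt_eq_one_iff hΩ hz₀).2 σ.2, mul_one]
  have hO : IsOpen {z | z ∈ Ω.carrier ∧ r < Ω.gaugeAt z₀ (z - z₀)} :=
    Ω.isOpen.inter (isOpen_lt continuous_const
      ((continuous_gaugeAt hΩ hz₀).comp (continuous_id.sub continuous_const)))
  have hmem : ∀ s ∈ Ioo r 1, ∀ σ : Ω.bdry, z₀ + s * (σ - z₀) ∈
      {z | z ∈ Ω.carrier ∧ r < Ω.gaugeAt z₀ (z - z₀)} := by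
    intro s hs σ
    have := hg s (hr0.trans hs.1.le) σ
    exact ⟨(gaugeAt_lt_one_iff hΩ hz₀).1 (this.trans_lt hs.2), hs.1.trans_eq this.symm⟩
  have hmem' : ∀ s ∈ Icc r 1, ∀ σ : Ω.bdry, z₀ + s * (σ - z₀) ∈
      {z | z ∈ closure Ω.carrier ∧ r ≤ Ω.gaugeAt z₀ (z - z₀)} := by
    intro s hs σ
    have := hg s (hr0.trans hs.1) σ
    refine ⟨?_, hs.1.trans_eq this.symm⟩
    rcases hs.2.lt_or_eq with h | h
    · exact subset_closure ((gaugeAt_lt_one_iff hΩ hz₀).1 (this.trans_lt h))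
    · exact frontier_subset_closure ((gaugeAt_eq_one_iff hΩ hz₀).1 (this.trans h))
  have hcont : Continuous fun p : ℝ × Ω.bdry => (z₀ + p.1 * (p.2 - z₀) : ℂ) := by fun_prop
  have hG' : ContinuousOn (deriv G) {z | z ∈ Ω.carrier ∧ r < Ω.gaugeAt z₀ (z - z₀)} :=
    (hGd.deriv hO).continuousOn
  have hGat : ∀ s ∈ Ioo r 1, ∀ σ : Ω.bdry,
      HasDerivAt G (deriv G (z₀ + s * (σ - z₀))) (z₀ + s * (σ - z₀)) := fun s hs σ =>
    (hGd.differentiableAt (hO.mem_nhds (hmem s hs σ))).hasDerivAt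
  -- The identity used is `d/ds [s G(z₀ + s(w - z₀))] = d/dw [(w - z₀) G(z₀ + s(w - z₀))]`.
  have := integral_bdry_eq_of_deriv_eq hΩ ⟨z₀, hz₀⟩ hr1
    (Φ := fun s σ => (s : ℂ) • G (z₀ + s * (σ - z₀)))
    (Φ' := fun s σ => G (z₀ + s * (σ - z₀)) + (s * (σ - z₀) : ℂ) • deriv G (z₀ + s * (σ - z₀)))
    (Ψ := fun s w => (w - z₀) • G (z₀ + s * (w - z₀))) ?_ ?_ ?_ ?_
  · rw [this]
    simp
  · exact (by fun_prop : ContinuousOn (fun p : ℝ × Ω.bdry => (p.1 : ℂ)) _).smul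
      (hGc.comp hcont.continuousOn fun p hp => hmem' p.1 hp.1 p.2)
  · refine ((hGd.continuousOn.comp hcont.continuousOn fun p hp => hmem p.1 hp.1 p.2)).add
      ((by fun_prop : ContinuousOn (fun p : ℝ × Ω.bdry => (p.1 * (p.2 - z₀) : ℂ)) _).smul
        (hG'.comp hcont.continuousOn fun p hp => hmem p.1 hp.1 p.2))
  · intro s hs σ
    have h1 : HasDerivAt (fun s : ℝ => (z₀ + s * (σ - z₀) : ℂ)) (σ - z₀) s := by
      have := (((hasDerivAt_id (s : ℂ)).mul_const (σ - z₀ : ℂ)).const_add z₀).comp_ofReal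
      simpa using this
    have h2 := HasDerivAt.scomp s (hGat s hs σ) h1
    have h3 := ((hasDerivAt_id (s : ℂ)).comp_ofReal).smul h2
    refine h3.congr_deriv ?_
    simp [mul_smul, add_comm]
  · intro s hs σ
    have h1 : HasDerivAt (fun w : ℂ => z₀ + s * (w - z₀)) (s : ℂ) σ := by
      have := ((((hasDerivAt_id (σ : ℂ)).sub_const z₀).const_mul (s : ℂ))).const_add z₀
      simpa using this
    have h2 := HasDerivAt.scomp (σ : ℂ) (hGat s hs σ) h1
    have h3 := ((hasDerivAt_id (σ : ℂ)).sub_const z₀).smul h2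
    refine h3.congr_deriv ?_
    simp only [id, one_smul, smul_smul, mul_comm (s : ℂ)]
    exact add_comm _ _

end Homotopy

end SmoothlyBoundedSet

/-! ### The contour integral of the resolvent. -/

section RingInverse

variable {𝔸 : Type*} [NormedRing 𝔸] [CompleteSpace 𝔸]

theorem HasDerivAt.ringInverse {𝕜 : Type*} [NontriviallyNormedField 𝕜] [NormedAlgebra 𝕜 𝔸]
    {c : 𝕜 → 𝔸} {c' : 𝔸} {t : 𝕜} (hc : HasDerivAt c c' t)
    (hu : IsUnit (c t)) : HasDerivAt (fun s => Ring.inverse (c s))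
      (-(Ring.inverse (c t) * c' * Ring.inverse (c t))) t := by
  obtain ⟨u, hu⟩ := hu
  have h := hasFDerivAt_ringInverse (𝕜 := 𝕜) u
  rw [hu] at h
  have := h.comp_hasDerivAt t hc
  refine this.congr_deriv ?_
  rw [← hu, Ring.inverse_unit]
  simp

theorem ContinuousOn.ringInverse {X : Type*} [TopologicalSpace X] {c : X → 𝔸} {s : Set X}
    (hc : ContinuousOn c s) (hu : ∀ x ∈ s, IsUnit (c x)) :
    ContinuousOn (fun x => Ring.inverse (c x)) s := by
  intro x hx
  obtain ⟨u, hu⟩ := hu x hx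
  have := NormedRing.inverse_continuousAt u
  rw [hu] at this
  exact this.comp_continuousWithinAt (hc x hx)

end RingInverse

namespace SmoothlyBoundedSet

variable {Ω : SmoothlyBoundedSet} {z₀ : ℂ}
variable {𝔸 : Type*} [NormedRing 𝔸] [NormedAlgebra ℂ 𝔸]

/-- For `s > 0` the element is `s` times `w - A` with `w = z₀ + s⁻¹ (σ - z₀)`. Its gauge is `1/s ≥
1`, so `w` is outside `Ω` and hence outside the spectrum. -/
theorem isUnit_sub_smul_of_spectrum_subset (hΩ : Convex ℝ Ω.carrier) (hz₀ : z₀ ∈ Ω.carrier) {A : 𝔸}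
    (hA : spectrum ℂ A ⊆ Ω.carrier) {s : ℝ} (hs : s ∈ Icc (0 : ℝ) 1) {σ : ℂ} (hσ : σ ∈ Ω.bdry) :
    IsUnit (algebraMap ℂ 𝔸 (σ - z₀) - (s : ℂ) • (A - algebraMap ℂ 𝔸 z₀)) := by
  rcases hs.1.eq_or_lt with rfl | hpos
  · rw [Complex.ofReal_zero, zero_smul, sub_zero]
    exact (isUnit_iff_ne_zero.2 (sub_ne_zero_of_mem_bdry hσ hz₀)).map (algebraMap ℂ 𝔸)
  · have hs0 : (s : ℂ) ≠ 0 := by exact_mod_cast hpos.ne'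
    have h1 : (z₀ + (s : ℂ)⁻¹ * (σ - z₀)) ∉ spectrum ℂ A := by
      intro h
      have := (gaugeAt_lt_one_iff hΩ hz₀).2 (hA h)
      rw [add_sub_cancel_left, ← Complex.ofReal_inv, ← Complex.real_smul,
        gaugeAt_smul (by positivity), (gaugeAt_eq_one_iff hΩ hz₀).2 hσ, mul_one] at this
      exact absurd this (not_lt.2 ((one_le_inv₀ hpos).2 hs.2))
    rw [spectrum.notMem_iff] at h1
    have h2 : algebraMap ℂ 𝔸 (σ - z₀) - (s : ℂ) • (A - algebraMap ℂ 𝔸 z₀) =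
        algebraMap ℂ 𝔸 s * (algebraMap ℂ 𝔸 (z₀ + (s : ℂ)⁻¹ * (σ - z₀)) - A) := by
      rw [mul_sub, ← map_mul, mul_add, mul_inv_cancel_left₀ hs0, map_add, map_mul, Algebra.smul_def,
        mul_sub]
      abel
    rw [h2]
    exact ((isUnit_iff_ne_zero.2 hs0).map (algebraMap ℂ 𝔸)).mul h1

variable [CompleteSpace 𝔸]

/-- The resolvent of `A` integrates to `2πi` along a contour around the spectrum of `A`. -/
theorem integral_bdry_resolvent (hΩ : Convex ℝ Ω.carrier) (hne : Ω.carrier.Nonempty) {A : 𝔸}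
    (hA : spectrum ℂ A ⊆ Ω.carrier) :
    ∫ σ : Ω.bdry, (Complex.I * Ω.normal σ) • resolvent A (σ : ℂ) ∂μH[1] =
      (2 * Real.pi * Complex.I : ℂ) • (1 : 𝔸) := by
  obtain ⟨z₀, hz₀⟩ := hne
  set B : 𝔸 := A - algebraMap ℂ 𝔸 z₀ with hB
  set c : ℝ → ℂ → 𝔸 := fun s w => algebraMap ℂ 𝔸 (w - z₀) - (s : ℂ) • B with hc
  have hunit : ∀ s ∈ Icc (0 : ℝ) 1, ∀ σ : Ω.bdry, IsUnit (c s σ) := fun s hs σ =>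
    isUnit_sub_smul_of_spectrum_subset hΩ hz₀ hA hs σ.2
  have hcc : Continuous fun p : ℝ × Ω.bdry => c p.1 p.2 := by
    have : Continuous (algebraMap ℂ 𝔸) := continuous_algebraMap ℂ 𝔸
    exact (this.comp (by fun_prop)).sub ((by fun_prop : Continuous fun p : ℝ × Ω.bdry =>
      (p.1 : ℂ)).smul continuous_const)
  have hcomm : ∀ s ∈ Icc (0 : ℝ) 1, ∀ σ : Ω.bdry, Commute B (Ring.inverse (c s σ)) := by
    intro s hs σ
    obtain ⟨u, hu⟩ := hunit s hs σ
    rw [← hu, Ring.inverse_unit]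
    refine Commute.units_inv_right ?_
    rw [hu]
    exact (Algebra.commute_algebraMap_right _ B).sub_right ((Commute.refl B).smul_right _)
  -- Homotopy `z₀ + s B` from the scalar `z₀` to `A`. Writing `R` for the resolvent, `dR/ds = R B
  -- R`, and this is `d/dw (-B R)` because `B` commutes with `R`.
  have key := integral_bdry_eq_of_deriv_eq hΩ ⟨z₀, hz₀⟩ zero_le_one
    (Φ := fun s σ => Ring.inverse (c s σ))
    (Φ' := fun s σ => Ring.inverse (c s σ) * B * Ring.inverse (c s σ))
    (Ψ := fun s w => -(B * Ring.inverse (c s w))) ?_ ?_ ?_ ?_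
  · have h1 : ∀ σ : Ω.bdry, Ring.inverse (c 1 σ) = resolvent A (σ : ℂ) := by
      intro σ
      simp [hc, hB, resolvent]
    have h0 : ∀ σ : Ω.bdry, Ring.inverse (c 0 σ) = (σ - z₀ : ℂ)⁻¹ • (1 : 𝔸) := by
      intro σ
      have hne := sub_ne_zero_of_mem_bdry σ.2 hz₀
      rw [← mul_one (Ring.inverse _), Ring.inverse_mul_eq_iff_eq_mul _ _ _ (hunit 0 (by simp) σ)]
      simp only [hc, Complex.ofReal_zero, zero_smul, sub_zero, Algebra.algebraMap_eq_smul_one]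
      rw [smul_mul_smul_comm, mul_inv_cancel₀ hne, one_smul, mul_one]
    simp only [h1, h0] at key
    rw [← key, ← integral_bdry_inv_sub hΩ hz₀]
    simp only [← smul_assoc]
    exact integral_smul_const _ _
  · exact ContinuousOn.ringInverse hcc.continuousOn fun p hp => hunit p.1 hp.1 p.2
  · have h1 : ContinuousOn (fun p : ℝ × Ω.bdry => Ring.inverse (c p.1 p.2)) (Ioo 0 1 ×ˢ univ) :=
      ContinuousOn.ringInverse hcc.continuousOn fun p hp => hunit p.1 (Ioo_subset_Icc_self hp.1) p.2
    exact (h1.mul continuousOn_const).mul h1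
  · intro s hs σ
    have h1 : HasDerivAt (fun s => c s σ) (-B) s := by
      have := (((hasDerivAt_id (s : ℂ)).comp_ofReal).smul_const B).const_sub
        (algebraMap ℂ 𝔸 (σ - z₀))
      exact this.congr_deriv (by simp)
    refine (h1.ringInverse (hunit s (Ioo_subset_Icc_self hs) σ)).congr_deriv ?_
    simp
  · intro s hs σ
    have h1 : HasDerivAt (fun w => c s w) (1 : 𝔸) σ := by
      have := (((hasDerivAt_id (σ : ℂ)).sub_const z₀).smul_const (1 : 𝔸)).sub_const ((s : ℂ) • B)
      simpa [hc, Algebra.algebraMap_eq_smul_one] using this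
    have h2 := ((h1.ringInverse (hunit s (Ioo_subset_Icc_self hs) σ)).const_mul B).neg
    refine h2.congr_deriv ?_
    rw [← (hcomm s (Ioo_subset_Icc_self hs) σ).eq]
    simp [mul_assoc]

end SmoothlyBoundedSet

/-! ### The double-layer potential and its continuity up to the boundary. -/

namespace SmoothlyBoundedSet

variable {Ω : SmoothlyBoundedSet} {z₀ : ℂ}

theorem integrable_of_continuous {E : Type*} [NormedAddCommGroup E] (hΩ : Convex ℝ Ω.carrier)
    (hne : Ω.carrier.Nonempty) {f : Ω.bdry → E} (hf : Continuous f) :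
    Integrable f (μH[1] : Measure Ω.bdry) := by
  have := isFiniteMeasure_hausdorffMeasure hΩ hne
  exact hf.integrable_of_hasCompactSupport (HasCompactSupport.of_compactSpace _)

theorem continuous_doubleLayerPotential_uncurry (hΩ : Convex ℝ Ω.carrier) :
    Continuous fun p : Ω.carrier × Ω.bdry => Ω.doubleLayerPotential p.2 p.1 := by
  have h1 : Continuous fun p : Ω.carrier × Ω.bdry => Ω.normal p.2 :=
    (Ω.continuous_normal hΩ).comp continuous_snd
  exact continuous_const.mul (Complex.continuous_re.comp
    (h1.div (by fun_prop) fun p => sub_ne_zero_of_mem_bdry p.2.2 p.1.2))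

theorem continuous_doubleLayerPotential (hΩ : Convex ℝ Ω.carrier) {z : ℂ} (hz : z ∈ Ω.carrier) :
    Continuous fun σ : Ω.bdry => Ω.doubleLayerPotential σ z :=
  continuous_const.mul (Complex.continuous_re.comp ((Ω.continuous_normal hΩ).div
    (by fun_prop) fun σ => sub_ne_zero_of_mem_bdry σ.2 hz))

theorem doubleLayerPotential_nonneg (hΩ : Convex ℝ Ω.carrier) {σ z : ℂ} (hσ : σ ∈ Ω.bdry)
    (hz : z ∈ Ω.carrier) : 0 ≤ Ω.doubleLayerPotential σ z := by
  have h := (inner_sub_normal_pos hΩ hz hσ).le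
  rw [doubleLayerPotential, div_eq_mul_inv (Ω.normal σ), Complex.inv_def, ← mul_assoc, Complex.re_mul_ofReal]
  rw [Complex.inner] at h
  exact mul_nonneg (by positivity) (mul_nonneg h (inv_nonneg.2 (Complex.normSq_nonneg _)))

/-- The potential is `1/π` times the imaginary part of the density of `dσ / (σ - z)`, whose integral
is `2πi`. -/
theorem integral_doubleLayerPotential (hΩ : Convex ℝ Ω.carrier) {z : ℂ} (hz : z ∈ Ω.carrier) :
    ∫ σ : Ω.bdry, Ω.doubleLayerPotential σ z ∂μH[1] = 2 := by
  have h1 := integral_bdry_inv_sub hΩ hz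
  have hc : Continuous fun σ : Ω.bdry => (Complex.I * Ω.normal σ) • (σ - z : ℂ)⁻¹ :=
    (continuous_const.mul (Ω.continuous_normal hΩ)).smul
      ((continuous_subtype_val.sub continuous_const).inv₀ fun σ => sub_ne_zero_of_mem_bdry σ.2 hz)
  have h2 := Complex.imCLM.integral_comp_comm (integrable_of_continuous hΩ ⟨z, hz⟩ hc)
  rw [h1] at h2
  have h3 : ∀ σ : Ω.bdry, Ω.doubleLayerPotential σ z =
      (1 / Real.pi) * Complex.imCLM ((Complex.I * Ω.normal σ) • (σ - z : ℂ)⁻¹) := by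
    intro σ
    rw [doubleLayerPotential, Complex.imCLM_apply, smul_eq_mul, mul_assoc, Complex.I_mul_im,
      div_eq_mul_inv (Ω.normal σ)]
  simp only [h3]
  rw [integral_const_mul, h2]
  simp
  field_simp

theorem norm_doubleLayerPotential_sub_le (hΩ : Convex ℝ Ω.carrier) {σ : ℂ} (hσ : σ ∈ Ω.bdry)
    {z z' : ℂ} (hz : z ∈ Ω.carrier) (hz' : z' ∈ Ω.carrier) {d : ℝ} (hd : 0 < d)
    (h : d ≤ ‖σ - z‖) (h' : d ≤ ‖σ - z'‖) :
    |Ω.doubleLayerPotential σ z - Ω.doubleLayerPotential σ z'| ≤ ‖z - z'‖ / d ^ 2 := by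
  have h0 := sub_ne_zero_of_mem_bdry hσ hz
  have h0' := sub_ne_zero_of_mem_bdry hσ hz'
  have h1 : Ω.doubleLayerPotential σ z - Ω.doubleLayerPotential σ z' =
      (1 / Real.pi) * (Ω.normal σ * (z - z') / ((σ - z) * (σ - z'))).re := by
    rw [doubleLayerPotential, doubleLayerPotential, ← mul_sub, ← Complex.sub_re]
    congr 2
    field_simp
    ring
  have hpi : (1 : ℝ) / Real.pi ≤ 1 := by
    rw [div_le_one Real.pi_pos]; linarith [Real.pi_gt_three]
  rw [h1, abs_mul, abs_of_pos (by positivity)]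
  calc 1 / Real.pi * |(Ω.normal σ * (z - z') / ((σ - z) * (σ - z'))).re|
      ≤ 1 * ‖Ω.normal σ * (z - z') / ((σ - z) * (σ - z'))‖ := by
        gcongr
        exact Complex.abs_re_le_norm _
    _ = ‖z - z'‖ / (‖σ - z‖ * ‖σ - z'‖) := by
        rw [norm_div, norm_mul, norm_mul, Ω.norm_normal hΩ hσ, one_mul, one_mul]
    _ ≤ ‖z - z'‖ / d ^ 2 := by
        rw [pow_two]
        gcongr

/-- The interior double-layer potential with density `φ`. -/
noncomputable def doubleLayer (Ω : SmoothlyBoundedSet) (φ : C(Ω.bdry, ℂ)) (z : ℂ) : ℂ :=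
  ∫ σ : Ω.bdry, φ σ * (Ω.doubleLayerPotential σ z : ℂ) ∂μH[1]

theorem norm_doubleLayer_le (hΩ : Convex ℝ Ω.carrier) (φ : C(Ω.bdry, ℂ)) {z : ℂ}
    (hz : z ∈ Ω.carrier) : ‖Ω.doubleLayer φ z‖ ≤ 2 * ‖φ‖ := by
  calc ‖Ω.doubleLayer φ z‖ ≤ ∫ σ : Ω.bdry, ‖φ‖ * Ω.doubleLayerPotential σ z ∂μH[1] := by
        refine norm_integral_le_of_norm_le (integrable_of_continuous hΩ ⟨z, hz⟩
          (continuous_const.mul (continuous_doubleLayerPotential hΩ hz)))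
          (Eventually.of_forall fun σ => ?_)
        have := doubleLayerPotential_nonneg hΩ σ.2 hz
        rw [norm_mul, Complex.norm_real, Real.norm_of_nonneg this]
        gcongr
        exact φ.norm_coe_le_norm σ
    _ = 2 * ‖φ‖ := by rw [integral_const_mul, integral_doubleLayerPotential hΩ hz, mul_comm]

theorem continuousOn_doubleLayer (hΩ : Convex ℝ Ω.carrier) (φ : C(Ω.bdry, ℂ)) :
    ContinuousOn (Ω.doubleLayer φ) Ω.carrier := by
  rcases Ω.carrier.eq_empty_or_nonempty with h | hne
  · rw [h]; exact continuousOn_empty _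
  have := isFiniteMeasure_hausdorffMeasure hΩ hne
  have := Ω.isOpen.locallyCompactSpace
  rw [continuousOn_iff_continuous_domRestrict]
  have h3 : Continuous (Function.uncurry fun (z : Ω.carrier) (σ : Ω.bdry) =>
      φ σ * (Ω.doubleLayerPotential σ z : ℂ)) :=
    (φ.continuous.comp continuous_snd).mul
      (Complex.continuous_ofReal.comp (continuous_doubleLayerPotential_uncurry hΩ))
  have := continuous_parametric_integral_of_continuous (μ := (μH[1] : Measure Ω.bdry))
    (X := Ω.carrier) (E := ℂ) h3 isCompact_univ
  simp only [Measure.restrict_univ] at this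
  exact this

/-- Constants have the same potential at all interior points, so `φ σ₀` may be subtracted. Near `σ₀`
the density is at most `ε` and the two kernels have total mass `4`. Away from `σ₀` the kernel is
Lipschitz in `z`, at distance at least `δ / 2` from the poles. -/
theorem norm_doubleLayer_sub_le (hΩ : Convex ℝ Ω.carrier) (φ : C(Ω.bdry, ℂ)) (σ₀ : Ω.bdry)
    {ε δ : ℝ} (hδ : 0 < δ) (hφ : ∀ σ : Ω.bdry, dist σ σ₀ < δ → ‖φ σ - φ σ₀‖ ≤ ε) (hε : 0 ≤ ε)
    {z z' : ℂ} (hz : z ∈ Ω.carrier) (hz' : z' ∈ Ω.carrier) (hzd : ‖z - σ₀‖ ≤ δ / 2)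
    (hzd' : ‖z' - σ₀‖ ≤ δ / 2) :
    ‖Ω.doubleLayer φ z - Ω.doubleLayer φ z'‖ ≤ 4 * ε +
      2 * ‖φ‖ * (‖z - z'‖ / (δ / 2) ^ 2) * (μH[1] : Measure Ω.bdry).real univ := by
  have := isFiniteMeasure_hausdorffMeasure hΩ ⟨z, hz⟩
  have hP := continuous_doubleLayerPotential hΩ hz
  have hP' := continuous_doubleLayerPotential hΩ hz'
  have hPi := integrable_of_continuous hΩ ⟨z, hz⟩ hP
  have hPi' := integrable_of_continuous hΩ ⟨z, hz⟩ hP'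
  have hm := integral_doubleLayerPotential hΩ hz
  have hm' := integral_doubleLayerPotential hΩ hz'
  have hPs : Integrable (fun σ : Ω.bdry =>
      Ω.doubleLayerPotential σ z - Ω.doubleLayerPotential σ z') μH[1] := hPi.sub hPi'
  have hPa : Integrable (fun σ : Ω.bdry =>
      Ω.doubleLayerPotential σ z + Ω.doubleLayerPotential σ z') μH[1] := hPi.add hPi'
  have key : Ω.doubleLayer φ z - Ω.doubleLayer φ z' = ∫ σ : Ω.bdry, (φ σ - φ σ₀) *
      ((Ω.doubleLayerPotential σ z - Ω.doubleLayerPotential σ z' : ℝ) : ℂ) ∂μH[1] := by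
    have e : ∀ σ : Ω.bdry, (φ σ - φ σ₀) *
      ((Ω.doubleLayerPotential σ z - Ω.doubleLayerPotential σ z' : ℝ) : ℂ) =
      (φ σ * (Ω.doubleLayerPotential σ z : ℂ) - φ σ * (Ω.doubleLayerPotential σ z' : ℂ)) -
      φ σ₀ * ((Ω.doubleLayerPotential σ z - Ω.doubleLayerPotential σ z' : ℝ) : ℂ) := by
      intro σ; push_cast; ring
    have i1 : ∀ w ∈ Ω.carrier, Integrable (fun σ : Ω.bdry =>
        φ σ * (Ω.doubleLayerPotential σ w : ℂ)) μH[1] := fun w hw =>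
      integrable_of_continuous hΩ ⟨z, hz⟩ (φ.continuous.mul
        (Complex.continuous_ofReal.comp (continuous_doubleLayerPotential hΩ hw)))
    simp only [e]
    have i2 : Integrable (fun σ : Ω.bdry => φ σ * (Ω.doubleLayerPotential σ z : ℂ) -
        φ σ * (Ω.doubleLayerPotential σ z' : ℂ)) μH[1] := (i1 z hz).sub (i1 z' hz')
    have i3 : Integrable (fun σ : Ω.bdry => φ σ₀ *
        ((Ω.doubleLayerPotential σ z - Ω.doubleLayerPotential σ z' : ℝ) : ℂ)) μH[1] :=
      hPs.ofReal.const_mul _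
    rw [integral_sub i2 i3,
      integral_sub (i1 z hz) (i1 z' hz'), integral_const_mul, integral_complex_ofReal,
      integral_sub hPi hPi', hm, hm']
    simp [doubleLayer]
  rw [key]
  set κ := ‖z - z'‖ / (δ / 2) ^ 2 with hκ
  calc _ ≤ ∫ σ : Ω.bdry, (ε * (Ω.doubleLayerPotential σ z + Ω.doubleLayerPotential σ z') +
        2 * ‖φ‖ * κ) ∂μH[1] := by
        refine norm_integral_le_of_norm_le ((hPa.const_mul ε).add (integrable_const _))
          (Eventually.of_forall fun σ => ?_)
        have p1 := doubleLayerPotential_nonneg hΩ σ.2 hz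
        have p2 := doubleLayerPotential_nonneg hΩ σ.2 hz'
        have hκ0 : 0 ≤ κ := by positivity
        rw [norm_mul, Complex.norm_real, Real.norm_eq_abs]
        by_cases hσ : dist σ σ₀ < δ
        · calc _ ≤ ε * (Ω.doubleLayerPotential σ z + Ω.doubleLayerPotential σ z') := by
                gcongr
                · exact hφ σ hσ
                · rw [abs_le]; constructor <;> linarith
            _ ≤ _ := le_add_of_nonneg_right (by positivity)
        · have hd : ∀ w : ℂ, ‖w - σ₀‖ ≤ δ / 2 → δ / 2 ≤ ‖(σ : ℂ) - w‖ := by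
            intro w hw
            rw [Subtype.dist_eq, dist_eq_norm, not_lt] at hσ
            have := norm_sub_le_norm_sub_add_norm_sub (σ : ℂ) w σ₀
            linarith
          calc _ ≤ (2 * ‖φ‖) * κ := by
                gcongr
                · calc ‖φ σ - φ σ₀‖ ≤ ‖φ σ‖ + ‖φ σ₀‖ := norm_sub_le _ _
                    _ ≤ 2 * ‖φ‖ := by linarith [φ.norm_coe_le_norm σ, φ.norm_coe_le_norm σ₀]
                · exact norm_doubleLayerPotential_sub_le hΩ σ.2 hz hz' (by positivity) (hd z hzd)
                    (hd z' hzd')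
            _ ≤ _ := le_add_of_nonneg_left (by positivity)
    _ = _ := by
        rw [integral_add (hPa.const_mul ε) (integrable_const _), integral_const_mul,
          integral_add hPi hPi', hm, hm', integral_const, smul_eq_mul]
        ring

theorem exists_tendsto_doubleLayer (hΩ : Convex ℝ Ω.carrier) (φ : C(Ω.bdry, ℂ)) {z : ℂ}
    (hz : z ∈ closure Ω.carrier) : ∃ y, Tendsto (Ω.doubleLayer φ) (𝓝[Ω.carrier] z) (𝓝 y) := by
  by_cases hzΩ : z ∈ Ω.carrier
  · exact ⟨_, continuousOn_doubleLayer hΩ φ z hzΩ⟩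
  have hσ : z ∈ Ω.bdry := by rw [bdry, Ω.isOpen.frontier_eq]; exact ⟨hz, hzΩ⟩
  set σ₀ : Ω.bdry := ⟨z, hσ⟩
  have := mem_closure_iff_nhdsWithin_neBot.1 hz
  refine cauchy_map_iff_exists_tendsto.1 (Metric.cauchy_iff.2 ⟨inferInstance, fun ε hε => ?_⟩)
  obtain ⟨δ, hδ, hφ⟩ := Metric.continuousAt_iff.1 (φ.continuous.continuousAt (x := σ₀)) (ε / 8)
    (by positivity)
  set m := (μH[1] : Measure Ω.bdry).real univ with hm
  have hm0 : 0 ≤ m := measureReal_nonneg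
  set D := 2 * ‖φ‖ * m * (2 / (δ / 2) ^ 2) with hD
  have hD0 : 0 ≤ D := by positivity
  -- Within `η` of `z` the near part costs `4 · ε/8 = ε/2` and the far part at most `D η ≤ ε/4`.
  -- Adding `1` to `D` avoids division by zero.
  set η := min (δ / 2) (ε / (4 * (D + 1))) with hη
  have hη0 : 0 < η := by positivity
  refine ⟨Ω.doubleLayer φ '' (Ω.carrier ∩ Metric.ball z η), image_mem_map
    (inter_mem self_mem_nhdsWithin (nhdsWithin_le_nhds (Metric.ball_mem_nhds z hη0))), ?_⟩
  rintro _ ⟨w, ⟨hw, hwb⟩, rfl⟩ _ ⟨w', ⟨hw', hwb'⟩, rfl⟩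
  rw [mem_ball_iff_norm] at hwb hwb'
  rw [dist_eq_norm]
  have hww : ‖w - w'‖ ≤ 2 * η := by
    have := norm_sub_le_norm_sub_add_norm_sub w z w'
    rw [norm_sub_rev z w'] at this
    linarith
  have hηδ : η ≤ δ / 2 := min_le_left _ _
  calc _ ≤ 4 * (ε / 8) + 2 * ‖φ‖ * (‖w - w'‖ / (δ / 2) ^ 2) * m :=
        norm_doubleLayer_sub_le hΩ φ σ₀ hδ (fun σ hσ => by
          rw [← dist_eq_norm]; exact (hφ hσ).le) (by positivity) hw hw' (hwb.le.trans hηδ)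
          (hwb'.le.trans hηδ)
    _ ≤ 4 * (ε / 8) + 2 * ‖φ‖ * ((2 * η) / (δ / 2) ^ 2) * m := by gcongr
    _ = ε / 2 + D * η := by rw [hD]; ring
    _ ≤ ε / 2 + D * (ε / (4 * (D + 1))) := by gcongr; exact min_le_right _ _
    _ < ε := by
        have : D * (ε / (4 * (D + 1))) ≤ ε / 4 := by
          rw [mul_div_assoc', div_le_div_iff₀ (by positivity) (by positivity)]
          nlinarith
        linarith

/-- The continuous extension of the interior double-layer potential to the closure of `Ω`. -/
noncomputable def doubleLayerExt (Ω : SmoothlyBoundedSet) (φ : C(Ω.bdry, ℂ)) : ℂ → ℂ :=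
  extendFrom Ω.carrier (Ω.doubleLayer φ)

theorem continuousOn_doubleLayerExt (hΩ : Convex ℝ Ω.carrier) (φ : C(Ω.bdry, ℂ)) :
    ContinuousOn (Ω.doubleLayerExt φ) (closure Ω.carrier) :=
  continuousOn_extendFrom subset_rfl fun _ hz => exists_tendsto_doubleLayer hΩ φ hz

theorem doubleLayerExt_eq (hΩ : Convex ℝ Ω.carrier) (φ : C(Ω.bdry, ℂ)) {z : ℂ}
    (hz : z ∈ Ω.carrier) : Ω.doubleLayerExt φ z = Ω.doubleLayer φ z :=
  extendFrom_eq (subset_closure hz) (continuousOn_doubleLayer hΩ φ z hz)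

end SmoothlyBoundedSet

/-! ### Construction and uniqueness of the interior double-layer transform. -/

namespace SmoothlyBoundedSet

variable {Ω : SmoothlyBoundedSet} {z₀ : ℂ}

instance (Ω : SmoothlyBoundedSet) : CompleteSpace Ω.harmonicSpace :=
  (Submodule.isClosed_topologicalClosure _).completeSpace_coe

theorem dilate_mem (hΩ : Convex ℝ Ω.carrier) (hz₀ : z₀ ∈ Ω.carrier) (r : Ico (0 : ℝ) 1) {z : ℂ}
    (hz : z ∈ closure Ω.carrier) : z₀ + r * (z - z₀) ∈ Ω.carrier := by
  have := hΩ.add_smul_sub_mem_interior' hz (Ω.isOpen.interior_eq.symm ▸ hz₀) (t := 1 - r)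
    ⟨by linarith [r.2.2], by linarith [r.2.1]⟩
  rw [Ω.isOpen.interior_eq] at this
  convert this using 1
  simp only [Complex.real_smul]; push_cast; ring

theorem sub_dilate_ne_zero (hΩ : Convex ℝ Ω.carrier) (hz₀ : z₀ ∈ Ω.carrier) (r : Ico (0 : ℝ) 1)
    (σ : Ω.bdry) {z : ℂ} (hz : z ∈ closure Ω.carrier) : (σ - (z₀ + r * (z - z₀)) : ℂ) ≠ 0 :=
  sub_ne_zero_of_mem_bdry σ.2 (dilate_mem hΩ hz₀ r hz)

/-- The function `z ↦ n(σ) / (2π (σ - z_r))`, where `z_r = z₀ + r (z - z₀)` with `r < 1`. -/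
noncomputable def cauchyKernel (hΩ : Convex ℝ Ω.carrier) (hz₀ : z₀ ∈ Ω.carrier) (r : Ico (0 : ℝ) 1)
    (σ : Ω.bdry) : Ω.analyticSpace :=
  ⟨⟨fun τ => (1 / (2 * Real.pi)) * (Ω.normal σ * (σ - (z₀ + r * (τ - z₀)))⁻¹),
    continuous_const.mul (continuous_const.mul ((by fun_prop : Continuous fun τ : Ω.bdry =>
      (σ - (z₀ + r * (τ - z₀)) : ℂ)).inv₀ fun τ =>
        sub_dilate_ne_zero hΩ hz₀ r σ (frontier_subset_closure τ.2)))⟩,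
    fun z => (1 / (2 * Real.pi)) * (Ω.normal σ * (σ - (z₀ + r * (z - z₀)))⁻¹),
    by
      refine DifferentiableOn.diffContOnCl fun z hz => ?_
      exact ((((by fun_prop : DifferentiableAt ℂ (fun z : ℂ => (σ - (z₀ + r * (z - z₀)) : ℂ)) z).inv
        (sub_dilate_ne_zero hΩ hz₀ r σ hz)).const_mul _).const_mul _).differentiableWithinAt,
    fun _ => rfl⟩

theorem cauchyKernel_apply (hΩ : Convex ℝ Ω.carrier) (hz₀ : z₀ ∈ Ω.carrier) (r : Ico (0 : ℝ) 1)
    (σ τ : Ω.bdry) : (cauchyKernel hΩ hz₀ r σ : C(Ω.bdry, ℂ)) τ =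
      (1 / (2 * Real.pi)) * (Ω.normal σ * (σ - (z₀ + r * (τ - z₀)))⁻¹) := rfl

/-- The dilated double-layer potential `z ↦ P_Ω(σ, z₀ + r (z - z₀))` as an element of `ℋ(Ω⁻)`. -/
noncomputable def dilatedPotential (hΩ : Convex ℝ Ω.carrier) (hz₀ : z₀ ∈ Ω.carrier)
    (r : Ico (0 : ℝ) 1) (σ : Ω.bdry) : Ω.harmonicSpace :=
  Ω.addStar (cauchyKernel hΩ hz₀ r σ) (cauchyKernel hΩ hz₀ r σ)

theorem dilatedPotential_apply (hΩ : Convex ℝ Ω.carrier) (hz₀ : z₀ ∈ Ω.carrier)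
    (r : Ico (0 : ℝ) 1) (σ τ : Ω.bdry) :
    (dilatedPotential hΩ hz₀ r σ : C(Ω.bdry, ℂ)) τ =
      (Ω.doubleLayerPotential σ (z₀ + r * (τ - z₀)) : ℂ) := by
  change (cauchyKernel hΩ hz₀ r σ : C(Ω.bdry, ℂ)) τ +
    (starRingEnd ℂ) ((cauchyKernel hΩ hz₀ r σ : C(Ω.bdry, ℂ)) τ) = _
  rw [Complex.add_conj, cauchyKernel_apply, doubleLayerPotential, ← div_eq_mul_inv]
  rw [show (1 / (2 * Real.pi) : ℂ) = ((1 / (2 * Real.pi) : ℝ) : ℂ) by push_cast; rfl,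
    Complex.re_ofReal_mul]
  push_cast
  field_simp

theorem continuous_dilatedPotential (hΩ : Convex ℝ Ω.carrier) (hz₀ : z₀ ∈ Ω.carrier)
    (r : Ico (0 : ℝ) 1) : Continuous (dilatedPotential hΩ hz₀ r) := by
  have h : Continuous fun σ => (cauchyKernel hΩ hz₀ r σ : C(Ω.bdry, ℂ)) := by
    refine ContinuousMap.continuous_of_continuous_uncurry _ ?_
    have h1 : Continuous fun p : Ω.bdry × Ω.bdry => Ω.normal p.1 :=
      (Ω.continuous_normal hΩ).comp continuous_fst
    have h2 : Continuous fun p : Ω.bdry × Ω.bdry =>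
        ((1 / (2 * Real.pi)) * (Ω.normal p.1 * (p.1 - (z₀ + r * (p.2 - z₀)))⁻¹) : ℂ) :=
      continuous_const.mul (h1.mul ((by fun_prop : Continuous fun p : Ω.bdry × Ω.bdry =>
      (p.1 - (z₀ + r * (p.2 - z₀)) : ℂ)).inv₀ fun p =>
        sub_dilate_ne_zero hΩ hz₀ r p.1 (frontier_subset_closure p.2.2)))
    exact h2
  exact (h.add h.star).subtype_mk _

/-- The dilated double-layer transform `φ ↦ ∫ φ(σ) P_Ω(σ, z₀ + r (· - z₀)) |dσ|`. -/
noncomputable def dilatedTransform (hΩ : Convex ℝ Ω.carrier) (hz₀ : z₀ ∈ Ω.carrier)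
    (r : Ico (0 : ℝ) 1) (φ : C(Ω.bdry, ℂ)) : Ω.harmonicSpace :=
  ∫ σ : Ω.bdry, φ σ • dilatedPotential hΩ hz₀ r σ ∂μH[1]

theorem integrable_smul_dilatedPotential (hΩ : Convex ℝ Ω.carrier) (hz₀ : z₀ ∈ Ω.carrier)
    (r : Ico (0 : ℝ) 1) (φ : C(Ω.bdry, ℂ)) :
    Integrable (fun σ : Ω.bdry => φ σ • dilatedPotential hΩ hz₀ r σ) μH[1] :=
  integrable_of_continuous hΩ ⟨z₀, hz₀⟩ (φ.continuous.smul (continuous_dilatedPotential hΩ hz₀ r))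

theorem dilatedTransform_apply (hΩ : Convex ℝ Ω.carrier) (hz₀ : z₀ ∈ Ω.carrier)
    (r : Ico (0 : ℝ) 1) (φ : C(Ω.bdry, ℂ)) (τ : Ω.bdry) :
    (dilatedTransform hΩ hz₀ r φ : C(Ω.bdry, ℂ)) τ = Ω.doubleLayer φ (z₀ + r * (τ - z₀)) := by
  have := ((ContinuousMap.evalCLM ℂ τ).comp Ω.harmonicSpace.subtypeL).integral_comp_comm
    (integrable_smul_dilatedPotential hΩ hz₀ r φ)
  change _ = (dilatedTransform hΩ hz₀ r φ : C(Ω.bdry, ℂ)) τ at this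
  rw [← this, doubleLayer]
  congr 1
  ext σ
  rw [← dilatedPotential_apply hΩ hz₀]
  simp

/-- The boundary values of the interior double-layer potential. -/
noncomputable def doubleLayerBoundary (hΩ : Convex ℝ Ω.carrier) (φ : C(Ω.bdry, ℂ)) :
    C(Ω.bdry, ℂ) :=
  ⟨fun τ => Ω.doubleLayerExt φ τ, (continuousOn_doubleLayerExt hΩ φ).comp_continuous
    continuous_subtype_val fun τ => frontier_subset_closure τ.2⟩

/-- The dilated transform is the potential evaluated at the dilated points, and the extended
potential is uniformly continuous on the compact `Ω⁻`. Consequently the boundary values lie in the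
closed space `ℋ(Ω⁻)`, and linearity and the bound `2` pass to the limit. -/
theorem tendsto_dilatedTransform (hΩ : Convex ℝ Ω.carrier) (hz₀ : z₀ ∈ Ω.carrier)
    {r : ℕ → Ico (0 : ℝ) 1} (hr : Tendsto (fun n => (r n : ℝ)) atTop (𝓝 1)) (φ : C(Ω.bdry, ℂ)) :
    Tendsto (fun n => (dilatedTransform hΩ hz₀ (r n) φ : C(Ω.bdry, ℂ))) atTop
      (𝓝 (doubleLayerBoundary hΩ φ)) := by
  rw [ContinuousMap.tendsto_iff_tendstoUniformly, Metric.tendstoUniformly_iff]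
  intro ε hε
  have huc := Ω.isBounded.isCompact_closure.uniformContinuousOn_of_continuous
    (continuousOn_doubleLayerExt hΩ φ)
  obtain ⟨δ, hδ, h⟩ := Metric.uniformContinuousOn_iff.1 huc ε hε
  obtain ⟨C, hC⟩ := Ω.isBounded.closure.subset_closedBall z₀
  have h1 : Tendsto (fun n => (1 - (r n : ℝ)) * C) atTop (𝓝 0) := by
    simpa using ((tendsto_const_nhds (x := (1 : ℝ))).sub hr).mul_const C
  filter_upwards [h1.eventually (gt_mem_nhds hδ)] with n hn τ
  have hτ := frontier_subset_closure τ.2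
  have hd := dilate_mem hΩ hz₀ (r n) hτ
  rw [dilatedTransform_apply, ← doubleLayerExt_eq hΩ φ hd]
  refine h _ hτ _ (subset_closure hd) ?_
  have h2 := hC hτ
  rw [mem_closedBall_iff_norm] at h2
  have h3 : (τ - (z₀ + r n * (τ - z₀)) : ℂ) = ((1 - (r n : ℝ) : ℝ) : ℂ) * (τ - z₀) := by
    push_cast; ring
  have h4 : 0 ≤ 1 - (r n : ℝ) := by linarith [(r n).2.2]
  rw [dist_eq_norm, h3, norm_mul, Complex.norm_real, Real.norm_of_nonneg h4]
  calc _ ≤ (1 - (r n : ℝ)) * C := by gcongr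
    _ < δ := hn

/-- Dilation factors converging to `1`. -/
noncomputable def dilationFactor (n : ℕ) : Ico (0 : ℝ) 1 :=
  ⟨n / (n + 1), by positivity, by rw [div_lt_one (by positivity)]; linarith⟩

theorem tendsto_dilationFactor : Tendsto (fun n => (dilationFactor n : ℝ)) atTop (𝓝 1) :=
  tendsto_natCast_div_add_atTop (1 : ℝ)

theorem doubleLayerBoundary_mem (hΩ : Convex ℝ Ω.carrier) (hne : Ω.carrier.Nonempty)
    (φ : C(Ω.bdry, ℂ)) : doubleLayerBoundary hΩ φ ∈ Ω.harmonicSpace := by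
  obtain ⟨z₀, hz₀⟩ := hne
  exact (Submodule.isClosed_topologicalClosure _).mem_of_tendsto
    (tendsto_dilatedTransform hΩ hz₀ tendsto_dilationFactor φ)
    (Eventually.of_forall fun n => (dilatedTransform hΩ hz₀ (dilationFactor n) φ).2)

/-- The interior double-layer transform. -/
noncomputable def doubleLayerTransform (hΩ : Convex ℝ Ω.carrier) (hne : Ω.carrier.Nonempty) :
    C(Ω.bdry, ℂ) →L[ℂ] Ω.harmonicSpace :=
  LinearMap.mkContinuous
    { toFun := fun φ => ⟨doubleLayerBoundary hΩ φ, doubleLayerBoundary_mem hΩ hne φ⟩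
      map_add' := by
        intro φ ψ
        obtain ⟨z₀, hz₀⟩ := hne
        refine Subtype.ext (tendsto_nhds_unique
          (tendsto_dilatedTransform hΩ hz₀ tendsto_dilationFactor (φ + ψ)) ?_)
        have h := (tendsto_dilatedTransform hΩ hz₀ tendsto_dilationFactor φ).add
          (tendsto_dilatedTransform hΩ hz₀ tendsto_dilationFactor ψ)
        refine h.congr fun n => ?_
        rw [← Submodule.coe_add, dilatedTransform, dilatedTransform, ← integral_add
          (integrable_smul_dilatedPotential hΩ hz₀ _ φ)
          (integrable_smul_dilatedPotential hΩ hz₀ _ ψ)]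
        simp only [← add_smul]
        rfl
      map_smul' := by
        intro c φ
        obtain ⟨z₀, hz₀⟩ := hne
        refine Subtype.ext (tendsto_nhds_unique
          (tendsto_dilatedTransform hΩ hz₀ tendsto_dilationFactor (c • φ)) ?_)
        have h := (tendsto_dilatedTransform hΩ hz₀ tendsto_dilationFactor φ).const_smul c
        refine h.congr fun n => ?_
        rw [← Submodule.coe_smul, dilatedTransform, ← integral_smul]
        simp only [smul_smul]
        rfl } 2 <| by
    intro φ
    change ‖doubleLayerBoundary hΩ φ‖ ≤ _
    obtain ⟨z₀, hz₀⟩ := hne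
    refine le_of_tendsto (tendsto_dilatedTransform hΩ hz₀ tendsto_dilationFactor φ).norm
      (Eventually.of_forall fun n => ?_)
    refine (ContinuousMap.norm_le _ (by positivity)).2 fun τ => ?_
    rw [dilatedTransform_apply]
    exact norm_doubleLayer_le hΩ φ (dilate_mem hΩ hz₀ _ (frontier_subset_closure τ.2))

theorem tendsto_dilatedTransform_doubleLayerTransform (hΩ : Convex ℝ Ω.carrier)
    (hz₀ : z₀ ∈ Ω.carrier) (φ : C(Ω.bdry, ℂ)) :
    Tendsto (fun n => dilatedTransform hΩ hz₀ (dilationFactor n) φ) atTop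
      (𝓝 (doubleLayerTransform hΩ ⟨z₀, hz₀⟩ φ)) :=
  tendsto_subtype_rng.2 (tendsto_dilatedTransform hΩ hz₀ tendsto_dilationFactor φ)

theorem isInteriorDoubleLayerTransform_doubleLayerTransform (hΩ : Convex ℝ Ω.carrier)
    (hne : Ω.carrier.Nonempty) :
    Ω.IsInteriorDoubleLayerTransform (doubleLayerTransform hΩ hne) := fun φ _ =>
  ⟨Ω.doubleLayerExt φ, continuousOn_doubleLayerExt hΩ φ, fun _ hz => doubleLayerExt_eq hΩ φ hz,
    fun _ => rfl⟩

end SmoothlyBoundedSet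

/-- Lipschitz functions are dense among the continuous functions on a compact set of complex
numbers. -/
theorem dense_setOf_isHolder {S : Set ℂ} [CompactSpace S] : Dense {φ : C(S, ℂ) | IsHolder φ} := by
  -- Stone–Weierstrass is applied to the star algebra generated by the coordinate function: it
  -- separates points, and all its members are Lipschitz.
  have hmem : ∀ φ ∈ StarAlgebra.adjoin ℂ {(⟨(↑), continuous_subtype_val⟩ : C(S, ℂ))},
      ∃ C, LipschitzWith C φ := by
    intro φ hφ
    induction hφ using StarAlgebra.adjoin_induction with
    | mem φ h =>
      rw [mem_singleton_iff.1 h]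
      exact ⟨1, LipschitzWith.subtype_val _⟩
    | algebraMap c => exact ⟨0, LipschitzWith.const c⟩
    | add φ ψ _ _ h1 h2 =>
      obtain ⟨C, hC⟩ := h1
      obtain ⟨D, hD⟩ := h2
      exact ⟨_, hC.add hD⟩
    | mul φ ψ _ _ h1 h2 =>
      obtain ⟨C, hC⟩ := h1
      obtain ⟨D, hD⟩ := h2
      refine ⟨C * ‖ψ‖₊ + ‖φ‖₊ * D, LipschitzWith.of_dist_le_mul fun x y => ?_⟩
      have e : φ x * ψ x - φ y * ψ y = (φ x - φ y) * ψ x + φ y * (ψ x - ψ y) := by ring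
      have h1 := hC.dist_le_mul x y
      have h2 := hD.dist_le_mul x y
      rw [dist_eq_norm] at h1 h2
      rw [ContinuousMap.mul_apply, ContinuousMap.mul_apply, dist_eq_norm, e]
      calc _ ≤ ‖φ x - φ y‖ * ‖ψ x‖ + ‖φ y‖ * ‖ψ x - ψ y‖ := by
            refine (norm_add_le _ _).trans ?_
            rw [norm_mul, norm_mul]
        _ ≤ (C * dist x y) * ‖ψ‖ + ‖φ‖ * (D * dist x y) := by
            gcongr
            · exact ψ.norm_coe_le_norm x
            · exact φ.norm_coe_le_norm y
        _ = _ := by push_cast; ring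
    | star φ _ h =>
      obtain ⟨C, hC⟩ := h
      refine ⟨C, LipschitzWith.of_dist_le_mul fun x y => ?_⟩
      rw [ContinuousMap.star_apply, ContinuousMap.star_apply, dist_star_star]
      exact hC.dist_le_mul x y
  have hdense := ContinuousMap.starSubalgebra_topologicalClosure_eq_top_of_separatesPoints
    (StarAlgebra.adjoin ℂ {(⟨(↑), continuous_subtype_val⟩ : C(S, ℂ))}) (fun x y hxy =>
      ⟨_, ⟨_, StarAlgebra.self_mem_adjoin_singleton ℂ _, rfl⟩, fun h => hxy (Subtype.ext h)⟩)
  have h2 : Dense ((StarAlgebra.adjoin ℂ {(⟨(↑), continuous_subtype_val⟩ : C(S, ℂ))} :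
      StarSubalgebra ℂ C(S, ℂ)) : Set C(S, ℂ)) := by
    rw [dense_iff_closure_eq, ← StarSubalgebra.topologicalClosure_coe, hdense]
    rfl
  refine h2.mono fun φ hφ => ?_
  obtain ⟨C, hC⟩ := hmem φ hφ
  exact ⟨C, 1, one_pos, hC.holderWith⟩

namespace SmoothlyBoundedSet

variable {Ω : SmoothlyBoundedSet}

theorem IsInteriorDoubleLayerTransform.unique {K L : C(Ω.bdry, ℂ) →L[ℂ] Ω.harmonicSpace}
    (hK : Ω.IsInteriorDoubleLayerTransform K) (hL : Ω.IsInteriorDoubleLayerTransform L) :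
    K = L := by
  refine DFunLike.coe_injective (Continuous.ext_on dense_setOf_isHolder K.continuous L.continuous
    fun φ hφ => ?_)
  obtain ⟨u, hu, hu', huK⟩ := hK φ hφ
  obtain ⟨v, hv, hv', hvL⟩ := hL φ hφ
  have huv : EqOn u v (closure Ω.carrier) :=
    EqOn.of_subset_closure (fun z hz => (hu' z hz).trans (hv' z hz).symm) hu hv
      subset_closure subset_rfl
  refine Subtype.ext (ContinuousMap.ext fun τ => ?_)
  rw [← huK, ← hvL]
  exact huv (frontier_subset_closure τ.2)

end SmoothlyBoundedSet

/-! ### The kernel formula for the composed map. -/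

namespace SmoothlyBoundedSet

variable {Ω : SmoothlyBoundedSet} {z₀ : ℂ}
variable {H : Type*} [NormedAddCommGroup H] [InnerProductSpace ℂ H]
  {A : H →L[ℂ] H}

theorem isUnit_sub_of_mem_bdry (hA : spectrum ℂ A ⊆ Ω.carrier) {σ : ℂ} (hσ : σ ∈ Ω.bdry) :
    IsUnit (algebraMap ℂ (H →L[ℂ] H) σ - A) := by
  rw [← spectrum.notMem_iff]
  intro h
  rw [bdry, Ω.isOpen.frontier_eq] at hσ
  exact hσ.2 (hA h)

theorem analyticCalculus_eq (f : Ω.analyticSpace) :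
    Ω.analyticCalculus A f = (1 / (2 * Real.pi * Complex.I) : ℂ) • ∫ σ : Ω.bdry,
      (Complex.I * Ω.normal σ) • ((f : C(Ω.bdry, ℂ)) σ • resolvent A (σ : ℂ)) ∂μH[1] := by
  rw [analyticCalculus]
  simp only [smul_smul, mul_comm ((f : C(Ω.bdry, ℂ)) _)]

/-- The resolvent `(σ - A_s)⁻¹` of the dilated operator `A_s = z₀ + s (A - z₀)`. -/
noncomputable def dilatedResolvent (z₀ : ℂ) (A : H →L[ℂ] H) (s : ℝ) (σ : ℂ) : H →L[ℂ] H :=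
  Ring.inverse (algebraMap ℂ (H →L[ℂ] H) (σ - z₀) - (s : ℂ) • (A - algebraMap ℂ (H →L[ℂ] H) z₀))

theorem dilatedResolvent_one (z₀ : ℂ) (A : H →L[ℂ] H) (σ : ℂ) :
    dilatedResolvent z₀ A 1 σ = resolvent A σ := by
  simp [dilatedResolvent, resolvent]

variable [CompleteSpace H]

theorem continuous_resolvent_bdry (hA : spectrum ℂ A ⊆ Ω.carrier) :
    Continuous fun σ : Ω.bdry => resolvent A (σ : ℂ) := by
  rw [← continuousOn_univ]
  refine ContinuousOn.ringInverse ?_ fun σ _ => isUnit_sub_of_mem_bdry hA σ.2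
  exact (((continuous_algebraMap ℂ (H →L[ℂ] H)).comp continuous_subtype_val).sub
    continuous_const).continuousOn

theorem integrable_analyticCalculus (hΩ : Convex ℝ Ω.carrier) (hne : Ω.carrier.Nonempty)
    (hA : spectrum ℂ A ⊆ Ω.carrier) (f : C(Ω.bdry, ℂ)) :
    Integrable (fun σ : Ω.bdry => (f σ * (Complex.I * Ω.normal σ)) • resolvent A (σ : ℂ))
      μH[1] :=
  integrable_of_continuous hΩ hne ((f.continuous.mul
    (continuous_const.mul (Ω.continuous_normal hΩ))).smul (continuous_resolvent_bdry hA))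

/-- The analytic functional calculus as a linear map. -/
noncomputable def analyticCalculusₗ (hΩ : Convex ℝ Ω.carrier) (hne : Ω.carrier.Nonempty)
    (hA : spectrum ℂ A ⊆ Ω.carrier) : Ω.analyticSpace →ₗ[ℂ] (H →L[ℂ] H) where
  toFun := Ω.analyticCalculus A
  map_add' f g := by
    rw [analyticCalculus, analyticCalculus, analyticCalculus, ← smul_add, ← integral_add
      (integrable_analyticCalculus hΩ hne hA f) (integrable_analyticCalculus hΩ hne hA g)]
    simp only [← add_smul, ← add_mul]
    rfl
  map_smul' c f := by
    rw [analyticCalculus, analyticCalculus, RingHom.id_apply, smul_comm c, ← integral_smul c]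
    congr 2 with σ : 1
    rw [smul_smul]
    change (c * (f : C(Ω.bdry, ℂ)) σ * (Complex.I * Ω.normal σ)) • _ = _
    rw [mul_assoc]

/-- The constant function `1`. -/
noncomputable def oneAnalytic (Ω : SmoothlyBoundedSet) : Ω.analyticSpace :=
  ⟨1, fun _ => 1, diffContOnCl_const, fun _ => rfl⟩

theorem analyticCalculus_one (hΩ : Convex ℝ Ω.carrier) (hne : Ω.carrier.Nonempty)
    (hA : spectrum ℂ A ⊆ Ω.carrier) : Ω.analyticCalculus A Ω.oneAnalytic = 1 := by
  rw [analyticCalculus_eq]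
  change (1 / (2 * Real.pi * Complex.I) : ℂ) • ∫ σ : Ω.bdry,
      (Complex.I * Ω.normal σ) • ((1 : ℂ) • resolvent A (σ : ℂ)) ∂μH[1] = 1
  simp only [one_smul]
  rw [integral_bdry_resolvent hΩ hne hA, smul_smul, one_div, inv_mul_cancel₀ Complex.two_pi_I_ne_zero,
    one_smul]

theorem notMem_closure_of_inv_dilate (hΩ : Convex ℝ Ω.carrier) (hz₀ : z₀ ∈ Ω.carrier) {r : ℝ}
    (hr : r ∈ Ioo (0 : ℝ) 1) {σ : ℂ} (hσ : σ ∈ Ω.bdry) :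
    z₀ + (r : ℂ)⁻¹ * (σ - z₀) ∉ closure Ω.carrier := by
  intro h
  have h0 : (r : ℂ) ≠ 0 := by exact_mod_cast hr.1.ne'
  have := dilate_mem hΩ hz₀ ⟨r, hr.1.le, hr.2⟩ h
  rw [add_sub_cancel_left, mul_inv_cancel_left₀ h0, add_sub_cancel] at this
  rw [bdry, Ω.isOpen.frontier_eq] at hσ
  exact hσ.2 this

/-- As a function of `τ`, the integrand has its pole at `z₀ + r⁻¹ (σ - z₀)`, outside `Ω⁻`. The
factor `r` makes the case `r = 0` harmless. -/
theorem integral_bdry_inv_sub_dilate (hΩ : Convex ℝ Ω.carrier) (hz₀ : z₀ ∈ Ω.carrier)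
    (r : Ico (0 : ℝ) 1) (σ : Ω.bdry) :
    ∫ τ : Ω.bdry, (Complex.I * Ω.normal τ) • (((r : ℝ) : ℂ) * (σ - (z₀ + r * (τ - z₀)) : ℂ)⁻¹)
      ∂μH[1] = 0 := by
  rcases r.2.1.eq_or_lt with h0 | hpos
  · rw [← h0]; simp
  have hr0 : ((r : ℝ) : ℂ) ≠ 0 := by exact_mod_cast hpos.ne'
  have h1 := integral_bdry_inv_sub_of_notMem hΩ ⟨z₀, hz₀⟩
    (notMem_closure_of_inv_dilate hΩ hz₀ ⟨hpos, r.2.2⟩ σ.2)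
  rw [← neg_eq_zero, ← integral_neg] at h1
  rw [← h1]
  congr 1
  ext τ
  have e : (σ - (z₀ + r * (τ - z₀)) : ℂ) =
      -((r : ℝ) * (τ - (z₀ + ((r : ℝ) : ℂ)⁻¹ * (σ - z₀)))) := by
    field_simp
    ring
  rw [e, inv_neg, mul_inv, mul_neg, mul_inv_cancel_left₀ hr0, smul_neg]

/-- A resolvent identity: with `k = σ - (z₀ + r (τ - z₀))` and `A_r = z₀ + r (A - z₀)`, one has `σ -
A_r = k + r (τ - A)`. Multiplication by `k⁻¹ (τ - A)⁻¹` gives the claim. -/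
theorem inv_smul_resolvent_eq (hΩ : Convex ℝ Ω.carrier) (hz₀ : z₀ ∈ Ω.carrier)
    (hA : spectrum ℂ A ⊆ Ω.carrier) (r : Ico (0 : ℝ) 1) (σ τ : Ω.bdry) :
    (σ - (z₀ + r * (τ - z₀)) : ℂ)⁻¹ • resolvent A (τ : ℂ) = dilatedResolvent z₀ A r σ *
      (resolvent A (τ : ℂ) + (((r : ℝ) : ℂ) * (σ - (z₀ + r * (τ - z₀)) : ℂ)⁻¹) • 1) := by
  have hk := sub_dilate_ne_zero hΩ hz₀ r σ (frontier_subset_closure τ.2)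
  have hu := isUnit_sub_smul_of_spectrum_subset hΩ hz₀ hA ⟨r.2.1, r.2.2.le⟩ σ.2
  symm
  rw [dilatedResolvent, Ring.inverse_mul_eq_iff_eq_mul _ _ _ hu]
  have hres : (algebraMap ℂ (H →L[ℂ] H) τ - A) * resolvent A (τ : ℂ) = 1 :=
    Ring.mul_inverse_cancel _ (isUnit_sub_of_mem_bdry hA τ.2)
  set k : ℂ := σ - (z₀ + r * (τ - z₀)) with hkdef
  have hc : algebraMap ℂ (H →L[ℂ] H) (σ - z₀) - ((r : ℝ) : ℂ) • (A - algebraMap ℂ (H →L[ℂ] H) z₀) =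
      k • 1 + ((r : ℝ) : ℂ) • (algebraMap ℂ (H →L[ℂ] H) τ - A) := by
    simp only [Algebra.algebraMap_eq_smul_one, hkdef, smul_sub, sub_smul, add_smul, smul_smul,
      mul_sub]
    abel
  rw [hc, mul_smul_comm, add_mul, smul_mul_assoc, smul_mul_assoc, hres, one_mul, smul_add, smul_smul,
    smul_smul, inv_mul_cancel₀ hk, one_smul, mul_comm k⁻¹]

/-- Integrating the resolvent identity over `τ` leaves the resolvent of the dilated operator: the
term with `(τ - A)⁻¹` contributes `2πi` and the scalar term nothing. -/
theorem analyticCalculus_cauchyKernel (hΩ : Convex ℝ Ω.carrier) (hz₀ : z₀ ∈ Ω.carrier)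
    (hA : spectrum ℂ A ⊆ Ω.carrier) (r : Ico (0 : ℝ) 1) (σ : Ω.bdry) :
    Ω.analyticCalculus A (cauchyKernel hΩ hz₀ r σ) =
      ((1 / (2 * Real.pi)) * Ω.normal σ : ℂ) • dilatedResolvent z₀ A r σ := by
  have hne : Ω.carrier.Nonempty := ⟨z₀, hz₀⟩
  set R := dilatedResolvent z₀ A r σ
  have hn : Continuous fun τ : Ω.bdry => Complex.I * Ω.normal τ :=
    continuous_const.mul (Ω.continuous_normal hΩ)
  have hkc : Continuous fun τ : Ω.bdry => ((r : ℝ) : ℂ) * (σ - (z₀ + r * (τ - z₀)) : ℂ)⁻¹ :=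
    continuous_const.mul ((by fun_prop : Continuous fun τ : Ω.bdry =>
      (σ - (z₀ + r * (τ - z₀)) : ℂ)).inv₀ fun τ =>
        sub_dilate_ne_zero hΩ hz₀ r σ (frontier_subset_closure τ.2))
  have i1 : Integrable (fun τ : Ω.bdry => (Complex.I * Ω.normal τ) • resolvent A (τ : ℂ)) μH[1] :=
    integrable_of_continuous hΩ hne (hn.smul (continuous_resolvent_bdry hA))
  have i2 : Integrable (fun τ : Ω.bdry => ((Complex.I * Ω.normal τ) •
      (((r : ℝ) : ℂ) * (σ - (z₀ + r * (τ - z₀)) : ℂ)⁻¹)) • (1 : H →L[ℂ] H)) μH[1] :=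
    (integrable_of_continuous hΩ hne (hn.smul hkc)).smul_const 1
  have hint : ∫ τ : Ω.bdry, (Complex.I * Ω.normal τ) •
      ((σ - (z₀ + r * (τ - z₀)) : ℂ)⁻¹ • resolvent A (τ : ℂ)) ∂μH[1] =
      (2 * Real.pi * Complex.I : ℂ) • R := by
    have e : ∀ τ : Ω.bdry, (Complex.I * Ω.normal τ) •
        ((σ - (z₀ + r * (τ - z₀)) : ℂ)⁻¹ • resolvent A (τ : ℂ)) =
        ContinuousLinearMap.mul ℂ (H →L[ℂ] H) R ((Complex.I * Ω.normal τ) • resolvent A (τ : ℂ) +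
          ((Complex.I * Ω.normal τ) • (((r : ℝ) : ℂ) * (σ - (z₀ + r * (τ - z₀)) : ℂ)⁻¹)) • 1) := by
      intro τ
      rw [inv_smul_resolvent_eq hΩ hz₀ hA, ContinuousLinearMap.mul_apply', ← mul_smul_comm, smul_add,
        ← smul_assoc]
    simp only [e]
    have i3 : Integrable (fun τ : Ω.bdry => (Complex.I * Ω.normal τ) • resolvent A (τ : ℂ) +
        ((Complex.I * Ω.normal τ) •
          (((r : ℝ) : ℂ) * (σ - (z₀ + r * (τ - z₀)) : ℂ)⁻¹)) • (1 : H →L[ℂ] H)) μH[1] := i1.add i2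
    rw [ContinuousLinearMap.integral_comp_comm _ i3, integral_add i1 i2,
      integral_bdry_resolvent hΩ hne hA, integral_smul_const, integral_bdry_inv_sub_dilate hΩ hz₀,
      zero_smul, add_zero, ContinuousLinearMap.mul_apply', mul_smul_comm, mul_one]
  have e2 : ∀ τ : Ω.bdry, (Complex.I * Ω.normal τ) • ((cauchyKernel hΩ hz₀ r σ : C(Ω.bdry, ℂ)) τ •
      resolvent A (τ : ℂ)) = ((1 / (2 * Real.pi)) * Ω.normal σ : ℂ) • ((Complex.I * Ω.normal τ) •
      ((σ - (z₀ + r * (τ - z₀)) : ℂ)⁻¹ • resolvent A (τ : ℂ))) := by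
    intro τ
    rw [cauchyKernel_apply]
    simp only [smul_smul]
    congr 1
    ring
  rw [analyticCalculus_eq]
  simp only [e2]
  rw [integral_smul, hint, smul_comm, smul_smul (1 / (2 * Real.pi * Complex.I) : ℂ), one_div (2 * Real.pi * Complex.I : ℂ),
    inv_mul_cancel₀ Complex.two_pi_I_ne_zero, one_smul]

/-- The operator-valued double-layer kernel `(1/π) Re (n(σ) (σ - A_s)⁻¹)` of the dilated operator
`A_s = z₀ + s (A - z₀)`. -/
noncomputable def operatorKernel (Ω : SmoothlyBoundedSet) (z₀ : ℂ) (A : H →L[ℂ] H) (s : ℝ) (σ : ℂ) :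
    H →L[ℂ] H :=
  ((1 / (2 * Real.pi)) * Ω.normal σ : ℂ) • dilatedResolvent z₀ A s σ +
    ContinuousLinearMap.adjoint (((1 / (2 * Real.pi)) * Ω.normal σ : ℂ) • dilatedResolvent z₀ A s σ)

theorem IsHarmonicCalculus.map_dilatedPotential {Γ : Ω.harmonicSpace →L[ℂ] (H →L[ℂ] H)}
    (hΓ : Ω.IsHarmonicCalculus A Γ) (hΩ : Convex ℝ Ω.carrier) (hz₀ : z₀ ∈ Ω.carrier)
    (hA : spectrum ℂ A ⊆ Ω.carrier) (r : Ico (0 : ℝ) 1) (σ : Ω.bdry) :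
    Γ (dilatedPotential hΩ hz₀ r σ) = Ω.operatorKernel z₀ A r σ := by
  rw [dilatedPotential, hΓ, analyticCalculus_cauchyKernel hΩ hz₀ hA, operatorKernel]

theorem continuous_operatorKernel (hΩ : Convex ℝ Ω.carrier) (hz₀ : z₀ ∈ Ω.carrier)
    (hA : spectrum ℂ A ⊆ Ω.carrier) :
    Continuous fun p : Icc (0 : ℝ) 1 × Ω.bdry => Ω.operatorKernel z₀ A p.1 p.2 := by
  have h1 : Continuous fun p : Icc (0 : ℝ) 1 × Ω.bdry => dilatedResolvent z₀ A p.1 p.2 := by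
    rw [← continuousOn_univ]
    refine ContinuousOn.ringInverse ?_ fun p _ =>
      isUnit_sub_smul_of_spectrum_subset hΩ hz₀ hA p.1.2 p.2.2
    refine Continuous.continuousOn ?_
    exact ((continuous_algebraMap ℂ (H →L[ℂ] H)).comp (by fun_prop)).sub
      ((by fun_prop : Continuous fun p : Icc (0 : ℝ) 1 × Ω.bdry => ((p.1 : ℝ) : ℂ)).smul
        continuous_const)
  have h2 : Continuous fun p : Icc (0 : ℝ) 1 × Ω.bdry => Ω.normal p.2 :=
    (Ω.continuous_normal hΩ).comp continuous_snd
  have h3 : Continuous fun p : Icc (0 : ℝ) 1 × Ω.bdry =>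
      ((1 / (2 * Real.pi)) * Ω.normal p.2 : ℂ) • dilatedResolvent z₀ A p.1 p.2 :=
    (continuous_const.mul h2).smul h1
  exact h3.add (ContinuousLinearMap.adjoint.continuous.comp h3)

/-- The operator-valued double-layer kernel `(1/π) Re (n(σ) (σ - A)⁻¹)`. -/
noncomputable def resolventKernel (Ω : SmoothlyBoundedSet) (A : H →L[ℂ] H) (σ : ℂ) : H →L[ℂ] H :=
  ((1 / (2 * Real.pi)) * Ω.normal σ : ℂ) • resolvent A σ +
    ContinuousLinearMap.adjoint (((1 / (2 * Real.pi)) * Ω.normal σ : ℂ) • resolvent A σ)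

theorem continuous_resolventKernel (hΩ : Convex ℝ Ω.carrier) (hA : spectrum ℂ A ⊆ Ω.carrier) :
    Continuous fun σ : Ω.bdry => Ω.resolventKernel A σ := by
  have h3 : Continuous fun σ : Ω.bdry => ((1 / (2 * Real.pi)) * Ω.normal σ : ℂ) • resolvent A (σ : ℂ) :=
    (continuous_const.mul (Ω.continuous_normal hΩ)).smul (continuous_resolvent_bdry hA)
  exact h3.add (ContinuousLinearMap.adjoint.continuous.comp h3)

/-- For `r < 1` the map `Γ` passes under the integral and turns the dilated potentials into operator
kernels. The scalar kernels become singular as `r → 1`, but the operator kernels are jointly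
continuous on `[0, 1] × ∂Ω`, since the spectrum stays off the boundary. So the limit can be taken
inside. -/
theorem IsHarmonicCalculus.map_doubleLayerTransform {Γ : Ω.harmonicSpace →L[ℂ] (H →L[ℂ] H)}
    (hΓ : Ω.IsHarmonicCalculus A Γ) (hΩ : Convex ℝ Ω.carrier) (hne : Ω.carrier.Nonempty)
    (hA : spectrum ℂ A ⊆ Ω.carrier) (φ : C(Ω.bdry, ℂ)) :
    Γ (doubleLayerTransform hΩ hne φ) =
      ∫ σ : Ω.bdry, φ σ • Ω.resolventKernel A σ ∂μH[1] := by
  obtain ⟨z₀, hz₀⟩ := hne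
  have := isFiniteMeasure_hausdorffMeasure hΩ ⟨z₀, hz₀⟩
  have h1 := (Γ.continuous.tendsto _).comp (tendsto_dilatedTransform_doubleLayerTransform hΩ hz₀ φ)
  have hB : ∀ n, (Γ ∘ fun n => dilatedTransform hΩ hz₀ (dilationFactor n) φ) n =
      ∫ σ : Ω.bdry, φ σ • Ω.operatorKernel z₀ A (dilationFactor n) σ ∂μH[1] := by
    intro n
    rw [Function.comp_apply, dilatedTransform, ← Γ.integral_comp_comm
      (integrable_smul_dilatedPotential hΩ hz₀ _ φ)]
    simp only [map_smul, hΓ.map_dilatedPotential hΩ hz₀ hA]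
  have hc : Continuous (Function.uncurry fun (s : Icc (0 : ℝ) 1) (σ : Ω.bdry) =>
      φ σ • Ω.operatorKernel z₀ A s σ) :=
    (φ.continuous.comp continuous_snd).smul (continuous_operatorKernel hΩ hz₀ hA)
  have h2 := continuous_parametric_integral_of_continuous (μ := (μH[1] : Measure Ω.bdry))
    (X := Icc (0 : ℝ) 1) (E := H →L[ℂ] H) hc isCompact_univ
  simp only [Measure.restrict_univ] at h2
  have h3 : Tendsto (fun n => (⟨dilationFactor n, (dilationFactor n).2.1, (dilationFactor n).2.2.le⟩ :
      Icc (0 : ℝ) 1)) atTop (𝓝 ⟨1, zero_le_one, le_rfl⟩) :=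
    tendsto_subtype_rng.2 tendsto_dilationFactor
  have h4 := (h2.tendsto _).comp h3
  have h5 : ∀ σ, Ω.operatorKernel z₀ A 1 σ = Ω.resolventKernel A σ := by
    intro σ
    rw [operatorKernel, resolventKernel, dilatedResolvent_one]
  simp only [h5] at h4
  exact tendsto_nhds_unique (h1.congr hB) h4

end SmoothlyBoundedSet

end

section

open Set Filter Topology MeasureTheory ContinuousLinearMap

/-! ### Positivity of operators and of operator-valued maps. -/

section Operators

variable {H : Type*} [NormedAddCommGroup H] [InnerProductSpace ℂ H]

theorem ContinuousLinearMap.isPositive_of_inner_nonneg {T : H →L[ℂ] H}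
    (h : ∀ x, 0 ≤ inner ℂ x (T x)) : T.IsPositive := by
  rw [ContinuousLinearMap.isPositive_iff_complex]
  intro x
  obtain ⟨h1, h2⟩ := Complex.nonneg_iff.1 (h x)
  rw [← inner_conj_symm (T x) x]
  generalize inner ℂ x (T x) = w at h1 h2
  exact ⟨Complex.ext (by simp) (by simp [← h2]), by simpa using h1⟩

theorem ContinuousLinearMap.IsPositive.inner_nonneg_right' {T : H →L[ℂ] H} (h : T.IsPositive)
    (x : H) : 0 ≤ (inner ℂ x (T x)).re := by
  have h1 := ((ContinuousLinearMap.isPositive_iff_complex T).1 h x).2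
  rw [← inner_conj_symm (T x) x] at h1
  generalize inner ℂ x (T x) = w at h1 ⊢
  simpa using h1

/-- Expand `⟨P (x - c y), x - c y⟩ ≥ 0` with `c` unimodular rotating `⟨P x, y⟩` to its modulus. The
arithmetic mean, unlike the geometric one, can be integrated directly over `σ`. -/
theorem ContinuousLinearMap.norm_inner_le_of_isPositive {P : H →L[ℂ] H} (h : P.IsPositive)
    (x y : H) : ‖inner ℂ y (P x)‖ ≤ ((inner ℂ x (P x)).re + (inner ℂ y (P y)).re) / 2 := by
  set w := inner ℂ y (P x) with hw
  obtain ⟨c, hc1, hc⟩ : ∃ c : ℂ, ‖c‖ = 1 ∧ (starRingEnd ℂ) c * w = ‖w‖ := by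
    rcases eq_or_ne w 0 with h0 | h0
    · exact ⟨1, by simp, by simp [h0]⟩
    · have hn : (‖w‖ : ℂ) ≠ 0 := by exact_mod_cast norm_ne_zero_iff.2 h0
      refine ⟨w / ‖w‖, by simp [h0], ?_⟩
      rw [map_div₀, Complex.conj_ofReal, div_mul_eq_mul_div, mul_comm, Complex.mul_conj,
        Complex.normSq_eq_norm_sq]
      push_cast
      field_simp
  have hsym : inner ℂ x (P y) = (starRingEnd ℂ) w := by
    rw [hw, inner_conj_symm]
    exact (h.isSymmetric x y).symm
  have h1 := h.inner_nonneg_right' (x - c • y)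
  have hcc : (starRingEnd ℂ) c * c = 1 := by
    rw [mul_comm, Complex.mul_conj, Complex.normSq_eq_norm_sq, hc1]; simp
  have h2 : inner ℂ (x - c • y) (P (x - c • y)) =
      inner ℂ x (P x) + inner ℂ y (P y) - ((starRingEnd ℂ) ((starRingEnd ℂ) c * w) +
        (starRingEnd ℂ) c * w) := by
    simp only [map_sub, map_smul, inner_sub_left, inner_sub_right, inner_smul_left, inner_smul_right,
      hsym, ← hw, map_mul, Complex.conj_conj]
    linear_combination (inner ℂ y (P y)) * hcc
  rw [h2, hc] at h1
  simp at h1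
  linarith

theorem ContinuousLinearMap.opNorm_le_of_norm_inner_le {T : H →L[ℂ] H} {C : ℝ} (hC : 0 ≤ C)
    (h : ∀ x y, ‖x‖ = 1 → ‖y‖ = 1 → ‖inner ℂ y (T x)‖ ≤ C) : ‖T‖ ≤ C := by
  refine T.opNorm_le_bound hC fun x => ?_
  rcases eq_or_ne x 0 with rfl | hx
  · simp
  rcases eq_or_ne (T x) 0 with hT | hT
  · rw [hT, norm_zero]; positivity
  have hx' := norm_pos_iff.2 hx
  have hT' := norm_pos_iff.2 hT
  have h1 := h (((‖x‖⁻¹ : ℝ) : ℂ) • x) (((‖T x‖⁻¹ : ℝ) : ℂ) • T x)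
    (by rw [norm_smul, Complex.norm_real, norm_inv, norm_norm, inv_mul_cancel₀ hx'.ne'])
    (by rw [norm_smul, Complex.norm_real, norm_inv, norm_norm, inv_mul_cancel₀ hT'.ne'])
  rw [map_smul, inner_smul_left, inner_smul_right, inner_self_eq_norm_sq_to_K, Complex.conj_ofReal,
    norm_mul, norm_mul, Complex.norm_real, Complex.norm_real, norm_inv, norm_inv, norm_norm,
    norm_norm, norm_pow, RCLike.norm_ofReal, abs_of_pos hT'] at h1
  have h2 : ‖T x‖⁻¹ * (‖x‖⁻¹ * ‖T x‖ ^ 2) = ‖T x‖ / ‖x‖ := by field_simp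
  rw [h2, div_le_iff₀ hx'] at h1
  exact h1

/-- A bounded map `T` from `C(X)` to operators with `‖T‖ ≤ c` and `T 1 = c` is positive. -/
theorem isPositiveMap_of_norm_le {X : Type*} [TopologicalSpace X] [CompactSpace X]
    {T : C(X, ℂ) →L[ℂ] (H →L[ℂ] H)} {c : ℝ} (hT : ‖T‖ ≤ c) (h1 : T 1 = (c : ℂ) • 1) :
    IsPositiveMap T := by
  intro φ hφ
  refine ContinuousLinearMap.isPositive_of_inner_nonneg fun x => ?_
  have hc : 0 ≤ c := (norm_nonneg T).trans hT
  set a := inner ℂ x (T φ x) with ha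
  set N := c * ‖x‖ ^ 2 with hN
  set M := ‖φ‖ with hM
  have hN0 : 0 ≤ N := by positivity
  -- The values of `φ` lie in `[0, M]`, hence in every disc centred at `M/2 + i t` with radius
  -- `√(M²/4 + t²)`. The norm bound and the value at `1` put `a` in the disc scaled by `N`.
  have key : ∀ t : ℝ, (a.re - M / 2 * N) ^ 2 + (a.im - t * N) ^ 2 ≤ N ^ 2 * (M ^ 2 / 4 + t ^ 2) := by
    intro t
    set l : ℂ := ⟨M / 2, t⟩ with hl
    have hφl : ‖φ - l • (1 : C(X, ℂ))‖ ≤ Real.sqrt (M ^ 2 / 4 + t ^ 2) := by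
      refine (ContinuousMap.norm_le _ (Real.sqrt_nonneg _)).2 fun s => Real.le_sqrt_of_sq_le ?_
      have hs := Complex.nonneg_iff.1 (hφ s)
      have hsM : (φ s).re ≤ M := (Complex.re_le_norm _).trans (φ.norm_coe_le_norm s)
      have e : (φ - l • (1 : C(X, ℂ))) s = φ s - l := by simp
      rw [e, ← Complex.normSq_eq_norm_sq, Complex.normSq_apply]
      simp only [Complex.sub_re, Complex.sub_im, hl, ← hs.2]
      nlinarith [hs.1]
    have hin : inner ℂ x (T (φ - l • (1 : C(X, ℂ))) x) = a - l * N := by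
      rw [map_sub, map_smul, h1, sub_apply, inner_sub_right, ← ha, smul_apply, smul_apply, one_apply_eq_self,
        inner_smul_right, inner_smul_right, inner_self_eq_norm_sq_to_K, hN]
      push_cast
      rfl
    have hb : ‖a - l * N‖ ≤ N * Real.sqrt (M ^ 2 / 4 + t ^ 2) := by
      rw [← hin]
      calc _ ≤ ‖x‖ * ‖T (φ - l • (1 : C(X, ℂ))) x‖ := norm_inner_le_norm _ _
        _ ≤ ‖x‖ * (c * Real.sqrt (M ^ 2 / 4 + t ^ 2) * ‖x‖) := by
          gcongr
          refine (le_opNorm _ _).trans ?_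
          gcongr
          exact (le_opNorm _ _).trans (by gcongr)
        _ = _ := by rw [hN]; ring
    have hsq := pow_le_pow_left₀ (norm_nonneg _) hb 2
    rw [mul_pow, Real.sq_sqrt (by positivity), ← Complex.normSq_eq_norm_sq,
      Complex.normSq_apply] at hsq
    simp [hl] at hsq
    linarith
  rw [Complex.nonneg_iff]
  rcases hN0.eq_or_lt with h0 | hpos
  · have := key 0
    rw [← h0] at this
    have h3 : a.re = 0 := by nlinarith [sq_nonneg a.re, sq_nonneg a.im]
    have h4 : a.im = 0 := by nlinarith [sq_nonneg a.re, sq_nonneg a.im]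
    exact ⟨h3.ge, h4.symm⟩
  · have him : a.im = 0 := by
      by_contra hne
      -- The discs intersect in a real segment. This `t` makes the cross term `-2 t N a.im` equal to
      -- `M² N² + 1`, which exceeds the room `M² N² / 4`.
      have := key (-(M ^ 2 * N ^ 2 + 1) / (2 * N * a.im))
      have e : (-(M ^ 2 * N ^ 2 + 1) / (2 * N * a.im)) * N * a.im = -(M ^ 2 * N ^ 2 + 1) / 2 := by
        field_simp
      nlinarith [sq_nonneg (a.re - M / 2 * N), sq_nonneg a.im, sq_nonneg (M * N)]
    have h0 := key 0
    rw [him] at h0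
    have hM0 : 0 ≤ M * N := by positivity
    refine ⟨?_, him.symm⟩
    by_contra! hneg
    nlinarith

end Operators

/-! ### The three equivalent conditions, read off the kernel. -/

namespace SmoothlyBoundedSet

variable {Ω : SmoothlyBoundedSet}
variable {H : Type*} [NormedAddCommGroup H] [InnerProductSpace ℂ H] [CompleteSpace H]
  {A : H →L[ℂ] H}

theorem inner_resolventKernel (σ : ℂ) (x y : H) :
    inner ℂ y (Ω.resolventKernel A σ x) = (1 / (2 * Real.pi)) *
      (Ω.normal σ * inner ℂ y (resolvent A σ x) +
        (starRingEnd ℂ) (Ω.normal σ * inner ℂ x (resolvent A σ y))) := by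
  rw [resolventKernel, add_apply, inner_add_right, adjoint_inner_right, smul_apply, smul_apply,
    inner_smul_right, inner_smul_left, map_mul, map_mul, map_div₀, map_mul, Complex.conj_ofReal, map_one,
    Complex.conj_ofNat, inner_conj_symm]
  ring

theorem inner_resolventKernel_self (σ : ℂ) (x : H) :
    inner ℂ x (Ω.resolventKernel A σ x) =
      (((1 / Real.pi) * (Ω.normal σ * inner ℂ x (resolvent A σ x)).re : ℝ) : ℂ) := by
  rw [inner_resolventKernel, Complex.add_conj]
  push_cast
  field_simp

/-- Substituting `(σ - A) y` cancels the resolvent, so the quadratic form of the kernel measures on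
which side of the supporting line at `σ` the numerical range lies. -/
theorem inner_resolventKernel_sub_apply (hA : spectrum ℂ A ⊆ Ω.carrier) {σ : ℂ} (hσ : σ ∈ Ω.bdry)
    (y : H) : (inner ℂ (σ • y - A y) (Ω.resolventKernel A σ (σ • y - A y))).re =
      (1 / Real.pi) * inner ℝ (σ * ‖y‖ ^ 2 - inner ℂ y (A y)) (Ω.normal σ) := by
  have hR : resolvent A σ (σ • y - A y) = y := by
    have := Ring.inverse_mul_cancel _ (isUnit_sub_of_mem_bdry hA hσ)
    have h2 := congrArg (fun T : H →L[ℂ] H => T y) this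
    simp only [Algebra.algebraMap_eq_smul_one] at h2
    exact h2
  rw [inner_resolventKernel_self, hR, Complex.ofReal_re, Complex.inner, inner_sub_left,
    inner_smul_left, inner_self_eq_norm_sq_to_K, map_sub, inner_conj_symm, map_mul, map_pow]
  have e : (starRingEnd ℂ) (‖y‖ : ℂ) = ‖y‖ := Complex.conj_ofReal _
  rw [e]
  rfl

theorem isPositive_resolventKernel_iff (σ : ℂ) :
    (Ω.resolventKernel A σ).IsPositive ↔ ∀ x, 0 ≤ (inner ℂ x (Ω.resolventKernel A σ x)).re := by
  refine ⟨fun h x => h.inner_nonneg_right' x, fun h => isPositive_of_inner_nonneg fun x => ?_⟩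
  have := h x
  rw [inner_resolventKernel_self] at this ⊢
  exact Complex.zero_le_real.2 this

/-- Every `x` is `(σ - A) y`, so positivity at `σ` says that the numerical range lies in the
supporting half-plane there. A value outside `Ω⁻` would be cut off by some supporting line. -/
theorem numericalRange_subset_iff (hΩ : Convex ℝ Ω.carrier) (hne : Ω.carrier.Nonempty)
    (hA : spectrum ℂ A ⊆ Ω.carrier) :
    numericalRange A ⊆ closure Ω.carrier ↔ ∀ σ : Ω.bdry, (Ω.resolventKernel A σ).IsPositive := by
  constructor
  · intro h σ
    rw [isPositive_resolventKernel_iff]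
    intro x
    obtain ⟨y, rfl⟩ : ∃ y, (σ : ℂ) • y - A y = x := by
      have := Ring.mul_inverse_cancel _ (isUnit_sub_of_mem_bdry hA σ.2)
      have h2 := congrArg (fun T : H →L[ℂ] H => T x) this
      refine ⟨resolvent A (σ : ℂ) x, ?_⟩
      simpa [Algebra.algebraMap_eq_smul_one, resolvent] using h2
    rw [inner_resolventKernel_sub_apply hA σ.2]
    refine mul_nonneg (by positivity) ?_
    rcases eq_or_ne y 0 with rfl | hy
    · simp
    have hy' := norm_pos_iff.2 hy
    have hyc : (‖y‖ : ℂ) ≠ 0 := by exact_mod_cast hy'.ne'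
    set u : H := ((‖y‖⁻¹ : ℝ) : ℂ) • y with hu
    have hun : ‖u‖ = 1 := by
      rw [hu, norm_smul, Complex.norm_real, norm_inv, norm_norm, inv_mul_cancel₀ hy'.ne']
    have hyu : inner ℂ y (A y) = ‖y‖ ^ 2 * inner ℂ u (A u) := by
      rw [hu, map_smul, inner_smul_left, inner_smul_right, Complex.conj_ofReal]
      push_cast
      field_simp
    have h1 := Ω.inner_sub_normal_nonpos hΩ σ.2 (h ⟨u, hun, rfl⟩)
    have h2 : (σ * ‖y‖ ^ 2 - inner ℂ y (A y) : ℂ) = -((‖y‖ ^ 2 : ℝ) • (inner ℂ u (A u) - σ)) := by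
      rw [hyu, Complex.real_smul]
      push_cast
      ring
    rw [h2, inner_neg_left, real_inner_smul_left]
    nlinarith [sq_nonneg ‖y‖]
  · rintro h _ ⟨y, hy, rfl⟩
    by_contra hcl
    obtain ⟨σ, hσ, hpos⟩ := exists_inner_normal_pos hΩ hne hcl
    have h1 := (isPositive_resolventKernel_iff σ).1 (h ⟨σ, hσ⟩) (σ • y - A y)
    rw [inner_resolventKernel_sub_apply hA hσ, hy] at h1
    simp only [Complex.ofReal_one, one_pow, mul_one] at h1
    rw [← neg_sub, inner_neg_left] at h1
    have : 0 < (1 / Real.pi) * inner ℝ (inner ℂ y (A y) - σ) (Ω.normal σ) := by positivity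
    linarith

theorem integral_resolventKernel (hΩ : Convex ℝ Ω.carrier) (hne : Ω.carrier.Nonempty)
    (hA : spectrum ℂ A ⊆ Ω.carrier) :
    ∫ σ : Ω.bdry, Ω.resolventKernel A σ ∂μH[1] = (2 : ℂ) • (1 : H →L[ℂ] H) := by
  set f : Ω.bdry → H →L[ℂ] H := fun σ => ((1 / (2 * Real.pi)) * Ω.normal σ : ℂ) • resolvent A (σ : ℂ)
    with hf
  have hc : Continuous f :=
    (continuous_const.mul (Ω.continuous_normal hΩ)).smul (continuous_resolvent_bdry hA)
  have h1 : ∫ σ, f σ ∂μH[1] = 1 := by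
    have e : ∀ σ, f σ = (1 / (2 * Real.pi * Complex.I) : ℂ) •
        ((Complex.I * Ω.normal σ) • resolvent A (σ : ℂ)) := by
      intro σ
      rw [hf, smul_smul]
      field_simp
    simp only [e]
    rw [integral_smul, integral_bdry_resolvent hΩ hne hA, smul_smul, one_div,
      inv_mul_cancel₀ Complex.two_pi_I_ne_zero, one_smul]
  have hi := integrable_of_continuous hΩ hne hc
  have hia : Integrable (fun σ => adjoint (f σ)) (μH[1] : Measure Ω.bdry) :=
    integrable_of_continuous hΩ hne (adjoint.continuous.comp hc)
  have h2 : ∫ σ, adjoint (f σ) ∂(μH[1] : Measure Ω.bdry) = 1 := by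
    have := integral_comp_commSL (𝕜 := ℂ) (σ := starRingEnd ℂ) (by simp)
      (adjoint (𝕜 := ℂ) (E := H) (F := H)).toContinuousLinearEquiv.toContinuousLinearMap hi
    refine this.trans ?_
    rw [h1]
    exact adjoint_id
  change ∫ σ, (f σ + adjoint (f σ)) ∂μH[1] = _
  rw [integral_add hi hia, h1, h2, two_smul]

/-- The map `φ ↦ ∫ φ(σ) (1/π) Re (n(σ) (σ - A)⁻¹) |dσ|`, paired with vectors. -/
theorem inner_integral_smul_resolventKernel (hΩ : Convex ℝ Ω.carrier) (hne : Ω.carrier.Nonempty)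
    (hA : spectrum ℂ A ⊆ Ω.carrier) (φ : C(Ω.bdry, ℂ)) (x y : H) :
    inner ℂ y ((∫ σ : Ω.bdry, φ σ • Ω.resolventKernel A σ ∂μH[1]) x) =
      ∫ σ : Ω.bdry, φ σ * inner ℂ y (Ω.resolventKernel A σ x) ∂μH[1] := by
  have hi : Integrable (fun σ : Ω.bdry => φ σ • Ω.resolventKernel A σ) μH[1] :=
    integrable_of_continuous hΩ hne (φ.continuous.smul (continuous_resolventKernel hΩ hA))
  have := ((innerSL ℂ y).comp (ContinuousLinearMap.apply ℂ H x)).integral_comp_comm hi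
  simp only [comp_apply, apply_apply, innerSL_apply_apply, smul_apply, inner_smul_right] at this
  exact this.symm

theorem continuous_inner_resolventKernel (hΩ : Convex ℝ Ω.carrier) (hA : spectrum ℂ A ⊆ Ω.carrier)
    (x y : H) : Continuous fun σ : Ω.bdry => inner ℂ y (Ω.resolventKernel A σ x) :=
  continuous_const.inner ((continuous_resolventKernel hΩ hA).clm_apply continuous_const)

variable {T : C(Ω.bdry, ℂ) →L[ℂ] (H →L[ℂ] H)}

theorem isPositiveMap_of_resolventKernel (hΩ : Convex ℝ Ω.carrier) (hne : Ω.carrier.Nonempty)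
    (hA : spectrum ℂ A ⊆ Ω.carrier)
    (hT : ∀ φ, T φ = ∫ σ : Ω.bdry, φ σ • Ω.resolventKernel A σ ∂μH[1])
    (h : ∀ σ : Ω.bdry, (Ω.resolventKernel A σ).IsPositive) : IsPositiveMap T := by
  intro φ hφ
  refine isPositive_of_inner_nonneg fun x => ?_
  rw [hT, inner_integral_smul_resolventKernel hΩ hne hA]
  have e : ∀ σ : Ω.bdry, φ σ * inner ℂ x (Ω.resolventKernel A σ x) =
      (((φ σ).re * (inner ℂ x (Ω.resolventKernel A σ x)).re : ℝ) : ℂ) := by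
    intro σ
    have h1 : φ σ = ((φ σ).re : ℂ) :=
      Complex.ext rfl (by simp [← (Complex.nonneg_iff.1 (hφ σ)).2])
    rw [inner_resolventKernel_self, h1]
    simp
  simp only [e]
  rw [integral_complex_ofReal, Complex.zero_le_real]
  exact integral_nonneg fun σ => mul_nonneg (Complex.nonneg_iff.1 (hφ σ)).1
    ((isPositive_resolventKernel_iff _).1 (h σ) x)

/-- The map is tested on the negative part `m` of the continuous function `q σ = ⟨P(σ) x, x⟩`.
Positivity gives `-∫ m² ≥ 0`, and full support of arc length forces `m = 0`. -/
theorem isPositive_resolventKernel_of_isPositiveMap (hΩ : Convex ℝ Ω.carrier)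
    (hne : Ω.carrier.Nonempty) (hA : spectrum ℂ A ⊆ Ω.carrier)
    (hT : ∀ φ, T φ = ∫ σ : Ω.bdry, φ σ • Ω.resolventKernel A σ ∂μH[1])
    (h : IsPositiveMap T) (σ : Ω.bdry) : (Ω.resolventKernel A σ).IsPositive := by
  rw [isPositive_resolventKernel_iff]
  intro x
  have := isOpenPosMeasure_hausdorffMeasure hΩ hne
  set q : Ω.bdry → ℝ := fun σ => (inner ℂ x (Ω.resolventKernel A σ x)).re with hq
  have hqc : Continuous q :=
    Complex.continuous_re.comp (continuous_inner_resolventKernel hΩ hA x x)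
  set m : Ω.bdry → ℝ := fun σ => max (-q σ) 0 with hm
  have hmc : Continuous m := hqc.neg.max continuous_const
  have h1 := (h ⟨fun σ => (m σ : ℂ), Complex.continuous_ofReal.comp hmc⟩
    fun σ => Complex.zero_le_real.2 (le_max_right _ _)).inner_nonneg_right' x
  rw [hT, inner_integral_smul_resolventKernel hΩ hne hA] at h1
  have e : ∀ σ : Ω.bdry, (m σ : ℂ) * inner ℂ x (Ω.resolventKernel A σ x) =
      ((-(m σ ^ 2) : ℝ) : ℂ) := by
    intro σ
    have e1 : inner ℂ x (Ω.resolventKernel A σ x) = (q σ : ℂ) := by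
      change _ = ((inner ℂ x (Ω.resolventKernel A σ x)).re : ℂ)
      rw [inner_resolventKernel_self, Complex.ofReal_re]
    rw [e1, ← Complex.ofReal_mul]
    congr 1
    rcases le_total 0 (q σ) with h0 | h0
    · have : m σ = 0 := max_eq_right (by linarith)
      rw [this]; ring
    · have : m σ = -q σ := max_eq_left (by linarith)
      rw [this]; ring
  simp only [ContinuousMap.coe_mk, e] at h1
  rw [integral_complex_ofReal, Complex.ofReal_re, integral_neg, Left.nonneg_neg_iff] at h1
  have h2 : ∫ σ, m σ ^ 2 ∂μH[1] = 0 := le_antisymm h1 (integral_nonneg fun σ => sq_nonneg _)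
  rw [integral_eq_zero_iff_of_nonneg (fun σ => sq_nonneg _)
    (integrable_of_continuous hΩ hne (hmc.pow 2))] at h2
  have h3 : m σ = 0 := pow_eq_zero_iff two_ne_zero |>.1
    (congrFun ((Continuous.ae_eq_iff_eq _ (hmc.pow 2) continuous_zero).1 h2) σ)
  have h4 : -q σ ≤ m σ := le_max_left _ _
  linarith

/-- Apply the mean form of Cauchy–Schwarz at each `σ` and integrate. For unit vectors both quadratic
forms integrate to `2`. -/
theorem norm_le_two_of_resolventKernel (hΩ : Convex ℝ Ω.carrier) (hne : Ω.carrier.Nonempty)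
    (hA : spectrum ℂ A ⊆ Ω.carrier)
    (hT : ∀ φ, T φ = ∫ σ : Ω.bdry, φ σ • Ω.resolventKernel A σ ∂μH[1])
    (h : ∀ σ : Ω.bdry, (Ω.resolventKernel A σ).IsPositive) : ‖T‖ ≤ 2 := by
  refine T.opNorm_le_bound zero_le_two fun φ => opNorm_le_of_norm_inner_le (by positivity) ?_
  intro x y hx hy
  have hq : ∀ x : H, ‖x‖ = 1 →
      ∫ σ : Ω.bdry, (inner ℂ x (Ω.resolventKernel A σ x)).re ∂μH[1] = 2 := by
    intro x hx
    have h1 := inner_integral_smul_resolventKernel hΩ hne hA 1 x x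
    simp only [ContinuousMap.one_apply, one_smul, one_mul] at h1
    rw [integral_resolventKernel hΩ hne hA] at h1
    have h2 := Complex.reCLM.integral_comp_comm (integrable_of_continuous hΩ hne
      (continuous_inner_resolventKernel hΩ hA x x))
    rw [← h1] at h2
    refine h2.trans ?_
    rw [smul_apply, one_apply_eq_self, inner_smul_right, inner_self_eq_norm_sq_to_K, hx]
    simp
  have hqi : ∀ x : H, Integrable (fun σ : Ω.bdry => (inner ℂ x (Ω.resolventKernel A σ x)).re) μH[1] :=
    fun x => integrable_of_continuous hΩ hne
      (Complex.continuous_re.comp (continuous_inner_resolventKernel hΩ hA x x))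
  rw [hT, inner_integral_smul_resolventKernel hΩ hne hA]
  have hqq : Integrable (fun σ : Ω.bdry => (inner ℂ x (Ω.resolventKernel A σ x)).re +
      (inner ℂ y (Ω.resolventKernel A σ y)).re) μH[1] := (hqi x).add (hqi y)
  calc _ ≤ ∫ σ : Ω.bdry, (‖φ‖ / 2) * ((inner ℂ x (Ω.resolventKernel A σ x)).re +
        (inner ℂ y (Ω.resolventKernel A σ y)).re) ∂μH[1] := by
        refine norm_integral_le_of_norm_le (hqq.const_mul _) (Eventually.of_forall fun σ => ?_)
        rw [norm_mul]
        calc _ ≤ ‖φ‖ * (((inner ℂ x (Ω.resolventKernel A σ x)).re +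
              (inner ℂ y (Ω.resolventKernel A σ y)).re) / 2) := by
              gcongr
              · exact φ.norm_coe_le_norm σ
              · exact norm_inner_le_of_isPositive (h σ) x y
          _ = _ := by ring
    _ = 2 * ‖φ‖ := by
        rw [integral_const_mul, integral_add (hqi x) (hqi y), hq x hx, hq y hy]
        ring

theorem map_one_of_resolventKernel (hΩ : Convex ℝ Ω.carrier) (hne : Ω.carrier.Nonempty)
    (hA : spectrum ℂ A ⊆ Ω.carrier)
    (hT : ∀ φ, T φ = ∫ σ : Ω.bdry, φ σ • Ω.resolventKernel A σ ∂μH[1]) :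
    T 1 = ((2 : ℝ) : ℂ) • 1 := by
  rw [hT]
  simp only [ContinuousMap.one_apply, one_smul]
  rw [integral_resolventKernel hΩ hne hA, Complex.ofReal_ofNat]

theorem tfae_of_resolventKernel [Nontrivial H] (hΩ : Convex ℝ Ω.carrier) (hne : Ω.carrier.Nonempty)
    (hA : spectrum ℂ A ⊆ Ω.carrier)
    (hT : ∀ φ, T φ = ∫ σ : Ω.bdry, φ σ • Ω.resolventKernel A σ ∂μH[1]) :
    List.TFAE [numericalRange A ⊆ closure Ω.carrier, IsPositiveMap T, ‖T‖ = 2] := by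
  have hT1 := map_one_of_resolventKernel hΩ hne hA hT
  tfae_have 1 → 2 := fun h =>
    isPositiveMap_of_resolventKernel hΩ hne hA hT ((numericalRange_subset_iff hΩ hne hA).1 h)
  tfae_have 2 → 1 := fun h => (numericalRange_subset_iff hΩ hne hA).2
    (isPositive_resolventKernel_of_isPositiveMap hΩ hne hA hT h)
  tfae_have 2 → 3 := by
    intro h
    refine le_antisymm (norm_le_two_of_resolventKernel hΩ hne hA hT
      (isPositive_resolventKernel_of_isPositiveMap hΩ hne hA hT h)) ?_
    have h1 : ‖T 1‖ = 2 := by rw [hT1, norm_smul, norm_one]; simp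
    have h2 : ‖(1 : C(Ω.bdry, ℂ))‖ ≤ 1 := (ContinuousMap.norm_le _ zero_le_one).2 fun σ => by simp
    calc (2 : ℝ) = ‖T 1‖ := h1.symm
      _ ≤ ‖T‖ * ‖(1 : C(Ω.bdry, ℂ))‖ := T.le_opNorm 1
      _ ≤ ‖T‖ * 1 := by gcongr
      _ = ‖T‖ := mul_one _
  tfae_have 3 → 2 := fun h => isPositiveMap_of_norm_le h.le hT1
  tfae_finish

end SmoothlyBoundedSet

/-! ### Boundedness and existence of the harmonic calculus. -/

/-- The maximum principle for the real part of a holomorphic function. -/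
theorem abs_re_le_of_forall_mem_frontier {U : Set ℂ} (hU : Bornology.IsBounded U) {Φ : ℂ → ℂ}
    (hΦ : DiffContOnCl ℂ Φ U) {M : ℝ} (h : ∀ z ∈ frontier U, |(Φ z).re| ≤ M) {z : ℂ}
    (hz : z ∈ closure U) : |(Φ z).re| ≤ M := by
  have key : ∀ Ψ : ℂ → ℂ, DiffContOnCl ℂ Ψ U → (∀ z ∈ frontier U, (Ψ z).re ≤ M) → (Ψ z).re ≤ M := by
    intro Ψ hΨ hM
    -- The modulus of `exp Ψ` is `exp (Re Ψ)`, so the usual maximum modulus principle applies.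
    have h1 : DiffContOnCl ℂ (fun z => Complex.exp (Ψ z)) U :=
      ⟨hΨ.differentiableOn.cexp, hΨ.continuousOn.cexp⟩
    have h2 := Complex.norm_le_of_forall_mem_frontier_norm_le hU h1 (C := Real.exp M)
      (fun w hw => by rw [Complex.norm_exp]; exact Real.exp_le_exp.2 (hM w hw)) hz
    rwa [Complex.norm_exp, Real.exp_le_exp] at h2
  rw [abs_le]
  constructor
  · have := key (-Φ) hΦ.neg fun w hw => by
      have := (abs_le.1 (h w hw)).1
      simp only [Pi.neg_apply, Complex.neg_re]; linarith
    simp only [Pi.neg_apply, Complex.neg_re] at this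
    linarith
  · exact key Φ hΦ fun w hw => (abs_le.1 (h w hw)).2

/-- A gradient estimate for holomorphic functions with bounded real part. -/
theorem norm_deriv_le_of_abs_re_le {Φ : ℂ → ℂ} {z : ℂ} {d M : ℝ} (hd : 0 < d) (hM : 0 < M)
    (hΦ : DiffContOnCl ℂ Φ (Metric.ball z d)) (h : ∀ w ∈ Metric.closedBall z d, |(Φ w).re| ≤ M) :
    ‖deriv Φ z‖ ≤ Real.exp 1 ^ 2 / d * M := by
  have hMc : (M : ℂ) ≠ 0 := by exact_mod_cast hM.ne'
  have hre : ∀ w, (Φ w / M).re = (Φ w).re / M := fun w => Complex.div_ofReal_re _ _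
  -- The Cauchy estimate is applied to `exp (Φ / M)`, whose modulus lies between `e⁻¹` and `e`.
  -- Undoing the exponential costs the second factor `e`.
  have h1 : DiffContOnCl ℂ (fun w => Complex.exp (Φ w / M)) (Metric.ball z d) :=
    ⟨(hΦ.differentiableOn.div_const _).cexp, (hΦ.continuousOn.div_const _).cexp⟩
  have h2 := Complex.norm_deriv_le_of_forall_mem_sphere_norm_le hd h1 (C := Real.exp 1) fun w hw => by
    rw [Complex.norm_exp, hre, Real.exp_le_exp, div_le_one hM]
    exact (abs_le.1 (h w (Metric.sphere_subset_closedBall hw))).2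
  have hdiff : DifferentiableAt ℂ Φ z :=
    hΦ.differentiableOn.differentiableAt (Metric.ball_mem_nhds z hd)
  have h3 : deriv (fun w => Complex.exp (Φ w / M)) z = Complex.exp (Φ z / M) * (deriv Φ z / M) :=
    ((hdiff.hasDerivAt.div_const (M : ℂ)).cexp).deriv
  rw [h3, norm_mul, norm_div, Complex.norm_real, Real.norm_of_nonneg hM.le, Complex.norm_exp, hre] at h2
  have h4 : Real.exp (-1) ≤ Real.exp ((Φ z).re / M) := by
    rw [Real.exp_le_exp, le_div_iff₀ hM]
    linarith [(abs_le.1 (h z (Metric.mem_closedBall_self hd.le))).1]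
  have h5 : Real.exp (-1) * (‖deriv Φ z‖ / M) ≤ Real.exp 1 / d := le_trans (by gcongr) h2
  rw [Real.exp_neg, inv_mul_le_iff₀ (Real.exp_pos 1), div_le_iff₀ hM] at h5
  calc _ ≤ _ := h5
    _ = _ := by ring

namespace SmoothlyBoundedSet

variable {Ω : SmoothlyBoundedSet} {z₀ : ℂ}

open scoped Pointwise in
-- The dilate of `Ω⁻` is compact, convex and at positive distance `d` from the complement of `Ω`.
-- The gradient estimate on it and the mean value inequality give a constant depending only on the
-- geometry.
theorem exists_norm_dilate_sub_le (hΩ : Convex ℝ Ω.carrier) (hz₀ : z₀ ∈ Ω.carrier)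
    (r : Ico (0 : ℝ) 1) : ∃ C : ℝ, 0 ≤ C ∧ ∀ (Φ : ℂ → ℂ) (M : ℝ), DiffContOnCl ℂ Φ Ω.carrier → 0 < M →
      (∀ σ ∈ Ω.bdry, |(Φ σ).re| ≤ M) → ∀ σ : Ω.bdry,
        ‖Φ (z₀ + r * (σ - z₀)) - Φ z₀‖ ≤ C * M := by
  set S : Set ℂ := (fun z => z₀ + (r : ℝ) * (z - z₀)) '' closure Ω.carrier with hS
  have hScomp : IsCompact S := Ω.isBounded.isCompact_closure.image (by fun_prop)
  have hSsub : S ⊆ Ω.carrier := by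
    rintro _ ⟨z, hz, rfl⟩
    exact dilate_mem hΩ hz₀ r hz
  have hSconv : Convex ℝ S := by
    have h1 := (hΩ.closure.translate (-z₀)).smul (r : ℝ)
    have h2 := h1.translate z₀
    have hSe : S = (fun x => z₀ + x) '' ((r : ℝ) • (fun x => -z₀ + x) '' closure Ω.carrier) := by
      rw [hS, ← image_smul, image_image, image_image]
      refine image_congr fun z _ => ?_
      simp only [Complex.real_smul]
      ring
    rw [hSe]
    exact h2
  have hz₀S : z₀ ∈ S := ⟨z₀, subset_closure hz₀, by simp⟩
  obtain ⟨d, hd, hdS⟩ := hScomp.exists_cthickening_subset_open Ω.isOpen hSsub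
  obtain ⟨D, hD⟩ := hScomp.isBounded.subset_closedBall z₀
  have hD0 : 0 ≤ D := by
    have := hD hz₀S
    simpa using this
  refine ⟨Real.exp 1 ^ 2 / d * D, by positivity, fun Φ M hΦ hM h σ => ?_⟩
  have hball : ∀ z ∈ S, Metric.closedBall z d ⊆ Ω.carrier := fun z hz =>
    (Metric.closedBall_subset_cthickening hz d).trans hdS
  have hder : ∀ z ∈ S, ‖deriv Φ z‖ ≤ Real.exp 1 ^ 2 / d * M := fun z hz =>
    norm_deriv_le_of_abs_re_le hd hM
      (hΦ.mono (Metric.ball_subset_closedBall.trans (hball z hz)))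
      fun w hw => abs_re_le_of_forall_mem_frontier Ω.isBounded hΦ h (subset_closure (hball z hz hw))
  have hσS : z₀ + (r : ℝ) * (σ - z₀) ∈ S := ⟨σ, frontier_subset_closure σ.2, rfl⟩
  have h1 := hSconv.norm_image_sub_le_of_norm_deriv_le
    (fun z hz => hΦ.differentiableOn.differentiableAt (Ω.isOpen.mem_nhds (hSsub hz))) hder hz₀S hσS
  have h2 := hD hσS
  rw [mem_closedBall_iff_norm] at h2
  calc _ ≤ _ := h1
    _ ≤ Real.exp 1 ^ 2 / d * M * D := by gcongr
    _ = _ := by ring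

variable {H : Type*} [NormedAddCommGroup H] [InnerProductSpace ℂ H] [CompleteSpace H]
  {A : H →L[ℂ] H}

theorem exists_gaugeAt_lt_of_mem_spectrum (hΩ : Convex ℝ Ω.carrier) (hz₀ : z₀ ∈ Ω.carrier)
    (hA : spectrum ℂ A ⊆ Ω.carrier) :
    ∃ r : Ico (0 : ℝ) 1, ∀ z ∈ spectrum ℂ A, Ω.gaugeAt z₀ (z - z₀) < r := by
  have hg : Continuous fun z => Ω.gaugeAt z₀ (z - z₀) :=
    (continuous_gaugeAt hΩ hz₀).comp (continuous_id.sub continuous_const)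
  rcases (spectrum ℂ A).eq_empty_or_nonempty with h | h
  · exact ⟨⟨0, le_rfl, one_pos⟩, by simp [h]⟩
  obtain ⟨w, hw, hmax⟩ := (spectrum.isCompact (𝕜 := ℂ) A).exists_isMaxOn h hg.continuousOn
  have h1 := (gaugeAt_lt_one_iff hΩ hz₀).2 (hA hw)
  have h0 : 0 ≤ Ω.gaugeAt z₀ (w - z₀) := gauge_nonneg _
  refine ⟨⟨(Ω.gaugeAt z₀ (w - z₀) + 1) / 2, by positivity, by linarith⟩, fun z hz => ?_⟩
  have h2 : Ω.gaugeAt z₀ (z - z₀) ≤ Ω.gaugeAt z₀ (w - z₀) := hmax hz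
  change Ω.gaugeAt z₀ (z - z₀) < (Ω.gaugeAt z₀ (w - z₀) + 1) / 2
  linarith

/-- The contour is moved to the `r`-dilate of `∂Ω`, which still encloses the spectrum and on which
the resolvent is bounded. Only values of `F` in the interior then matter. -/
theorem exists_norm_analyticCalculus_le (hΩ : Convex ℝ Ω.carrier) (hz₀ : z₀ ∈ Ω.carrier)
    {r : Ico (0 : ℝ) 1} (hr : ∀ z ∈ spectrum ℂ A, Ω.gaugeAt z₀ (z - z₀) < r) :
    ∃ C : ℝ, 0 ≤ C ∧ ∀ (f : Ω.analyticSpace) (F : ℂ → ℂ) (m : ℝ), DiffContOnCl ℂ F Ω.carrier →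
      (∀ σ : Ω.bdry, F σ = (f : C(Ω.bdry, ℂ)) σ) →
      (∀ σ : Ω.bdry, ‖F (z₀ + r * (σ - z₀))‖ ≤ m) → ‖Ω.analyticCalculus A f‖ ≤ C * m := by
  have hne : Ω.carrier.Nonempty := ⟨z₀, hz₀⟩
  have := isFiniteMeasure_hausdorffMeasure hΩ hne
  have hunit : ∀ z, (r : ℝ) ≤ Ω.gaugeAt z₀ (z - z₀) → IsUnit (algebraMap ℂ (H →L[ℂ] H) z - A) := by
    intro z hz
    rw [← spectrum.notMem_iff]
    exact fun h => absurd (hr z h) (not_lt.2 hz)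
  have hg : ∀ σ : Ω.bdry, Ω.gaugeAt z₀ (z₀ + (r : ℝ) * (σ - z₀) - z₀) = r := by
    intro σ
    rw [add_sub_cancel_left, ← Complex.real_smul, gaugeAt_smul r.2.1,
      (gaugeAt_eq_one_iff hΩ hz₀).2 σ.2, mul_one]
  have hres : ContinuousOn (fun z => resolvent A z) {z | (r : ℝ) ≤ Ω.gaugeAt z₀ (z - z₀)} :=
    ContinuousOn.ringInverse (((continuous_algebraMap ℂ (H →L[ℂ] H)).sub
      continuous_const).continuousOn) hunit
  have hresc : Continuous fun σ : Ω.bdry => resolvent A (z₀ + (r : ℝ) * (σ - z₀) : ℂ) :=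
    hres.comp_continuous (by fun_prop) fun σ => (hg σ).ge
  obtain ⟨R, hR⟩ := (isCompact_univ (X := Ω.bdry)).exists_bound_of_continuousOn hresc.continuousOn
  set μ1 := (μH[1] : Measure Ω.bdry).real univ
  have hR0 : 0 ≤ |R| := abs_nonneg R
  refine ⟨‖(1 / (2 * Real.pi * Complex.I) : ℂ)‖ * (|R| * μ1), by positivity,
    fun f F m hF hFf hm => ?_⟩
  have hdil := integral_bdry_eq_integral_dilate hΩ hz₀ r.2.1 r.2.2.le
    (G := fun z => F z • resolvent A z) ((hF.continuousOn.mono fun z hz => hz.1).smul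
      (hres.mono fun z hz => hz.2)) ?_
  · rw [analyticCalculus_eq]
    simp only [← hFf]
    rw [hdil, norm_smul, mul_assoc ‖_‖]
    gcongr
    rw [mul_right_comm]
    refine norm_integral_le_of_norm_le_const (Eventually.of_forall fun σ => ?_)
    rw [norm_smul, norm_smul, norm_smul, norm_mul, Complex.norm_I, Ω.norm_normal hΩ σ.2,
      Complex.norm_real, Real.norm_of_nonneg r.2.1, one_mul, one_mul, mul_comm |R|]
    calc _ ≤ 1 * (‖F (z₀ + (r : ℝ) * (σ - z₀))‖ * ‖resolvent A (z₀ + (r : ℝ) * (σ - z₀) : ℂ)‖) := by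
          gcongr
          exact r.2.2.le
      _ ≤ 1 * (m * |R|) := by
          have h1 := hm σ
          have h0 : 0 ≤ m := (norm_nonneg _).trans h1
          gcongr
          exact (hR σ (mem_univ _)).trans (le_abs_self R)
      _ = _ := one_mul _
  · intro z hz
    refine DifferentiableAt.differentiableWithinAt ?_
    refine (hF.differentiableOn.differentiableAt (Ω.isOpen.mem_nhds hz.1)).smul ?_
    have h1 : HasDerivAt (fun z => algebraMap ℂ (H →L[ℂ] H) z - A) (1 : H →L[ℂ] H) z := by
      have := ((hasDerivAt_id z).smul_const (1 : H →L[ℂ] H)).sub_const A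
      simpa [Algebra.algebraMap_eq_smul_one] using this
    exact (h1.ringInverse (hunit z hz.2.le)).differentiableAt

/-- A bound on `F + conj G` bounds `Re (F + G)` and `Re (-i (F - G))`, hence the oscillation of `F +
G` and of `F - G` on the dilated contour, and so that of `F` and `G`. The constants `F z₀` and `G
z₀` are not bounded separately, but they enter only through `F z₀ + conj (G z₀)`. -/
theorem exists_norm_calculus_add_adjoint_le (hΩ : Convex ℝ Ω.carrier) (hne : Ω.carrier.Nonempty)
    (hA : spectrum ℂ A ⊆ Ω.carrier) : ∃ C : ℝ, ∀ f g : Ω.analyticSpace,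
      ‖Ω.analyticCalculus A f + adjoint (Ω.analyticCalculus A g)‖ ≤
        C * ‖(f : C(Ω.bdry, ℂ)) + star (g : C(Ω.bdry, ℂ))‖ := by
  obtain ⟨z₀, hz₀⟩ := hne
  have hne : Ω.carrier.Nonempty := ⟨z₀, hz₀⟩
  obtain ⟨r, hr⟩ := exists_gaugeAt_lt_of_mem_spectrum hΩ hz₀ hA
  obtain ⟨C₁, hC₁, h₁⟩ := exists_norm_dilate_sub_le hΩ hz₀ r
  obtain ⟨C₂, hC₂, h₂⟩ := exists_norm_analyticCalculus_le hΩ hz₀ hr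
  refine ⟨2 * (C₂ * C₁) + 2, fun f g => ?_⟩
  set h := (f : C(Ω.bdry, ℂ)) + star (g : C(Ω.bdry, ℂ)) with hh
  -- A strict bound keeps `M` positive even when `h = 0`, as the gradient estimate requires. At the
  -- end `M` decreases to `‖h‖`.
  have key : ∀ M, ‖h‖ < M → ‖Ω.analyticCalculus A f + adjoint (Ω.analyticCalculus A g)‖ ≤
      (2 * (C₂ * C₁) + 2) * M := by
    intro M hM
    have hM0 : 0 < M := (norm_nonneg h).trans_lt hM
    obtain ⟨F, hF, hFf⟩ := f.2
    obtain ⟨G, hG, hGg⟩ := g.2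
    have hbd : ∀ σ ∈ Ω.bdry, ‖F σ + (starRingEnd ℂ) (G σ)‖ ≤ M := by
      intro σ hσ
      have := (h.norm_coe_le_norm ⟨σ, hσ⟩).trans hM.le
      rw [hFf ⟨σ, hσ⟩, hGg ⟨σ, hσ⟩]
      exact this
    have hre : ∀ σ ∈ Ω.bdry, |((F + G) σ).re| ≤ M := by
      intro σ hσ
      refine le_trans (le_of_eq ?_) ((Complex.abs_re_le_norm _).trans (hbd σ hσ))
      simp
    have him : ∀ σ ∈ Ω.bdry, |(((-Complex.I) • (F - G)) σ).re| ≤ M := by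
      intro σ hσ
      refine le_trans (le_of_eq ?_) ((Complex.abs_im_le_norm _).trans (hbd σ hσ))
      simp [sub_eq_add_neg]
    have hd1 : DiffContOnCl ℂ (F + G) Ω.carrier := hF.add hG
    have hd2 : DiffContOnCl ℂ ((-Complex.I) • (F - G)) Ω.carrier := (hF.sub hG).const_smul _
    have e1 := h₁ _ M hd1 hM0 hre
    have e2 := h₁ _ M hd2 hM0 him
    have e3 := abs_re_le_of_forall_mem_frontier Ω.isBounded hd1 hre (subset_closure hz₀)
    have e4 := abs_re_le_of_forall_mem_frontier Ω.isBounded hd2 him (subset_closure hz₀)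
    have hsum : ∀ σ : Ω.bdry, ‖(F (z₀ + (r : ℝ) * (σ - z₀)) - F z₀) +
        (G (z₀ + (r : ℝ) * (σ - z₀)) - G z₀)‖ ≤ C₁ * M := by
      intro σ
      convert e1 σ using 2
      simp only [Pi.add_apply]; ring
    have hdif : ∀ σ : Ω.bdry, ‖(F (z₀ + (r : ℝ) * (σ - z₀)) - F z₀) -
        (G (z₀ + (r : ℝ) * (σ - z₀)) - G z₀)‖ ≤ C₁ * M := by
      intro σ
      refine le_trans (le_of_eq ?_) (e2 σ)
      simp only [Pi.smul_apply, Pi.sub_apply, ← smul_sub]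
      rw [norm_smul, norm_neg, Complex.norm_I, one_mul]
      congr 1; ring
    set f₀ : Ω.analyticSpace := f - F z₀ • Ω.oneAnalytic with hf₀
    set g₀ : Ω.analyticSpace := g - G z₀ • Ω.oneAnalytic with hg₀
    have hn1 : ‖Ω.analyticCalculus A f₀‖ ≤ C₂ * (C₁ * M) := by
      refine h₂ f₀ (fun z => F z - F z₀) _ (hF.sub diffContOnCl_const) (fun σ => ?_) fun σ => ?_
      · rw [hFf]
        change _ = (f : C(Ω.bdry, ℂ)) σ - F z₀ * 1
        rw [mul_one]
      · have e : F (z₀ + (r : ℝ) * (σ - z₀)) - F z₀ = (1 / 2 : ℂ) *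
          (((F (z₀ + (r : ℝ) * (σ - z₀)) - F z₀) + (G (z₀ + (r : ℝ) * (σ - z₀)) - G z₀)) +
          ((F (z₀ + (r : ℝ) * (σ - z₀)) - F z₀) - (G (z₀ + (r : ℝ) * (σ - z₀)) - G z₀))) := by ring
        rw [e, norm_mul]
        have := norm_add_le_of_le (hsum σ) (hdif σ)
        rw [show ‖(1 / 2 : ℂ)‖ = 1 / 2 by simp]
        linarith
    have hn2 : ‖Ω.analyticCalculus A g₀‖ ≤ C₂ * (C₁ * M) := by
      refine h₂ g₀ (fun z => G z - G z₀) _ (hG.sub diffContOnCl_const) (fun σ => ?_) fun σ => ?_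
      · rw [hGg]
        change _ = (g : C(Ω.bdry, ℂ)) σ - G z₀ * 1
        rw [mul_one]
      · have e : G (z₀ + (r : ℝ) * (σ - z₀)) - G z₀ = (1 / 2 : ℂ) *
          (((F (z₀ + (r : ℝ) * (σ - z₀)) - F z₀) + (G (z₀ + (r : ℝ) * (σ - z₀)) - G z₀)) -
          ((F (z₀ + (r : ℝ) * (σ - z₀)) - F z₀) - (G (z₀ + (r : ℝ) * (σ - z₀)) - G z₀))) := by ring
        rw [e, norm_mul]
        have := norm_sub_le_of_le (hsum σ) (hdif σ)
        rw [show ‖(1 / 2 : ℂ)‖ = 1 / 2 by simp]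
        linarith
    have hn3 : ‖F z₀ + (starRingEnd ℂ) (G z₀)‖ ≤ 2 * M := by
      refine (Complex.norm_le_abs_re_add_abs_im _).trans ?_
      have a1 : |(F z₀ + (starRingEnd ℂ) (G z₀)).re| ≤ M := by simpa using e3
      have a2 : |(F z₀ + (starRingEnd ℂ) (G z₀)).im| ≤ M := by simpa [sub_eq_add_neg] using e4
      linarith
    have hone := analyticCalculus_one hΩ hne hA
    have hγ : ∀ (k : Ω.analyticSpace) (c : ℂ), Ω.analyticCalculus A k =
        Ω.analyticCalculus A (k - c • Ω.oneAnalytic) + c • 1 := by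
      intro k c
      have := (analyticCalculusₗ hΩ hne hA).map_sub k (c • Ω.oneAnalytic)
      rw [map_smul] at this
      change Ω.analyticCalculus A (k - c • Ω.oneAnalytic) = Ω.analyticCalculus A k -
        c • Ω.analyticCalculus A Ω.oneAnalytic at this
      rw [this, hone, sub_add_cancel]
    have hsplit : Ω.analyticCalculus A f + adjoint (Ω.analyticCalculus A g) =
        Ω.analyticCalculus A f₀ + adjoint (Ω.analyticCalculus A g₀) +
          (F z₀ + (starRingEnd ℂ) (G z₀)) • (1 : H →L[ℂ] H) := by
      have hadj1 : adjoint (1 : H →L[ℂ] H) = 1 := adjoint_id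
      rw [hγ f (F z₀), hγ g (G z₀), map_add, map_smulₛₗ, hadj1, add_smul]
      abel
    rw [hsplit]
    calc _ ≤ ‖Ω.analyticCalculus A f₀‖ + ‖adjoint (Ω.analyticCalculus A g₀)‖ +
          ‖(F z₀ + (starRingEnd ℂ) (G z₀)) • (1 : H →L[ℂ] H)‖ := norm_add₃_le
      _ ≤ C₂ * (C₁ * M) + C₂ * (C₁ * M) + 2 * M * 1 := by
          rw [LinearIsometryEquiv.norm_map, norm_smul]
          gcongr
          exact norm_id_le
      _ = _ := by ring
  have hc : Continuous fun M : ℝ => (2 * (C₂ * C₁) + 2) * M := by fun_prop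
  refine ge_of_tendsto ((hc.tendsto ‖h‖).mono_left nhdsWithin_le_nhds : Tendsto _ (𝓝[>] ‖h‖) _) ?_
  filter_upwards [self_mem_nhdsWithin] with M hM using key M hM

/-- The conjugates of the functions in `𝒜(Ω⁻)`. -/
noncomputable def conjAnalyticSpace (Ω : SmoothlyBoundedSet) : Submodule ℂ C(Ω.bdry, ℂ) :=
  Ω.analyticSpace.map (starLinearEquiv ℂ (A := C(Ω.bdry, ℂ))).toLinearMap

theorem star_mem_analyticSpace {k : C(Ω.bdry, ℂ)} (hk : k ∈ Ω.conjAnalyticSpace) :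
    star k ∈ Ω.analyticSpace := by
  obtain ⟨g, hg, rfl⟩ := hk
  change star (star g) ∈ _
  rwa [star_star]

/-- The sum map `𝒜(Ω⁻) × 𝒜(Ω⁻)* → ℋ(Ω⁻)`. -/
noncomputable def harmonicSum (Ω : SmoothlyBoundedSet) :
    (Ω.analyticSpace × Ω.conjAnalyticSpace) →ₗ[ℂ] Ω.harmonicSpace :=
  LinearMap.codRestrict Ω.harmonicSpace (Ω.analyticSpace.subtype.coprod Ω.conjAnalyticSpace.subtype)
    fun p => Submodule.le_topologicalClosure _ (Submodule.add_mem_sup p.1.2 p.2.2)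

theorem harmonicSum_eq_addStar (f : Ω.analyticSpace) (k : Ω.conjAnalyticSpace) :
    harmonicSum Ω (f, k) = Ω.addStar f ⟨star (k : C(Ω.bdry, ℂ)), star_mem_analyticSpace k.2⟩ := by
  refine Subtype.ext ?_
  change (f : C(Ω.bdry, ℂ)) + k = f + star (star (k : C(Ω.bdry, ℂ)))
  rw [star_star]

theorem denseRange_harmonicSum : DenseRange (harmonicSum Ω) := by
  intro x
  rw [Topology.IsInducing.subtypeVal.closure_eq_preimage_closure_image, mem_preimage]
  have hx : (x : C(Ω.bdry, ℂ)) ∈ closure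
      ((Ω.analyticSpace ⊔ Ω.conjAnalyticSpace : Submodule ℂ C(Ω.bdry, ℂ)) : Set C(Ω.bdry, ℂ)) := x.2
  refine closure_mono ?_ hx
  intro y hy
  obtain ⟨f, hf, k, hk, rfl⟩ := Submodule.mem_sup.1 hy
  exact ⟨harmonicSum Ω (⟨f, hf⟩, ⟨k, hk⟩), ⟨_, rfl⟩, rfl⟩

/-- The map `(f, g*) ↦ γ(f) + γ(g)*`. -/
noncomputable def harmonicCalculusSum (hΩ : Convex ℝ Ω.carrier) (hne : Ω.carrier.Nonempty)
    (hA : spectrum ℂ A ⊆ Ω.carrier) :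
    (Ω.analyticSpace × Ω.conjAnalyticSpace) →ₗ[ℂ] (H →L[ℂ] H) :=
  (analyticCalculusₗ hΩ hne hA).coprod
    -- Star and adjoint are both conjugate-linear, so their composite is linear in `k`.
    { toFun := fun k => adjoint (analyticCalculusₗ hΩ hne hA
        ⟨star (k : C(Ω.bdry, ℂ)), star_mem_analyticSpace k.2⟩)
      map_add' := by
        intro k l
        rw [← map_add, ← map_add]
        congr 2
        exact Subtype.ext (star_add (k : C(Ω.bdry, ℂ)) l)
      map_smul' := by
        intro c k
        rw [RingHom.id_apply, ← Complex.conj_conj c, ← map_smulₛₗ, ← map_smul]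
        congr 2
        refine Subtype.ext ?_
        change star ((starRingEnd ℂ) ((starRingEnd ℂ) c) • (k : C(Ω.bdry, ℂ))) = _
        rw [star_smul, Complex.conj_conj]
        rfl }

/-- The norm bound yields both well-definedness, as `f + g*` does not determine `f` and `g`, and the
extension from the dense range of `harmonicSum` to its closure. -/
theorem exists_isHarmonicCalculus (hΩ : Convex ℝ Ω.carrier) (hne : Ω.carrier.Nonempty)
    (hA : spectrum ℂ A ⊆ Ω.carrier) :
    ∃ Γ : Ω.harmonicSpace →L[ℂ] (H →L[ℂ] H), Ω.IsHarmonicCalculus A Γ := by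
  obtain ⟨C, hC⟩ := exists_norm_calculus_add_adjoint_le hΩ hne hA
  refine ⟨(harmonicCalculusSum hΩ hne hA).extendOfNorm (harmonicSum Ω), fun f g => ?_⟩
  have hbd : ∃ C, ∀ x, ‖harmonicCalculusSum hΩ hne hA x‖ ≤ C * ‖harmonicSum Ω x‖ := by
    refine ⟨C, fun x => ?_⟩
    obtain ⟨f, k⟩ := x
    rw [harmonicSum_eq_addStar]
    exact hC f ⟨star (k : C(Ω.bdry, ℂ)), star_mem_analyticSpace k.2⟩
  have hk : star (g : C(Ω.bdry, ℂ)) ∈ Ω.conjAnalyticSpace := ⟨g, g.2, rfl⟩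
  have hg : (⟨star (star (g : C(Ω.bdry, ℂ))), star_mem_analyticSpace hk⟩ : Ω.analyticSpace) = g :=
    Subtype.ext (star_star _)
  have h1 : Ω.addStar f g = harmonicSum Ω (f, ⟨_, hk⟩) := rfl
  rw [h1, LinearMap.extendOfNorm_eq denseRange_harmonicSum hbd]
  change Ω.analyticCalculus A f + adjoint (Ω.analyticCalculus A
    ⟨star (star (g : C(Ω.bdry, ℂ))), star_mem_analyticSpace hk⟩) = _
  rw [hg]

theorem IsHarmonicCalculus.unique {Γ Γ' : Ω.harmonicSpace →L[ℂ] (H →L[ℂ] H)}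
    (h : Ω.IsHarmonicCalculus A Γ) (h' : Ω.IsHarmonicCalculus A Γ') : Γ = Γ' := by
  refine DFunLike.coe_injective (denseRange_harmonicSum.equalizer Γ.continuous Γ'.continuous ?_)
  ext1 ⟨f, k⟩
  rw [Function.comp_apply, Function.comp_apply, harmonicSum_eq_addStar, h, h']

end SmoothlyBoundedSet

end

theorem proposition3p4 {H : Type*} [NormedAddCommGroup H] [InnerProductSpace ℂ H]
    [CompleteSpace H] [Nontrivial H] (A : H →L[ℂ] H) (Ω : SmoothlyBoundedSet)
    (hA : spectrum ℂ A ⊆ Ω.carrier) (hΩ : Convex ℝ Ω.carrier) :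
    (∃! K : C(Ω.bdry, ℂ) →L[ℂ] Ω.harmonicSpace, Ω.IsInteriorDoubleLayerTransform K) ∧
    (∃! Γ : Ω.harmonicSpace →L[ℂ] (H →L[ℂ] H), Ω.IsHarmonicCalculus A Γ) ∧
    ∀ (K : C(Ω.bdry, ℂ) →L[ℂ] Ω.harmonicSpace) (Γ : Ω.harmonicSpace →L[ℂ] (H →L[ℂ] H)),
      Ω.IsInteriorDoubleLayerTransform K → Ω.IsHarmonicCalculus A Γ →
      List.TFAE
        [numericalRange A ⊆ closure Ω.carrier,
          IsPositiveMap (Γ.comp K),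
          ‖Γ.comp K‖ = 2] := by
  -- The spectrum of an operator on a nonzero complex Hilbert space is nonempty.
  have hne : Ω.carrier.Nonempty := (spectrum.nonempty A).mono hA
  have hK₀ := SmoothlyBoundedSet.isInteriorDoubleLayerTransform_doubleLayerTransform hΩ hne
  obtain ⟨Γ₀, hΓ₀⟩ := SmoothlyBoundedSet.exists_isHarmonicCalculus hΩ hne hA
  refine ⟨⟨_, hK₀, fun K hK => hK.unique hK₀⟩, ⟨Γ₀, hΓ₀, fun Γ hΓ => hΓ.unique hΓ₀⟩, ?_⟩
  intro K Γ hK hΓ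
  -- Uniqueness replaces `K` by the constructed transform, for which the kernel formula holds for
  -- every continuous `φ`, not just Hölder ones.
  obtain rfl := hK.unique hK₀
  exact SmoothlyBoundedSet.tfae_of_resolventKernel hΩ hne hA fun φ => hΓ.map_doubleLayerTransform hΩ hne hA φ
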